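/- **Setting.** Let $G$ be a group, $\Gamma\subset S\subset C_G(\Gamma)$ subgroups, where $C_G(\Gamma)$ is the commensurator of $\Gamma$ in $G$ ($G$ may be a locally compact group and $\Gamma$ discrete; the topology of $G$ plays no role here). An *$S$-$C^*$-algebra* is a $C^*$-algebra with an action of $S$ by $*$-automorphisms. For $S$-$C^*$-algebras $A,B$, an *$(A,B)$-$S$-bimodule* is a right Hilbert $C^*$-module $X$ over $B$ with a $*$-homomorphism from $A$ to the adjointable operators on $X$ and an action of $S$ on $X$ by linear maps with $s(axb)=s(a)s(x)s(b)$ and $\langle sx,sx'\rangle=s\langle x,x'\rangle$. An *$S$-anchored bi-$\Gamma$-set* is a set $V$ with commuting left and right $\Gamma$-actions and a map $m=m_V:V\to S$ with $m(\gamma v\delta)=\gamma m(v)\delta$. For two such sets $V,W$ let $V\times_\Gamma W$ be the quotient of $V\times W$ by $(v,w)\sim(v\gamma,\gamma^{-1}w)$, with $\gamma[v,w]=[\gamma v,w]$, $[v,w]\gamma=[v,w\gamma]$ and the anchor $[v,w]\mapsto m_V(v)m_W(w)$. $C_c(\,\cdot\,,\cdot\,)$ denotes finitely supported functions. $C_c(\Gamma,B)$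 is the convolution $*$-algebra with $(f*g)(\delta)=\sum_\gamma f(\gamma)\,\gamma(g(\gamma^{-1}\delta))$ and $f^*(\gamma)=\gamma(f(\gamma^{-1})^*)$, and $B\rtimes_r\Gamma$ is its completion in the operator norm of left convolution on $\ell^2(\Gamma,B)$. For an $(A,B)$-$S$-bimodule $X$, $C_c(V,X)$ is a $(C_c(\Gamma,A),C_c(\Gamma,B))$-bimodule with a $C_c(\Gamma,B)$-valued inner product, by $$(f*\Phi)(v)=\sum_\gamma f(\gamma)\,\gamma\Phi(\gamma^{-1}v),\qquad(\Phi*f)(v)=\sum_\gamma\Phi(v\gamma)\,m(v\gamma)(f(\gamma^{-1})),\qquad\langle\Phi,\Psi\rangle(\delta)=\sum_{v\in V}m(v)^{-1}\langle\Phi(v),\Psi(v\delta)\rangle .$$ Write $E(V,X)$ for its completion, a Hilbert $C^*$-module over $B\rtimes_r\Gamma$. **Proposition.** Let $A,B,C$ be $S$-$C^*$-algebras, $V,W$ $S$-anchored bi-$\Gamma$-sets, $X$ an $(A,B)$-$S$-bimodule and $Y$ a $(B,C)$-$S$-bimodule. Let $X\otimes_BY$ be the interior tensor product, an $(A,C)$-$S$-bimodule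 with the diagonal action of $S$. Equip the algebraic balanced tensor product $C_c(V,X)\otimes^{\mathrm{alg}}_{C_c(\Gamma,B)}C_c(W,Y)$ with the actions $f*(\Phi\otimes\Psi)=(f*\Phi)\otimes\Psi$ of $C_c(\Gamma,A)$ and $(\Phi\otimes\Psi)*f=\Phi\otimes(\Psi*f)$ of $C_c(\Gamma,C)$ and the form $\langle\Phi\otimes\Psi,\Phi'\otimes\Psi'\rangle=\langle\Psi,\langle\Phi,\Phi'\rangle*\Psi'\rangle$. 1. The formula (with finitely many non-zero summands) $$\alpha(\Phi\otimes\Psi)[v,w]=\sum_{\gamma\in\Gamma}\Phi(v\gamma)\otimes m(v)\gamma\Psi(\gamma^{-1}w)$$ gives a well-defined linear map $$\alpha:C_c(V,X)\otimes^{\mathrm{alg}}_{C_c(\Gamma,B)}C_c(W,Y)\to C_c(V\times_\Gamma W,X\otimes_BY)$$ that is a map of $(C_c(\Gamma,A),C_c(\Gamma,C))$-bimodules, preserves the $C_c(\Gamma,C)$-valued inner products, and has range dense in $E(V\times_\Gamma W,X\otimes_BY)$. 2. The left convolution actions extend to actions by adjointable operators ($*$-homomorphisms) of $A\rtimes_r\Gamma$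 on $E(V,X)$ and on $E(V\times_\Gamma W,X\otimes_BY)$, and of $B\rtimes_r\Gamma$ on $E(W,Y)$. The canonical map $j$, $\Phi\otimes\Psi\mapsto\Phi\otimes\Psi$, from the algebraic balanced tensor product to the interior tensor product $E(V,X)\otimes_{B\rtimes_r\Gamma}E(W,Y)$ is a well-defined bimodule map that preserves the inner products and has dense range, so that the latter is the $C^*$-module completion of the former. There is a unitary isomorphism $$U:E(V,X)\otimes_{B\rtimes_r\Gamma}E(W,Y)\to E(V\times_\Gamma W,X\otimes_BY)$$ of $(A\rtimes_r\Gamma,C\rtimes_r\Gamma)$-bimodules with $U\circ j=\alpha$. -/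

import Mathlib

open scoped TensorProduct
open MulOpposite (op unop)

noncomputable section

/-! ### Hilbert C*-modules and their completions -/

/-- A (right) Hilbert C*-module over the C*-algebra `B`: a Banach space with a right action of `B`
(written `rsmul x b`) and a `B`-valued inner product, linear in the second variable, that induces
the norm. Positivity is written as `ip x x = b* b`. The algebraic laws of the right action follow
from `ip_rsmul_right`, because the inner product is definite. -/
class HilbertModule (B X : Type*) [NonUnitalCStarAlgebra B] [NormedAddCommGroup X]
    [NormedSpace ℂ X] [CompleteSpace X] where
  rsmul : X → B → X
  ip : X → X → B
  ip_add_right : ∀ x y z, ip x (y + z) = ip x y + ip x z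
  ip_smul_right : ∀ (c : ℂ) x y, ip x (c • y) = c • ip x y
  ip_rsmul_right : ∀ x y b, ip x (rsmul y b) = ip x y * b
  star_ip : ∀ x y, star (ip x y) = ip y x
  ip_self_pos : ∀ x, ∃ b, ip x x = star b * b
  norm_sq : ∀ x, ‖x‖ ^ 2 = ‖ip x x‖

/-- A `B`-valued positive semidefinite inner product on a complex vector space `E`, compatible with
a right action of a dense part of `B`. -/
structure PreHilbert (B E : Type*) [NonUnitalCStarAlgebra B] [AddCommGroup E] [Module ℂ E] where
  ip : E → E → B
  ip_add_right : ∀ x y z, ip x (y + z) = ip x y + ip x z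
  ip_smul_right : ∀ (c : ℂ) x y, ip x (c • y) = c • ip x y
  star_ip : ∀ x y, star (ip x y) = ip y x
  ip_self_pos : ∀ x, ∃ b, ip x x = star b * b
  dense_right : Dense {b : B | ∀ y, ∃ z, ∀ x, ip x z = ip x y * b}

theorem exists_star_mul_iff {B : Type*} [NonUnitalCStarAlgebra B] [PartialOrder B]
    [StarOrderedRing B] {a : B} : (∃ b, a = star b * b) ↔ 0 ≤ a :=
  CStarAlgebra.nonneg_iff_eq_star_mul_self.symm

namespace PreHilbert

section basic

variable {B E : Type*} [NonUnitalCStarAlgebra B] [AddCommGroup E] [Module ℂ E]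
  (P : PreHilbert B E)

theorem ip_add_left (x y z : E) : P.ip (x + y) z = P.ip x z + P.ip y z := by
  rw [← P.star_ip, P.ip_add_right, star_add, P.star_ip, P.star_ip]

theorem ip_smul_left (c : ℂ) (x y : E) : P.ip (c • x) y = star c • P.ip x y := by
  rw [← P.star_ip, P.ip_smul_right, star_smul, P.star_ip]

/-- The inner product as a sesquilinear map. -/
def ipₛₗ : E →ₗ⋆[ℂ] E →ₗ[ℂ] B :=
  LinearMap.mk₂'ₛₗ (starRingEnd ℂ) (RingHom.id ℂ) P.ip P.ip_add_left P.ip_smul_left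
    P.ip_add_right P.ip_smul_right

theorem ipₛₗ_apply (x y : E) : P.ipₛₗ x y = P.ip x y := rfl

theorem ip_sub_right (x y z : E) : P.ip x (y - z) = P.ip x y - P.ip x z :=
  map_sub (P.ipₛₗ x) y z

theorem ip_sub_left (x y z : E) : P.ip (x - y) z = P.ip x z - P.ip y z := by
  simp [← ipₛₗ_apply]

theorem norm_ip_comm (x y : E) : ‖P.ip x y‖ = ‖P.ip y x‖ := by
  rw [← P.star_ip, norm_star]

theorem norm_ip_sq_le (x y : E) : ‖P.ip x y‖ ^ 2 ≤ ‖P.ip x x‖ * ‖P.ip y y‖ := by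
  let _ := CStarAlgebra.spectralOrder B
  have := CStarAlgebra.spectralOrderedRing B
  have key : ∀ b : B, 0 ≤ star b * P.ip x x * b - star b * P.ip x y - P.ip y x * b + P.ip y y := by
    intro b
    have hcl : IsClosed {b : B |
        0 ≤ star b * P.ip x x * b - star b * P.ip x y - P.ip y x * b + P.ip y y} :=
      isClosed_le continuous_const (by fun_prop)
    refine hcl.closure_subset_iff.2 ?_ (P.dense_right b)
    intro d hd
    obtain ⟨z, hz⟩ := hd x
    have hz' : ∀ w, P.ip z w = star d * P.ip x w := fun w => by
      rw [← P.star_ip, hz, star_mul, P.star_ip]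
    have h0 := exists_star_mul_iff.1 (P.ip_self_pos (z - y))
    simp only [P.ip_sub_left, P.ip_sub_right, hz, hz'] at h0
    simp only [Set.mem_ofPred_eq]
    convert h0 using 1
    abel
  set c := P.ip y x * P.ip x y with hc
  have hxy : star (P.ip x y) = P.ip y x := P.star_ip x y
  have hc0 : 0 ≤ c := by rw [hc, ← hxy]; exact star_mul_self_nonneg _
  have hcn : ‖c‖ = ‖P.ip x y‖ ^ 2 := by rw [hc, ← hxy, CStarRing.norm_star_mul_self, sq]
  have hsa : IsSelfAdjoint (P.ip x x) := P.star_ip x x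
  have hb : P.ip y x * P.ip x x * P.ip x y ≤ ‖P.ip x x‖ • c := by
    rw [hc, ← hxy]; exact CStarAlgebra.star_left_conjugate_le_norm_smul
  have main : ∀ t : ℝ, 0 ≤ t → t * ‖P.ip x x‖ ≤ 1 → t * ‖P.ip x y‖ ^ 2 ≤ ‖P.ip y y‖ := by
    intro t ht htN
    have h1 := key (t • P.ip x y)
    have h2 : 0 ≤ (t ^ 2) • (P.ip y x * P.ip x x * P.ip x y) - (2 * t) • c + P.ip y y := by
      convert h1 using 1
      simp only [star_smul, hxy, smul_mul_assoc, mul_smul_comm, star_trivial, hc, smul_smul, two_mul,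
        add_smul, sq]
      abel
    have h3 : (t ^ 2) • (P.ip y x * P.ip x x * P.ip x y) ≤ t • c := by
      calc _ ≤ (t ^ 2) • (‖P.ip x x‖ • c) := smul_le_smul_of_nonneg_left hb (by positivity)
        _ = (t * (t * ‖P.ip x x‖)) • c := by rw [smul_smul]; ring_nf
        _ ≤ (t * 1) • c := smul_le_smul_of_nonneg_right (by gcongr) hc0
        _ = t • c := by rw [mul_one]
    have h4 : t • c ≤ P.ip y y := by
      have h5 : (2 * t) • c ≤ t • c + P.ip y y := by
        have h6 := h2.trans (add_le_add_left (sub_le_sub_right h3 _) _)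
        have h7 : t • c - (2 * t) • c + P.ip y y = (t • c + P.ip y y) - (2 * t) • c := by abel
        rw [h7] at h6
        exact sub_nonneg.1 h6
      rw [two_mul, add_smul] at h5
      exact le_of_add_le_add_left h5
    have h5 := CStarAlgebra.norm_le_norm_of_nonneg_of_le (smul_nonneg ht hc0) h4
    rwa [norm_smul, Real.norm_of_nonneg ht, hcn] at h5
  rcases (norm_nonneg (P.ip x x)).eq_or_lt with h | h
  · by_contra hcon
    rw [← h, zero_mul, not_le] at hcon
    have := main ((‖P.ip y y‖ + 1) / ‖P.ip x y‖ ^ 2) (by positivity) (by rw [← h]; simp)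
    rw [div_mul_cancel₀ _ hcon.ne'] at this
    linarith
  · have := main (‖P.ip x x‖⁻¹) (by positivity) (by rw [inv_mul_cancel₀ h.ne'])
    rwa [inv_mul_le_iff₀ h] at this

theorem norm_ip_le (x y : E) : ‖P.ip x y‖ ≤ √‖P.ip x x‖ * √‖P.ip y y‖ := by
  rw [← Real.sqrt_mul (norm_nonneg _)]
  exact Real.le_sqrt_of_sq_le (P.norm_ip_sq_le x y)

/-- The vector space `E` with the seminorm of the inner product `P`. -/
@[nolint unusedArguments]
def Carrier (_ : PreHilbert B E) : Type _ := E

instance : AddCommGroup P.Carrier := inferInstanceAs (AddCommGroup E)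
instance : Module ℂ P.Carrier := inferInstanceAs (Module ℂ E)
instance : Norm P.Carrier := ⟨fun x => √‖P.ip x x‖⟩

theorem seminormedCore : SeminormedSpace.Core ℂ P.Carrier where
  norm_nonneg x := Real.sqrt_nonneg _
  norm_smul c := fun (x : E) => by
    change √‖P.ip (c • x) (c • x)‖ = _ * √‖P.ip x x‖
    have : P.ip (c • x) (c • x) = (star c * c) • P.ip x x := by
      rw [P.ip_smul_left, P.ip_smul_right, smul_smul]
    rw [this, norm_smul, Real.sqrt_mul (norm_nonneg _), CStarRing.norm_star_mul_self,
      Real.sqrt_mul_self (norm_nonneg _)]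
  norm_triangle := fun (x y : E) => by
    change √‖P.ip (x + y) (x + y)‖ ≤ √‖P.ip x x‖ + √‖P.ip y y‖
    refine Real.sqrt_le_iff.2 ⟨by positivity, ?_⟩
    have h1 : P.ip (x + y) (x + y) = P.ip x x + P.ip x y + (P.ip y x + P.ip y y) := by
      rw [P.ip_add_left, P.ip_add_right, P.ip_add_right]
    rw [h1]
    have h2 := P.norm_ip_le x y
    have h3 := P.norm_ip_comm y x
    have h4 := Real.sq_sqrt (norm_nonneg (P.ip x x))
    have h5 := Real.sq_sqrt (norm_nonneg (P.ip y y))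
    calc _ ≤ (‖P.ip x x‖ + ‖P.ip x y‖) + (‖P.ip y x‖ + ‖P.ip y y‖) :=
          (norm_add_le _ _).trans (add_le_add (norm_add_le _ _) (norm_add_le _ _))
      _ ≤ _ := by nlinarith

instance : SeminormedAddCommGroup P.Carrier := SeminormedAddCommGroup.ofCore P.seminormedCore
instance : NormedSpace ℂ P.Carrier where
  norm_smul_le c x := (P.seminormedCore.norm_smul c x).le

/-- The identity map of `E`, with values in the seminormed space. -/
def toCarrier : E →ₗ[ℂ] P.Carrier where
  toFun x := x
  map_add' _ _ := rfl
  map_smul' _ _ := rfl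

/-- The inner product on the seminormed space. -/
def cipₛₗ : P.Carrier →ₗ⋆[ℂ] P.Carrier →ₗ[ℂ] B :=
  LinearMap.mk₂'ₛₗ (starRingEnd ℂ) (RingHom.id ℂ) (fun x y : P.Carrier => P.ip x y)
    P.ip_add_left P.ip_smul_left P.ip_add_right P.ip_smul_right

theorem norm_toCarrier (x : E) : ‖P.toCarrier x‖ = √‖P.ip x x‖ := rfl

/-- The completion of `E` in the norm `‖x‖ = ‖ip x x‖ ^ (1/2)` (null vectors are divided out). -/
def Completion : Type _ := UniformSpace.Completion P.Carrier

instance : NormedAddCommGroup P.Completion :=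
  inferInstanceAs (NormedAddCommGroup (UniformSpace.Completion P.Carrier))
instance : NormedSpace ℂ P.Completion :=
  inferInstanceAs (NormedSpace ℂ (UniformSpace.Completion P.Carrier))
instance : CompleteSpace P.Completion :=
  inferInstanceAs (CompleteSpace (UniformSpace.Completion P.Carrier))

/-- The canonical map of `E` to its completion. -/
def toCompletion : E →ₗ[ℂ] P.Completion :=
  (UniformSpace.Completion.toComplₗᵢ (𝕜 := ℂ) (E := P.Carrier)).toLinearMap ∘ₗ P.toCarrier

theorem norm_toCompletion (x : E) : ‖P.toCompletion x‖ = √‖P.ip x x‖ :=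
  (UniformSpace.Completion.norm_coe _).trans (P.norm_toCarrier x)

theorem denseRange_toCompletion : DenseRange P.toCompletion :=
  UniformSpace.Completion.denseRange_coe (α := P.Carrier)

theorem continuous_cipₛₗ : Continuous fun p : P.Carrier × P.Carrier => P.cipₛₗ p.1 p.2 := by
  let F : P.Carrier →L⋆[ℂ] P.Carrier →L[ℂ] B :=
    P.cipₛₗ.mkContinuous₂ 1 (fun x y => by rw [one_mul]; exact P.norm_ip_le x y)
  exact (F.continuous.comp continuous_fst).clm_apply continuous_snd

/-- The continuous extension of the inner product to the completion. -/
def cip : P.Completion → P.Completion → B :=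
  Function.curry ((UniformSpace.Completion.isDenseInducing_coe.prodMap
    UniformSpace.Completion.isDenseInducing_coe).extend
      (fun p : P.Carrier × P.Carrier => P.cipₛₗ p.1 p.2))

theorem cip_coe (x y : E) : P.cip (P.toCompletion x) (P.toCompletion y) = P.ip x y :=
  (UniformSpace.Completion.isDenseInducing_coe.prodMap
    UniformSpace.Completion.isDenseInducing_coe).extend_eq P.continuous_cipₛₗ
      (P.toCarrier x, P.toCarrier y)

theorem continuous_cip : Continuous fun p : P.Completion × P.Completion => P.cip p.1 p.2 := by
  let f : P.Carrier →+ P.Carrier →+ B :=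
    { toFun := fun x => (P.cipₛₗ x).toAddMonoidHom
      map_zero' := by ext; simp
      map_add' := fun x y => by ext; simp }
  have h : Continuous fun p : P.Carrier × P.Carrier => f p.1 p.2 := P.continuous_cipₛₗ
  have h' := (UniformSpace.Completion.isDenseInducing_toCompl P.Carrier).extend_Z_bilin
    (UniformSpace.Completion.isDenseInducing_toCompl P.Carrier) h
  exact h'

theorem ind {p : P.Completion → Prop} (hp : IsClosed {x | p x})
    (ih : ∀ x, p (P.toCompletion x)) (x : P.Completion) : p x :=
  P.denseRange_toCompletion.induction_on x hp ih

theorem ind₂ {p : P.Completion → P.Completion → Prop}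
    (hp : IsClosed {x : P.Completion × P.Completion | p x.1 x.2})
    (ih : ∀ x y, p (P.toCompletion x) (P.toCompletion y)) (x y : P.Completion) : p x y :=
  P.denseRange_toCompletion.induction_on₂ hp ih x y

theorem ind₃ {p : P.Completion → P.Completion → P.Completion → Prop}
    (hp : IsClosed {x : P.Completion × P.Completion × P.Completion | p x.1 x.2.1 x.2.2})
    (ih : ∀ x y z, p (P.toCompletion x) (P.toCompletion y) (P.toCompletion z))
    (x y z : P.Completion) : p x y z :=
  P.denseRange_toCompletion.induction_on₃ hp ih x y z

theorem continuous_cip_comp {T : Type*} [TopologicalSpace T] {f g : T → P.Completion}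
    (hf : Continuous f) (hg : Continuous g) : Continuous fun t => P.cip (f t) (g t) :=
  P.continuous_cip.comp (hf.prodMk hg)

theorem cip_add_right (x y z : P.Completion) : P.cip x (y + z) = P.cip x y + P.cip x z := by
  refine P.ind₃ (p := fun x y z => P.cip x (y + z) = P.cip x y + P.cip x z)
    (isClosed_eq (P.continuous_cip_comp (by fun_prop) (by fun_prop))
      ((P.continuous_cip_comp (by fun_prop) (by fun_prop)).add
        (P.continuous_cip_comp (by fun_prop) (by fun_prop)))) (fun x y z => ?_) x y z
  rw [← map_add, cip_coe, cip_coe, cip_coe, P.ip_add_right]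

theorem cip_smul_right (c : ℂ) (x y : P.Completion) : P.cip x (c • y) = c • P.cip x y := by
  refine P.ind₂ (p := fun x y => P.cip x (c • y) = c • P.cip x y)
    (isClosed_eq (P.continuous_cip_comp continuous_fst (continuous_snd.const_smul c))
      ((P.continuous_cip_comp continuous_fst continuous_snd).const_smul c)) (fun x y => ?_) x y
  rw [← map_smul, cip_coe, cip_coe, P.ip_smul_right]

theorem star_cip (x y : P.Completion) : star (P.cip x y) = P.cip y x := by
  refine P.ind₂ (p := fun x y => star (P.cip x y) = P.cip y x)
    (isClosed_eq (P.continuous_cip_comp continuous_fst continuous_snd).star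
      (P.continuous_cip_comp (by fun_prop) (by fun_prop))) (fun x y => ?_) x y
  rw [cip_coe, cip_coe, P.star_ip]

theorem cip_self_pos (x : P.Completion) : ∃ b, P.cip x x = star b * b := by
  let _ := CStarAlgebra.spectralOrder B
  have := CStarAlgebra.spectralOrderedRing B
  rw [exists_star_mul_iff]
  refine P.ind (p := fun x => 0 ≤ P.cip x x)
    (isClosed_le continuous_const (P.continuous_cip_comp (by fun_prop) (by fun_prop)))
    (fun x => ?_) x
  rw [cip_coe]
  exact exists_star_mul_iff.1 (P.ip_self_pos x)

theorem norm_sq_cip (x : P.Completion) : ‖x‖ ^ 2 = ‖P.cip x x‖ := by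
  refine P.ind (p := fun x => ‖x‖ ^ 2 = ‖P.cip x x‖)
    (isClosed_eq (by fun_prop) (P.continuous_cip_comp (by fun_prop) (by fun_prop)).norm)
    (fun x => ?_) x
  rw [cip_coe, norm_toCompletion, Real.sq_sqrt (norm_nonneg _)]

theorem norm_cip_le (x y : P.Completion) : ‖P.cip x y‖ ≤ ‖x‖ * ‖y‖ := by
  refine P.ind₂ (p := fun x y => ‖P.cip x y‖ ≤ ‖x‖ * ‖y‖)
    (isClosed_le (P.continuous_cip_comp (by fun_prop) (by fun_prop)).norm (by fun_prop))
    (fun x y => ?_) x y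
  rw [cip_coe, norm_toCompletion, norm_toCompletion]
  exact P.norm_ip_le x y

theorem cip_sub_right (x y z : P.Completion) : P.cip x (y - z) = P.cip x y - P.cip x z := by
  rw [eq_sub_iff_add_eq, ← cip_add_right, sub_add_cancel]

theorem exists_rsmul (y : P.Completion) (b : B) :
    ∃ z, ∀ x, P.cip x z = P.cip x y * b := by
  -- a limit of solvable equations is solvable
  have lim : ∀ (u : ℕ → P.Completion) (y : P.Completion) (v : ℕ → B) (b : B),
      Filter.Tendsto u Filter.atTop (nhds y) → Filter.Tendsto v Filter.atTop (nhds b) →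
      (∀ m n, ∃ z, ∀ x, P.cip x z = P.cip x (u m) * v n) →
      ((∀ n, v n = b) ∨ (∀ n, u n = y)) → ∃ z, ∀ x, P.cip x z = P.cip x y * b := by
    intro u y v b hu hv hz hor
    choose z hz using fun n => hz n n
    have hdist : ∀ m n, dist (z m) (z n) ≤ dist (u m) (u n) * ‖b‖ + ‖y‖ * dist (v m) (v n) := by
      intro m n
      rw [dist_eq_norm, dist_eq_norm, dist_eq_norm]
      set w := z m - z n with hw
      have h1 : P.cip w w = P.cip w (u m) * v m - P.cip w (u n) * v n := by
        conv_lhs => rw [hw]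
        rw [← hw, P.cip_sub_right, hz, hz]
      have h2 : ‖P.cip w w‖ ≤ ‖w‖ * (‖u m - u n‖ * ‖b‖ + ‖y‖ * ‖v m - v n‖) := by
        rcases hor with h | h
        · rw [h1, h, h, ← sub_mul, ← cip_sub_right]
          calc _ ≤ ‖P.cip w (u m - u n)‖ * ‖b‖ := norm_mul_le _ _
            _ ≤ (‖w‖ * ‖u m - u n‖) * ‖b‖ := by gcongr; exact P.norm_cip_le _ _
            _ = _ := by simp; ring
        · rw [h1, h, h, ← mul_sub]
          calc _ ≤ ‖P.cip w y‖ * ‖v m - v n‖ := norm_mul_le _ _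
            _ ≤ (‖w‖ * ‖y‖) * ‖v m - v n‖ := by gcongr; exact P.norm_cip_le _ _
            _ = _ := by simp; ring
      rw [← norm_sq_cip, sq] at h2
      rcases (norm_nonneg w).eq_or_lt with h0 | h0
      · rw [← h0]; positivity
      · exact le_of_mul_le_mul_left h2 h0
    have hc : CauchySeq z := by
      have hcu := hu.cauchySeq
      have hcv := hv.cauchySeq
      rw [Metric.cauchySeq_iff] at hcu hcv ⊢
      intro ε hε
      obtain ⟨N, hN⟩ := hcu (ε / (2 * (‖b‖ + 1))) (by positivity)
      obtain ⟨M, hM⟩ := hcv (ε / (2 * (‖y‖ + 1))) (by positivity)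
      refine ⟨max N M, fun m hm n hn => (hdist m n).trans_lt ?_⟩
      have e1 := hN m (le_of_max_le_left hm) n (le_of_max_le_left hn)
      have e2 := hM m (le_of_max_le_right hm) n (le_of_max_le_right hn)
      rw [lt_div_iff₀ (by positivity)] at e1 e2
      have d1 : 0 ≤ dist (u m) (u n) := dist_nonneg
      have d2 : 0 ≤ dist (v m) (v n) := dist_nonneg
      nlinarith
    obtain ⟨z0, hz0⟩ := cauchySeq_tendsto_of_complete hc
    refine ⟨z0, fun x => ?_⟩
    have t1 : Filter.Tendsto (fun n => P.cip x (z n)) Filter.atTop (nhds (P.cip x z0)) :=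
      ((P.continuous_cip_comp continuous_const continuous_id).tendsto z0).comp hz0
    have t2 : Filter.Tendsto (fun n => P.cip x (u n) * v n) Filter.atTop
        (nhds (P.cip x y * b)) :=
      (((P.continuous_cip_comp continuous_const continuous_id).tendsto y).comp hu).mul hv
    refine tendsto_nhds_unique t1 (t2.congr fun n => (hz n x).symm)
  have step1 : ∀ y : P.Completion, ∀ b ∈ {b : B | ∀ y, ∃ z, ∀ x, P.ip x z = P.ip x y * b},
      ∃ z, ∀ x, P.cip x z = P.cip x y * b := by
    intro y b hb
    obtain ⟨u, hu, hu'⟩ := mem_closure_iff_seq_limit.1 (P.denseRange_toCompletion y)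
    refine lim u y (fun _ => b) b hu' tendsto_const_nhds (fun m _ => ?_) (Or.inl fun _ => rfl)
    obtain ⟨w, hw⟩ := hu m
    obtain ⟨z, hz⟩ := hb w
    refine ⟨P.toCompletion z, fun x => ?_⟩
    rw [← hw]
    refine P.ind (p := fun x => P.cip x (P.toCompletion z) = P.cip x (P.toCompletion w) * b)
      (isClosed_eq (P.continuous_cip_comp (by fun_prop) (by fun_prop))
        ((P.continuous_cip_comp (by fun_prop) (by fun_prop)).mul continuous_const))
      (fun x => ?_) x
    rw [cip_coe, cip_coe, hz]
  obtain ⟨v, hv, hv'⟩ := mem_closure_iff_seq_limit.1 (P.dense_right b)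
  exact lim (fun _ => y) y v b tendsto_const_nhds hv' (fun _ n => step1 y (v n) (hv n))
    (Or.inr fun _ => rfl)

/-- The completion is a Hilbert C*-module: the inner product is the continuous extension, and
`rsmul y b` is the vector `z` (unique by definiteness) with `⟨x, z⟩ = ⟨x, y⟩ b` for all `x`. -/
instance : HilbertModule B P.Completion where
  rsmul y b := (P.exists_rsmul y b).choose
  ip := P.cip
  ip_add_right := P.cip_add_right
  ip_smul_right := P.cip_smul_right
  ip_rsmul_right x y b := (P.exists_rsmul y b).choose_spec x
  star_ip := P.star_cip
  ip_self_pos := P.cip_self_pos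
  norm_sq := P.norm_sq_cip

end basic

end PreHilbert

end

noncomputable section

namespace HilbertModule

section basic

variable {B X : Type*} [NonUnitalCStarAlgebra B] [NormedAddCommGroup X] [NormedSpace ℂ X]
  [CompleteSpace X] [HilbertModule B X]

variable (B X) in
/-- A Hilbert C*-module, viewed as a space with a positive inner product. -/
def toPreHilbert : PreHilbert B X where
  ip := ip
  ip_add_right := ip_add_right
  ip_smul_right := ip_smul_right
  star_ip := star_ip
  ip_self_pos := ip_self_pos
  dense_right := dense_univ.mono fun b _ y => ⟨rsmul y b, fun x => ip_rsmul_right x y b⟩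

theorem ip_add_left (x y z : X) : ip (B := B) (x + y) z = ip x z + ip y z :=
  (toPreHilbert B X).ip_add_left x y z

theorem ip_smul_left (c : ℂ) (x y : X) : ip (B := B) (c • x) y = star c • ip x y :=
  (toPreHilbert B X).ip_smul_left c x y

theorem ip_sub_right (x y z : X) : ip (B := B) x (y - z) = ip x y - ip x z :=
  (toPreHilbert B X).ip_sub_right x y z

theorem ip_zero_right (x : X) : ip (B := B) x 0 = 0 := by
  simpa using ip_sub_right (B := B) x 0 0

theorem ip_zero_left (x : X) : ip (B := B) 0 x = 0 := by
  rw [← star_ip, ip_zero_right, star_zero]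

theorem norm_eq_sqrt (x : X) : ‖x‖ = √‖ip (B := B) x x‖ := by
  rw [← norm_sq, Real.sqrt_sq (norm_nonneg _)]

theorem norm_ip_le (x y : X) : ‖ip (B := B) x y‖ ≤ ‖x‖ * ‖y‖ := by
  rw [norm_eq_sqrt (B := B) x, norm_eq_sqrt (B := B) y]
  exact (toPreHilbert B X).norm_ip_le x y

theorem ip_self_eq_zero {x : X} (h : ip (B := B) x x = 0) : x = 0 := by
  rw [← norm_eq_zero, norm_eq_sqrt (B := B), h, norm_zero, Real.sqrt_zero]

variable (B) in
theorem ext_ip {y z : X} (h : ∀ x, ip (B := B) x y = ip x z) : y = z := by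
  rw [← sub_eq_zero]
  refine ip_self_eq_zero (B := B) ?_
  rw [ip_sub_right, h, sub_self]

theorem rsmul_mul (x : X) (a b : B) : rsmul x (a * b) = rsmul (rsmul x a) b :=
  ext_ip B fun w => by simp only [ip_rsmul_right, mul_assoc]

theorem ip_rsmul_left (x y : X) (b : B) : ip (rsmul x b) y = star b * ip x y := by
  rw [← star_ip, ip_rsmul_right, star_mul, star_ip]

end basic

/-- A C*-algebra is a Hilbert C*-module over itself, with `⟨a, b⟩ = a* b`. -/
instance self (B : Type*) [NonUnitalCStarAlgebra B] : HilbertModule B B where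
  rsmul x b := x * b
  ip x y := star x * y
  ip_add_right _ _ _ := mul_add _ _ _
  ip_smul_right _ _ _ := mul_smul_comm _ _ _
  ip_rsmul_right _ _ _ := (mul_assoc _ _ _).symm
  star_ip _ _ := by rw [star_mul, star_star]
  ip_self_pos x := ⟨x, rfl⟩
  norm_sq x := by rw [CStarRing.norm_star_mul_self, sq]

end HilbertModule

open HilbertModule in
/-- The algebra of adjointable operators of the Hilbert `B`-module `X`, with the operator norm. -/
def adjointable (B X : Type*) [NonUnitalCStarAlgebra B] [NormedAddCommGroup X] [NormedSpace ℂ X]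
    [CompleteSpace X] [HilbertModule B X] : Subalgebra ℂ (X →L[ℂ] X) where
  carrier := {T | ∃ S : X →L[ℂ] X, ∀ x y, ip (B := B) (T x) y = ip x (S y)}
  mul_mem' {S T} := by
    rintro ⟨S', hS⟩ ⟨T', hT⟩
    refine ⟨T' * S', fun x y => ?_⟩
    change ip (B := B) (S (T x)) y = ip x (T' (S' y))
    rw [hS, hT]
  add_mem' {S T} := by
    rintro ⟨S', hS⟩ ⟨T', hT⟩
    refine ⟨S' + T', fun x y => ?_⟩
    change ip (B := B) (S x + T x) y = ip x (S' y + T' y)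
    rw [ip_add_left, ip_add_right, hS, hT]
  algebraMap_mem' c := by
    refine ⟨algebraMap ℂ _ (star c), fun x y => ?_⟩
    change ip (B := B) (c • x) y = ip x (star c • y)
    rw [ip_smul_left, ip_smul_right]

namespace adjointable

open HilbertModule

section basic

variable {B X : Type*} [NonUnitalCStarAlgebra B] [NormedAddCommGroup X] [NormedSpace ℂ X]
  [CompleteSpace X] [HilbertModule B X]

instance : CoeFun (adjointable B X) fun _ => X → X := ⟨fun T => ⇑T.1⟩

/-- An operator with an adjoint, as an element of `adjointable B X`. -/
def mk (T S : X →L[ℂ] X) (h : ∀ x y, ip (B := B) (T x) y = ip x (S y)) : adjointable B X := ⟨T, S, h⟩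

theorem ext_apply {S T : adjointable B X} (h : ∀ x, S x = T x) : S = T :=
  Subtype.ext (ContinuousLinearMap.ext h)

/-- The adjoint. -/
instance : Star (adjointable B X) where
  star T := mk T.2.choose T.1 fun x y => by
    rw [← star_ip, ← T.2.choose_spec, star_ip]

theorem ip_left (T : adjointable B X) (x y : X) : ip (B := B) (T x) y = ip x ((star T) y) :=
  T.2.choose_spec x y

theorem ip_right (T : adjointable B X) (x y : X) : ip (B := B) x (T y) = ip ((star T) x) y := by
  rw [← star_ip, ip_left, star_ip]

theorem star_eq_of_ip {T S : adjointable B X} (h : ∀ x y, ip (B := B) (T x) y = ip x (S y)) :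
    star T = S :=
  ext_apply fun y => ext_ip B fun x => by rw [← ip_left, h]

instance : StarRing (adjointable B X) where
  star_involutive T := star_eq_of_ip fun x y => (ip_right T x y).symm
  star_mul S T := star_eq_of_ip fun x y => by
    change ip (B := B) (S (T x)) y = ip x ((star T) ((star S) y))
    rw [ip_left, ip_left]
  star_add S T := star_eq_of_ip fun x y => by
    change ip (B := B) (S x + T x) y = ip x ((star S) y + (star T) y)
    rw [ip_add_left, ip_add_right, ip_left, ip_left]

instance : StarModule ℂ (adjointable B X) where
  star_smul c T := star_eq_of_ip fun x y => by
    change ip (B := B) (c • T x) y = ip x (star c • (star T) y)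
    rw [ip_smul_left, ip_smul_right, ip_left]

theorem norm_sq_le (T : adjointable B X) : ‖T‖ * ‖T‖ ≤ ‖star T * T‖ := by
  have h : ‖T‖ ≤ √‖star T * T‖ := by
    refine ContinuousLinearMap.opNorm_le_bound _ (Real.sqrt_nonneg _) fun x => ?_
    change ‖T x‖ ≤ _
    rw [norm_eq_sqrt (B := B) (T x), norm_eq_sqrt (B := B) x]
    refine (Real.sqrt_le_sqrt ?_).trans_eq (Real.sqrt_mul (norm_nonneg _) _)
    have h1 : ip (B := B) (T x) (T x) = ip x ((star T * T : adjointable B X) x) := ip_left T x (T x)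
    calc ‖ip (B := B) (T x) (T x)‖ ≤ ‖x‖ * ‖(star T * T : adjointable B X) x‖ := by
          rw [h1]; exact norm_ip_le _ _
      _ ≤ ‖x‖ * (‖star T * T‖ * ‖x‖) := by
          gcongr; exact (star T * T : adjointable B X).1.le_opNorm x
      _ = ‖star T * T‖ * ‖ip (B := B) x x‖ := by rw [← norm_sq]; ring
  calc ‖T‖ * ‖T‖ ≤ √‖star T * T‖ * √‖star T * T‖ := by gcongr
    _ = _ := Real.mul_self_sqrt (norm_nonneg _)

instance : CStarRing (adjointable B X) := ⟨fun {T} => norm_sq_le T⟩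

theorem isClosed : IsClosed (adjointable B X : Set (X →L[ℂ] X)) := by
  refine IsSeqClosed.isClosed fun u T hu hT => ?_
  let v : ℕ → adjointable B X := fun n => ⟨u n, hu n⟩
  have hc : CauchySeq fun n => (star (v n) : adjointable B X).1 := by
    have h := hT.cauchySeq
    rw [Metric.cauchySeq_iff] at h ⊢
    intro ε hε
    obtain ⟨N, hN⟩ := h ε hε
    refine ⟨N, fun m hm n hn => ?_⟩
    have h1 : dist (star (v m) : adjointable B X).1 (star (v n) : adjointable B X).1 = dist (v m) (v n) := by
      have h2 : star (v m) - star (v n) = star (v m - v n) := (star_sub _ _).symm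
      rw [← Subtype.dist_eq, dist_eq_norm, dist_eq_norm]
      exact (congrArg norm h2).trans (norm_star (v m - v n))
    rw [h1]
    exact hN m hm n hn
  obtain ⟨S, hS⟩ := cauchySeq_tendsto_of_complete hc
  refine ⟨S, fun x y => ?_⟩
  have hcont : ∀ x : X, Continuous fun y : X => ip (B := B) x y := fun x => by
    refine (LinearMap.mkContinuous ((toPreHilbert B X).ipₛₗ x) ‖x‖ fun y => ?_).continuous
    exact norm_ip_le x y
  have t1 := ((hcont y).tendsto _).comp (((ContinuousLinearMap.apply ℂ X x).continuous.tendsto T).comp hT)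
  have t2 := ((hcont x).tendsto _).comp (((ContinuousLinearMap.apply ℂ X y).continuous.tendsto S).comp hS)
  have t3 := t2.star
  refine star_injective ?_
  rw [star_ip]
  refine tendsto_nhds_unique t1 (t3.congr fun n => ?_)
  change star (ip (B := B) x ((star (v n)) y)) = ip y ((v n) x)
  rw [← ip_left, star_ip]

instance : CompleteSpace (adjointable B X) :=
  have : IsClosed (adjointable B X : Set (X →L[ℂ] X)) := adjointable.isClosed
  IsClosed.completeSpace_coe (s := (adjointable B X : Set (X →L[ℂ] X)))

instance : CStarAlgebra (adjointable B X) where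

end basic

end adjointable

/-- The C*-algebra of adjointable operators of the Hilbert `B`-module `X`. -/
def Adj (B X : Type*) [NonUnitalCStarAlgebra B] [NormedAddCommGroup X] [NormedSpace ℂ X]
    [CompleteSpace X] [HilbertModule B X] : Type _ := adjointable B X

namespace Adj

open HilbertModule

section basic

variable {B X : Type*} [NonUnitalCStarAlgebra B] [NormedAddCommGroup X] [NormedSpace ℂ X]
  [CompleteSpace X] [HilbertModule B X]

instance : CStarAlgebra (Adj B X) := inferInstanceAs (CStarAlgebra (adjointable B X))

/-- The underlying operator. -/
def toCLM (T : Adj B X) : X →L[ℂ] X := Subtype.val T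

instance : CoeFun (Adj B X) fun _ => X → X := ⟨fun T => ⇑T.toCLM⟩

/-- An operator with an adjoint, as an element of `Adj B X`. -/
def mk (T S : X →L[ℂ] X) (h : ∀ x y, ip (B := B) (T x) y = ip x (S y)) : Adj B X :=
  adjointable.mk T S h

theorem ext {S T : Adj B X} (h : S.toCLM = T.toCLM) : S = T := Subtype.ext h

theorem ext_apply {S T : Adj B X} (h : ∀ x, S x = T x) : S = T :=
  adjointable.ext_apply h

theorem ip_left (T : Adj B X) (x y : X) : ip (B := B) (T x) y = ip x ((star T) y) :=
  adjointable.ip_left T x y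

theorem ip_right (T : Adj B X) (x y : X) : ip (B := B) x (T y) = ip ((star T) x) y :=
  adjointable.ip_right T x y

theorem star_eq_of_ip {T S : Adj B X} (h : ∀ x y, ip (B := B) (T x) y = ip x (S y)) :
    star T = S :=
  adjointable.star_eq_of_ip h

end basic

end Adj

/-- A sufficient condition for positivity in a C*-algebra `D` represented on a space `F` with a
`B`-valued inner product. -/
theorem exists_star_mul_of_rep {D B F : Type*} [NonUnitalCStarAlgebra D] [NonUnitalCStarAlgebra B]
    [AddCommGroup F] (ip : F → F → B) (π : D → F → F)
    (ip_neg : ∀ x y, ip x (-y) = -ip x y)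
    (pos : ∀ x, ∃ b, ip x x = star b * b)
    (π_mul : ∀ a b x, π (a * b) x = π a (π b x))
    (π_neg : ∀ a x, π (-a) x = -π a x)
    (π_star : ∀ a x y, ip (π a x) y = ip x (π (star a) y))
    (inj : ∀ a, (∀ x, ip (π a x) (π a x) = 0) → a = 0)
    {T : D} (hT : star T = T) (h : ∀ x, ∃ b, ip x (π T x) = star b * b) :
    ∃ d, T = star d * d := by
  let _ := CStarAlgebra.spectralOrder D
  have := CStarAlgebra.spectralOrderedRing D
  let _ := CStarAlgebra.spectralOrder B
  have := CStarAlgebra.spectralOrderedRing B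
  rw [exists_star_mul_iff]
  have hsa : IsSelfAdjoint T := hT
  have hN : 0 ≤ T⁻ := CFC.negPart_nonneg T
  obtain ⟨R, hR⟩ := exists_star_mul_iff.2 hN
  have hNs : star T⁻ = T⁻ := (IsSelfAdjoint.of_nonneg hN)
  have hTN : T⁻ * T * T⁻ = -(star (R * T⁻) * (R * T⁻)) := by
    have h1 : T * T⁻ = -(T⁻ * T⁻) := by
      have h2 := CFC.posPart_sub_negPart T hsa
      have h3 : (T⁺ - T⁻) * T⁻ = -(T⁻ * T⁻) := by
        rw [sub_mul, CFC.posPart_mul_negPart, zero_sub]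
      rwa [h2] at h3
    rw [mul_assoc, h1, star_mul, hNs, mul_assoc, ← mul_assoc (star R), ← hR, mul_neg]
  have h0 : R * T⁻ = 0 := by
    refine inj _ fun x => ?_
    have e1 : 0 ≤ ip (π T⁻ x) (π T (π T⁻ x)) := exists_star_mul_iff.1 (h _)
    rw [π_star, hNs, ← π_mul, ← π_mul, hTN, π_neg, ip_neg, π_mul] at e1
    have e2 := π_star (R * T⁻) x (π (R * T⁻) x)
    rw [← e2] at e1
    exact le_antisymm (neg_nonneg.1 e1) (exists_star_mul_iff.1 (pos _))
  have h2 : T⁻ * T⁻ = 0 := by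
    nth_rw 1 [hR]; rw [mul_assoc, h0, mul_zero]
  have h3 : T⁻ = 0 := by
    rw [← CStarRing.star_mul_self_eq_zero_iff, hNs, h2]
  rw [← CFC.posPart_sub_negPart T hsa, h3, sub_zero]
  exact CFC.posPart_nonneg T

end

noncomputable section

set_option linter.unusedSectionVars false

/-! ### Extension of operators to completions -/

namespace PreHilbert

section lift

variable {B E C F : Type*} [NonUnitalCStarAlgebra B] [AddCommGroup E] [Module ℂ E]
  [NonUnitalCStarAlgebra C] [AddCommGroup F] [Module ℂ F]

/-- The continuous extension to the completions of a linear map (bounded for the norms of the two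
inner products). -/
def lift (P : PreHilbert B E) (Q : PreHilbert C F) (T : E →ₗ[ℂ] F) :
    P.Completion →L[ℂ] Q.Completion :=
  (Q.toCompletion ∘ₗ T).extendOfNorm P.toCompletion

theorem lift_coe (P : PreHilbert B E) (Q : PreHilbert C F) {T : E →ₗ[ℂ] F}
    (h : ∃ K, ∀ x, ‖Q.toCompletion (T x)‖ ≤ K * ‖P.toCompletion x‖) (x : E) :
    P.lift Q T (P.toCompletion x) = Q.toCompletion (T x) :=
  LinearMap.extendOfNorm_eq P.denseRange_toCompletion h x

theorem cip_lift (P : PreHilbert B E) (T T' : E →ₗ[ℂ] E)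
    (hT : ∃ K, ∀ x, ‖P.toCompletion (T x)‖ ≤ K * ‖P.toCompletion x‖)
    (hT' : ∃ K, ∀ x, ‖P.toCompletion (T' x)‖ ≤ K * ‖P.toCompletion x‖)
    (h : ∀ x y, P.ip (T x) y = P.ip x (T' y)) (x y : P.Completion) :
    P.cip (P.lift P T x) y = P.cip x (P.lift P T' y) := by
  refine P.ind₂ (p := fun x y => P.cip (P.lift P T x) y = P.cip x (P.lift P T' y))
    (isClosed_eq (P.continuous_cip_comp (by fun_prop) (by fun_prop))
      (P.continuous_cip_comp (by fun_prop) (by fun_prop))) (fun x y => ?_) x y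
  rw [lift_coe _ _ hT, lift_coe _ _ hT', cip_coe, cip_coe, h]

/-- The operator on the completion defined by a pair of bounded maps adjoint to each other. -/
def liftAdj (P : PreHilbert B E) (T T' : E →ₗ[ℂ] E)
    (hT : ∃ K, ∀ x, ‖P.toCompletion (T x)‖ ≤ K * ‖P.toCompletion x‖)
    (hT' : ∃ K, ∀ x, ‖P.toCompletion (T' x)‖ ≤ K * ‖P.toCompletion x‖)
    (h : ∀ x y, P.ip (T x) y = P.ip x (T' y)) : Adj B P.Completion :=
  Adj.mk (P.lift P T) (P.lift P T') (P.cip_lift T T' hT hT' h)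

theorem liftAdj_star (P : PreHilbert B E) (T T' : E →ₗ[ℂ] E)
    (hT : ∃ K, ∀ x, ‖P.toCompletion (T x)‖ ≤ K * ‖P.toCompletion x‖)
    (hT' : ∃ K, ∀ x, ‖P.toCompletion (T' x)‖ ≤ K * ‖P.toCompletion x‖)
    (h : ∀ x y, P.ip (T x) y = P.ip x (T' y)) (h' : ∀ x y, P.ip (T' x) y = P.ip x (T y)) :
    star (P.liftAdj T T' hT hT' h) = P.liftAdj T' T hT' hT h' :=
  Adj.star_eq_of_ip (P.cip_lift T T' hT hT' h)

theorem liftAdj_coe (P : PreHilbert B E) (T T' : E →ₗ[ℂ] E)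
    (hT : ∃ K, ∀ x, ‖P.toCompletion (T x)‖ ≤ K * ‖P.toCompletion x‖)
    (hT' : ∃ K, ∀ x, ‖P.toCompletion (T' x)‖ ≤ K * ‖P.toCompletion x‖)
    (h : ∀ x y, P.ip (T x) y = P.ip x (T' y)) (x : E) :
    P.liftAdj T T' hT hT' h (P.toCompletion x) = P.toCompletion (T x) :=
  lift_coe P P hT x

theorem clm_ext {P : PreHilbert B E} {G : Type*} [NormedAddCommGroup G] [NormedSpace ℂ G]
    {S T : P.Completion →L[ℂ] G} (h : ∀ x, S (P.toCompletion x) = T (P.toCompletion x)) :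
    S = T :=
  ContinuousLinearMap.ext fun x => P.ind (p := fun x => S x = T x)
    (isClosed_eq S.continuous T.continuous) h x

end lift

end PreHilbert

/-! ### Interior tensor products -/

namespace InteriorTensor

open HilbertModule

section positivity

variable {B X : Type*} [NonUnitalCStarAlgebra B] [NormedAddCommGroup X] [NormedSpace ℂ X]
  [CompleteSpace X] [HilbertModule B X]

theorem ip_sum_right {ι : Type*} (s : Finset ι) (x : X) (y : ι → X) :
    ip (B := B) x (∑ i ∈ s, y i) = ∑ i ∈ s, ip x (y i) :=
  map_sum ((toPreHilbert B X).ipₛₗ x) y s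

theorem ip_sum_left {ι : Type*} (s : Finset ι) (x : ι → X) (y : X) :
    ip (B := B) (∑ i ∈ s, x i) y = ∑ i ∈ s, ip (x i) y := by
  rw [← star_ip, ip_sum_right, star_sum]
  simp only [star_ip]

theorem exists_star_mul_sum {D ι : Type*} [NonUnitalCStarAlgebra D] (s : Finset ι) (a : ι → D)
    (h : ∀ i ∈ s, ∃ d, a i = star d * d) : ∃ d, ∑ i ∈ s, a i = star d * d := by
  let _ := CStarAlgebra.spectralOrder D
  have := CStarAlgebra.spectralOrderedRing D
  exact exists_star_mul_iff.2 (Finset.sum_nonneg fun i hi => exists_star_mul_iff.1 (h i hi))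

/-- The Gram matrix of a finite family of vectors is of the form `N* N`. -/
theorem gram_pos {ι : Type*} [Fintype ι] (x : ι → X) :
    ∃ N : ι → ι → B, ∀ i j, ip (x i) (x j) = ∑ k, star (N k i) * N k j := by
  classical
  let _ := CStarAlgebra.spectralOrder B
  have := CStarAlgebra.spectralOrderedRing B
  let M : CStarMatrix ι ι B := CStarMatrix.ofMatrix fun i j => ip (x i) (x j)
  have hM : ∀ i j, M i j = ip (x i) (x j) := fun i j => rfl
  obtain ⟨N, hN⟩ : ∃ N : CStarMatrix ι ι B, M = star N * N := by
    refine exists_star_mul_of_rep (B := B) (F := ι → B) (fun v w => ∑ i, star (v i) * w i)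
      (fun M v i => ∑ j, M i j * v j) ?_ ?_ ?_ ?_ ?_ ?_ ?_ ?_
    · intro v w; simp
    · intro v; exact exists_star_mul_sum _ _ fun i _ => ⟨v i, rfl⟩
    · intro a b v
      funext i
      simp only [CStarMatrix.mul_apply, Finset.sum_mul, Finset.mul_sum, mul_assoc]
      rw [Finset.sum_comm]
    · intro a v; funext i; simp
    · intro a v w
      simp only [star_sum, star_mul, Finset.sum_mul, Finset.mul_sum, CStarMatrix.star_apply,
        mul_assoc]
      rw [Finset.sum_comm]
    · intro a h
      ext i j
      have h1 := h (Pi.single j (star (a i j)))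
      rw [Finset.sum_eq_zero_iff_of_nonneg fun i _ => star_mul_self_nonneg _] at h1
      have h2 := h1 i (Finset.mem_univ i)
      rw [CStarRing.star_mul_self_eq_zero_iff, Finset.sum_eq_single j (by
        intro k _ hk; rw [Pi.single_eq_of_ne hk, mul_zero]) (by simp), Pi.single_eq_same,
        CStarRing.mul_star_self_eq_zero_iff] at h2
      exact h2
    · ext i j
      rw [CStarMatrix.star_apply, hM, hM, star_ip]
    · intro v
      obtain ⟨b, hb⟩ := ip_self_pos (B := B) (∑ i, rsmul (x i) (v i))
      refine ⟨b, ?_⟩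
      rw [← hb, ip_sum_left]
      refine Finset.sum_congr rfl fun i _ => ?_
      rw [ip_sum_right, Finset.mul_sum]
      refine Finset.sum_congr rfl fun j _ => ?_
      rw [ip_rsmul_left, ip_rsmul_right, hM]
  refine ⟨fun k i => N k i, fun i j => ?_⟩
  rw [← hM, hN, CStarMatrix.mul_apply]
  simp only [CStarMatrix.star_apply]

end positivity

section construction

variable {B C X Y : Type*} [NonUnitalCStarAlgebra B] [NonUnitalCStarAlgebra C]
  [NormedAddCommGroup X] [NormedSpace ℂ X] [CompleteSpace X] [HilbertModule B X]
  [NormedAddCommGroup Y] [NormedSpace ℂ Y] [CompleteSpace Y] [HilbertModule C Y]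
  (φ : B →⋆ₙₐ[ℂ] Adj C Y)

theorem φ_add_apply (a b : B) (y : Y) : φ (a + b) y = φ a y + φ b y := by
  rw [map_add]; rfl

theorem φ_smul_apply (c : ℂ) (b : B) (y : Y) : φ (c • b) y = c • φ b y := by
  rw [map_smul]; rfl

theorem φ_mul_apply (a b : B) (y : Y) : φ (a * b) y = φ a (φ b y) := by
  rw [map_mul]; rfl

theorem φ_sum_apply {ι : Type*} (s : Finset ι) (b : ι → B) (y : Y) :
    φ (∑ i ∈ s, b i) y = ∑ i ∈ s, φ (b i) y :=
  map_sum (⟨⟨fun b => φ b y, by rw [map_zero]; rfl⟩, fun a b => φ_add_apply φ a b y⟩ : B →+ Y) b s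

variable (X) in
/-- The inner product `⟨x ⊗ y, x' ⊗ y'⟩ = ⟨y, φ(⟨x, x'⟩) y'⟩`. -/
def form : X ⊗[ℂ] Y →ₗ⋆[ℂ] X ⊗[ℂ] Y →ₗ[ℂ] C :=
  TensorProduct.lift <| LinearMap.mk₂'ₛₗ (starRingEnd ℂ) (starRingEnd ℂ)
    (fun x y => TensorProduct.lift <| LinearMap.mk₂ ℂ
      (fun x' y' => ip (B := C) y (φ (ip x x') y'))
      (fun x₁ x₂ y' => by rw [ip_add_right, φ_add_apply, ip_add_right])
      (fun c x' y' => by rw [ip_smul_right, φ_smul_apply, ip_smul_right])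
      (fun x' y₁ y₂ => by rw [map_add, ip_add_right])
      (fun c x' y' => by rw [map_smul, ip_smul_right]))
    (fun x₁ x₂ y => TensorProduct.ext' fun x' y' => by
      change ip (B := C) y (φ (ip (x₁ + x₂) x') y') =
        ip y (φ (ip x₁ x') y') + ip y (φ (ip x₂ x') y')
      rw [ip_add_left, φ_add_apply, ip_add_right])
    (fun c x y => TensorProduct.ext' fun x' y' => by
      change ip (B := C) y (φ (ip (c • x) x') y') = star c • ip (B := C) y (φ (ip x x') y')
      rw [ip_smul_left, φ_smul_apply, ip_smul_right])
    (fun x y₁ y₂ => by ext x' y'; simp [ip_add_left])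
    (fun c x y => by ext x' y'; simp [ip_smul_left])

theorem form_tmul (x x' : X) (y y' : Y) :
    form X φ (x ⊗ₜ y) (x' ⊗ₜ y') = ip y (φ (ip x x') y') := rfl

theorem form_pos (z : X ⊗[ℂ] Y) : ∃ c, form X φ z z = star c * c := by
  obtain ⟨S, rfl⟩ := TensorProduct.exists_finset z
  obtain ⟨N, hN⟩ := gram_pos (B := B) fun i : S => i.1.1
  rw [← Finset.sum_coe_sort]
  have h : form X φ (∑ i : S, i.1.1 ⊗ₜ[ℂ] i.1.2) (∑ i : S, i.1.1 ⊗ₜ[ℂ] i.1.2) =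
      ∑ k : S, ip (∑ i : S, φ (N k i) i.1.2) (∑ j : S, φ (N k j) j.1.2) := by
    simp only [map_sum, LinearMap.sum_apply, form_tmul]
    simp only [hN, φ_sum_apply, ip_sum_right, ip_sum_left,
      φ_mul_apply, map_star, ← Adj.ip_left]
    conv_rhs => rw [Finset.sum_comm]
    refine Finset.sum_congr rfl fun j _ => ?_
    rw [Finset.sum_comm]
  rw [h]
  exact exists_star_mul_sum _ _ fun k _ => ip_self_pos _

theorem star_form (w z : X ⊗[ℂ] Y) : star (form X φ w z) = form X φ z w := by
  induction w with
  | zero => simp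
  | add w₁ w₂ h₁ h₂ => simp [h₁, h₂]
  | tmul x y =>
    induction z with
    | zero => simp
    | add z₁ z₂ h₁ h₂ => simp [h₁, h₂]
    | tmul x' y' =>
      rw [form_tmul, form_tmul, star_ip, Adj.ip_left, ← map_star, star_ip]

/-- The right action of an algebra element as a linear map. -/
def rsmulₗ (c : C) : Y →ₗ[ℂ] Y where
  toFun y := rsmul y c
  map_add' y z := ext_ip C fun x => by simp only [ip_rsmul_right, ip_add_right, add_mul]
  map_smul' a y := ext_ip C fun x => by
    simp only [ip_rsmul_right, ip_smul_right, smul_mul_assoc, RingHom.id_apply]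

theorem φ_rsmul (b : B) (y : Y) (c : C) : φ b (rsmul y c) = rsmul (φ b y) c :=
  ext_ip C fun x => by rw [Adj.ip_right, ip_rsmul_right, ip_rsmul_right, Adj.ip_right]

theorem form_rsmul (c : C) (w z : X ⊗[ℂ] Y) :
    form X φ w (TensorProduct.map LinearMap.id (rsmulₗ c) z) = form X φ w z * c := by
  induction z with
  | zero => simp
  | add z₁ z₂ h₁ h₂ => rw [map_add, map_add, map_add, h₁, h₂, add_mul]
  | tmul x y =>
    induction w with
    | zero => simp
    | add w₁ w₂ h₁ h₂ => simp only [map_add, LinearMap.add_apply, h₁, h₂, add_mul]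
    | tmul x' y' =>
      rw [TensorProduct.map_tmul, form_tmul, form_tmul]
      change ip y' (φ (ip x' x) (rsmul y c)) = _
      rw [φ_rsmul, ip_rsmul_right]

variable (X) in
/-- The algebraic tensor product with its `C`-valued inner product. -/
def pre : PreHilbert C (X ⊗[ℂ] Y) where
  ip w z := form X φ w z
  ip_add_right _ _ _ := map_add _ _ _
  ip_smul_right _ _ _ := map_smul _ _ _
  star_ip := star_form φ
  ip_self_pos := form_pos φ
  dense_right := dense_univ.mono fun c _ z =>
    ⟨TensorProduct.map LinearMap.id (rsmulₗ c) z, fun w => form_rsmul φ c w z⟩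

end construction

end InteriorTensor

section

variable {B C : Type*} (X : Type*) {Y : Type*} [NonUnitalCStarAlgebra B] [NonUnitalCStarAlgebra C]
  [NormedAddCommGroup X] [NormedSpace ℂ X] [CompleteSpace X] [HilbertModule B X]
  [NormedAddCommGroup Y] [NormedSpace ℂ Y] [CompleteSpace Y] [HilbertModule C Y]
  (φ : B →⋆ₙₐ[ℂ] Adj C Y)

/-- The interior tensor product `X ⊗_B Y` of the Hilbert `B`-module `X` and the Hilbert `C`-module
`Y`, on which `B` acts by `φ`: the Hilbert `C`-module obtained from the algebraic tensor product by
completion in the inner product `⟨x ⊗ y, x' ⊗ y'⟩ = ⟨y, φ(⟨x, x'⟩) y'⟩`. -/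
abbrev InteriorTensor : Type _ := (InteriorTensor.pre X φ).Completion

end

namespace InteriorTensor

open HilbertModule

section operators

variable {B C X Y : Type*} [NonUnitalCStarAlgebra B] [NonUnitalCStarAlgebra C]
  [NormedAddCommGroup X] [NormedSpace ℂ X] [CompleteSpace X] [HilbertModule B X]
  [NormedAddCommGroup Y] [NormedSpace ℂ Y] [CompleteSpace Y] [HilbertModule C Y]
  (φ : B →⋆ₙₐ[ℂ] Adj C Y)

/-- The elementary tensor `x ⊗ y` in `X ⊗_B Y`. -/
def tmul (x : X) (y : Y) : InteriorTensor X φ := (pre X φ).toCompletion (x ⊗ₜ y)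

/-- `T ⊗ 1` on the algebraic tensor product. -/
def algLeft (T : Adj B X) : X ⊗[ℂ] Y →ₗ[ℂ] X ⊗[ℂ] Y :=
  TensorProduct.map (T.toCLM : X →ₗ[ℂ] X) LinearMap.id

theorem algLeft_mul (S T : Adj B X) (z : X ⊗[ℂ] Y) :
    algLeft (S * T) z = algLeft S (algLeft T z) := by
  induction z with
  | zero => simp
  | add z₁ z₂ h₁ h₂ => rw [map_add, map_add, map_add, h₁, h₂]
  | tmul x y => rfl

theorem algLeft_add (S T : Adj B X) (z : X ⊗[ℂ] Y) :
    algLeft (S + T) z = algLeft S z + algLeft T z := by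
  induction z with
  | zero => simp
  | add z₁ z₂ h₁ h₂ => rw [map_add, map_add, map_add, h₁, h₂]; abel
  | tmul x y => exact TensorProduct.add_tmul _ _ _

theorem algLeft_smul (c : ℂ) (T : Adj B X) (z : X ⊗[ℂ] Y) :
    algLeft (c • T) z = c • algLeft T z := by
  induction z with
  | zero => simp
  | add z₁ z₂ h₁ h₂ => rw [map_add, map_add, h₁, h₂, smul_add]
  | tmul x y => rfl

theorem form_algLeft (T : Adj B X) (w z : X ⊗[ℂ] Y) :
    form X φ (algLeft T w) z = form X φ w (algLeft (star T) z) := by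
  induction w with
  | zero => simp
  | add w₁ w₂ h₁ h₂ => simp only [map_add, LinearMap.add_apply, h₁, h₂]
  | tmul x y =>
    induction z with
    | zero => simp
    | add z₁ z₂ h₁ h₂ => simp only [map_add, h₁, h₂]
    | tmul x' y' =>
      change form X φ (T x ⊗ₜ y) (x' ⊗ₜ y') = form X φ (x ⊗ₜ y) ((star T : Adj B X) x' ⊗ₜ y')
      rw [form_tmul, form_tmul, Adj.ip_left]

theorem norm_algLeft_le (T : Adj B X) (z : X ⊗[ℂ] Y) :
    ‖(pre X φ).toCompletion (algLeft T z)‖ ≤ ‖T‖ * ‖(pre X φ).toCompletion z‖ := by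
  let _ := CStarAlgebra.spectralOrder (Adj B X)
  have := CStarAlgebra.spectralOrderedRing (Adj B X)
  let _ := CStarAlgebra.spectralOrder C
  have := CStarAlgebra.spectralOrderedRing C
  obtain ⟨R, hR⟩ := exists_star_mul_iff.2 (sub_nonneg.2
    (CStarAlgebra.star_mul_le_algebraMap_norm_sq (a := T)))
  have h1 : form X φ (algLeft R z) (algLeft R z) =
      (‖T‖ ^ 2) • form X φ z z - form X φ (algLeft T z) (algLeft T z) := by
    have h2 : star R * R = ((‖T‖ ^ 2 : ℝ) : ℂ) • (1 : Adj B X) + (-1 : ℂ) • (star T * T) := by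
      rw [← hR, Algebra.algebraMap_eq_smul_one, neg_one_smul, sub_eq_add_neg]
      rfl
    have h3 : algLeft (1 : Adj B X) z = z := by
      change TensorProduct.map LinearMap.id LinearMap.id z = z
      rw [TensorProduct.map_id]; rfl
    rw [form_algLeft, form_algLeft, ← algLeft_mul, ← algLeft_mul, h2, algLeft_add, algLeft_smul,
      algLeft_smul, h3, map_add, map_smul, map_smul, neg_one_smul, sub_eq_add_neg]
    rfl
  have h2 : form X φ (algLeft T z) (algLeft T z) ≤ (‖T‖ ^ 2) • form X φ z z := by
    rw [← sub_nonneg, ← h1]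
    exact exists_star_mul_iff.1 (form_pos φ _)
  have h3 := CStarAlgebra.norm_le_norm_of_nonneg_of_le
    (exists_star_mul_iff.1 (form_pos φ (algLeft T z))) h2
  rw [norm_smul, Real.norm_of_nonneg (by positivity)] at h3
  rw [PreHilbert.norm_toCompletion, PreHilbert.norm_toCompletion]
  calc _ ≤ √(‖T‖ ^ 2 * ‖form X φ z z‖) := Real.sqrt_le_sqrt h3
    _ = _ := by rw [Real.sqrt_mul (by positivity), Real.sqrt_sq (norm_nonneg _)]; rfl

/-- `T ⊗ 1` on `X ⊗_B Y`. -/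
def leftOp (T : Adj B X) : Adj C (InteriorTensor X φ) :=
  (pre X φ).liftAdj (algLeft T) (algLeft (star T)) ⟨_, norm_algLeft_le φ T⟩
    ⟨_, norm_algLeft_le φ (star T)⟩ (form_algLeft φ T)

theorem leftOp_coe (T : Adj B X) (z : X ⊗[ℂ] Y) :
    leftOp φ T ((pre X φ).toCompletion z) = (pre X φ).toCompletion (algLeft T z) :=
  PreHilbert.liftAdj_coe _ _ _ _ _ _ _

theorem leftOp_tmul (T : Adj B X) (x : X) (y : Y) :
    leftOp φ T (tmul φ x y) = tmul φ (T x) y :=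
  leftOp_coe φ T _

/-- The left action `T ↦ T ⊗ 1` of the adjointable operators of `X` on `X ⊗_B Y`. -/
def leftHom : Adj B X →⋆ₙₐ[ℂ] Adj C (InteriorTensor X φ) where
  toFun := leftOp φ
  map_zero' := Adj.ext <| PreHilbert.clm_ext fun z => by
    have h := leftOp_coe φ (0 : Adj B X) z
    have h0 : algLeft (0 : Adj B X) z = 0 := by
      have := algLeft_smul (0 : ℂ) (0 : Adj B X) z
      rwa [zero_smul, zero_smul] at this
    rw [h0, map_zero] at h
    exact h
  map_add' S T := Adj.ext <| PreHilbert.clm_ext fun z => by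
    change leftOp φ (S + T) ((pre X φ).toCompletion z) =
      leftOp φ S ((pre X φ).toCompletion z) + leftOp φ T ((pre X φ).toCompletion z)
    rw [leftOp_coe, leftOp_coe, leftOp_coe, algLeft_add, map_add]
  map_smul' c T := Adj.ext <| PreHilbert.clm_ext fun z => by
    change leftOp φ (c • T) ((pre X φ).toCompletion z) =
      c • leftOp φ T ((pre X φ).toCompletion z)
    rw [leftOp_coe, leftOp_coe, algLeft_smul, map_smul]
  map_mul' S T := Adj.ext <| PreHilbert.clm_ext fun z => by
    change leftOp φ (S * T) ((pre X φ).toCompletion z) =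
      leftOp φ S (leftOp φ T ((pre X φ).toCompletion z))
    rw [leftOp_coe, leftOp_coe, leftOp_coe, algLeft_mul]
  map_star' T := by
    refine (PreHilbert.liftAdj_star (pre X φ) (algLeft T) (algLeft (star T)) ⟨_, norm_algLeft_le φ T⟩
      ⟨_, norm_algLeft_le φ (star T)⟩ (form_algLeft φ T) fun x y => ?_).symm ▸ ?_
    · have h := form_algLeft φ (star T) x y
      rwa [star_star] at h
    · refine Adj.ext <| PreHilbert.clm_ext fun z => ?_
      exact (leftOp_coe φ (star T) z).trans (PreHilbert.liftAdj_coe _ _ _ _ _ _ _).symm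

end operators

end InteriorTensor

end

noncomputable section

/-! ### Group actions on C*-algebras and Hilbert modules -/

/-- An action of the group `S` on the C*-algebra `B` by `*`-automorphisms. -/
class CStarAction (S B : Type*) [Group S] [NonUnitalCStarAlgebra B] extends
    DistribMulAction S B where
  smul_mul_alg : ∀ (s : S) (a b : B), s • (a * b) = (s • a) * (s • b)
  smul_star_alg : ∀ (s : S) (a : B), s • star a = star (s • a)
  smul_complex_alg : ∀ (s : S) (c : ℂ) (a : B), s • (c • a) = c • (s • a)

/-- A left action of the C*-algebra `A` by adjointable operators on the Hilbert `B`-module `X`,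
making `X` a C*-`(A, B)`-bimodule. -/
class HilbertBimodule (A B X : Type*) [NonUnitalCStarAlgebra A] [NonUnitalCStarAlgebra B]
    [NormedAddCommGroup X] [NormedSpace ℂ X] [CompleteSpace X] [HilbertModule B X] where
  lact : A →⋆ₙₐ[ℂ] Adj B X

open HilbertModule HilbertBimodule

/-- An action of `S` on the Hilbert `B`-module `X` that is compatible with the action of `S`
on `B`. -/
class EquivariantModule (S B X : Type*) [Group S] [NonUnitalCStarAlgebra B] [CStarAction S B]
    [NormedAddCommGroup X] [NormedSpace ℂ X] [CompleteSpace X] [HilbertModule B X]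
    [DistribMulAction S X] : Prop where
  smul_complex : ∀ (s : S) (c : ℂ) (x : X), s • (c • x) = c • (s • x)
  smul_rsmul : ∀ (s : S) (x : X) (b : B), s • rsmul x b = rsmul (s • x) (s • b)
  smul_ip : ∀ (s : S) (x y : X), s • ip (B := B) x y = ip (s • x) (s • y)

/-- An `S`-equivariant C*-`(A, B)`-bimodule. -/
class EquivariantBimodule (S A B X : Type*) [Group S] [NonUnitalCStarAlgebra A]
    [NonUnitalCStarAlgebra B] [CStarAction S A] [CStarAction S B]
    [NormedAddCommGroup X] [NormedSpace ℂ X] [CompleteSpace X] [HilbertModule B X]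
    [HilbertBimodule A B X] [DistribMulAction S X] : Prop extends EquivariantModule S B X where
  smul_lact : ∀ (s : S) (a : A) (x : X),
    s • (lact (B := B) a x) = lact (B := B) (s • a) (s • x)

section selfBimodule

variable (B : Type*) [NonUnitalCStarAlgebra B]

/-- Left multiplication, as an adjointable operator. -/
def Adj.mulLeft (b : B) : Adj B B :=
  Adj.mk (ContinuousLinearMap.mul ℂ B b) (ContinuousLinearMap.mul ℂ B (star b)) fun x y => by
    change star (b * x) * y = star x * (star b * y)
    rw [star_mul, mul_assoc]

/-- A C*-algebra is a bimodule over itself. -/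
instance HilbertBimodule.self : HilbertBimodule B B B where
  lact :=
    { toFun := Adj.mulLeft B
      map_zero' := Adj.ext_apply fun x => zero_mul x
      map_add' := fun a b => Adj.ext_apply fun x => add_mul a b x
      map_smul' := fun c a => Adj.ext_apply fun x => smul_mul_assoc c a x
      map_mul' := fun a b => Adj.ext_apply fun x => mul_assoc a b x
      map_star' := fun a => (Adj.star_eq_of_ip fun x y => by
        change star (a * x) * y = star x * (star a * y)
        rw [star_mul, mul_assoc]).symm }

theorem HilbertBimodule.self_lact (a b : B) : lact (B := B) a b = a * b := rfl

theorem HilbertModule.self_rsmul (a b : B) : rsmul a b = a * b := rfl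

theorem HilbertModule.self_ip (a b : B) : ip (B := B) a b = star a * b := rfl

instance EquivariantBimodule.self (S : Type*) [Group S] [CStarAction S B] :
    EquivariantBimodule S B B B where
  smul_complex := CStarAction.smul_complex_alg
  smul_rsmul := CStarAction.smul_mul_alg
  smul_ip s x y := by
    rw [self_ip, self_ip, CStarAction.smul_mul_alg, CStarAction.smul_star_alg]
  smul_lact := CStarAction.smul_mul_alg

end selfBimodule

section action

variable {S B : Type*} [Group S] [NonUnitalCStarAlgebra B] [CStarAction S B]

theorem CStarAction.norm_smul (s : S) (b : B) : ‖s • b‖ = ‖b‖ := by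
  let ψ : B →⋆ₙₐ[ℂ] B :=
    { toFun := fun b => s • b
      map_zero' := smul_zero s
      map_add' := smul_add s
      map_smul' := fun c b => smul_complex_alg s c b
      map_mul' := smul_mul_alg s
      map_star' := smul_star_alg s }
  exact NonUnitalStarAlgHom.norm_map ψ (MulAction.injective s) b

theorem CStarAction.continuous_smul (s : S) : Continuous fun b : B => s • b := by
  refine (AddMonoidHomClass.isometry_of_norm (DistribSMul.toAddMonoidHom B s) ?_).continuous
  exact CStarAction.norm_smul s

theorem CStarAction.smul_pos (s : S) {a : B} (h : ∃ b, a = star b * b) :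
    ∃ b, s • a = star b * b := by
  obtain ⟨b, rfl⟩ := h
  exact ⟨s • b, by rw [smul_mul_alg, smul_star_alg]⟩

variable {X : Type*} [NormedAddCommGroup X] [NormedSpace ℂ X] [CompleteSpace X]
  [HilbertModule B X] [DistribMulAction S X]

variable (B X) in
/-- The action of a group element as a linear map. -/
def EquivariantModule.smulₗ [EquivariantModule S B X] (s : S) : X →ₗ[ℂ] X where
  toFun x := s • x
  map_add' := smul_add s
  map_smul' c x := smul_complex (B := B) s c x

theorem EquivariantModule.smul_rsmul_of_ip
    (h : ∀ (s : S) (x y : X), s • ip (B := B) x y = ip (s • x) (s • y))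
    (s : S) (x : X) (b : B) : s • rsmul x b = rsmul (s • x) (s • b) :=
  ext_ip B fun w => by
    have h1 : ∀ y : X, ip (B := B) w (s • y) = s • ip (s⁻¹ • w) y := fun y => by
      rw [h, smul_inv_smul]
    rw [ip_rsmul_right, h1, h1, ip_rsmul_right, CStarAction.smul_mul_alg]

end action

namespace InteriorTensor

/-- The left action on an interior tensor product, `a (x ⊗ y) = a x ⊗ y`. -/
instance {A B C X Y : Type*} [NonUnitalCStarAlgebra A]
    [NonUnitalCStarAlgebra B] [NonUnitalCStarAlgebra C]
    [NormedAddCommGroup X] [NormedSpace ℂ X] [CompleteSpace X] [HilbertModule B X]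
    [NormedAddCommGroup Y] [NormedSpace ℂ Y] [CompleteSpace Y] [HilbertModule C Y]
    (φ : B →⋆ₙₐ[ℂ] Adj C Y) [HilbertBimodule A B X] :
    HilbertBimodule A C (InteriorTensor X φ) where
  lact := (leftHom φ).comp lact

section equivariant

variable {S A B C X Y : Type*} [Group S] [NonUnitalCStarAlgebra A] [NonUnitalCStarAlgebra B]
  [NonUnitalCStarAlgebra C] [CStarAction S A] [CStarAction S B] [CStarAction S C]
  [NormedAddCommGroup X] [NormedSpace ℂ X] [CompleteSpace X] [HilbertModule B X]
  [DistribMulAction S X]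
  [NormedAddCommGroup Y] [NormedSpace ℂ Y] [CompleteSpace Y] [HilbertModule C Y]
  [HilbertBimodule B C Y] [DistribMulAction S Y] [EquivariantBimodule S B C Y]

section smul

variable [EquivariantModule S B X]

variable (B C X Y) in
/-- The diagonal action of a group element on the algebraic tensor product. -/
def algSMul (s : S) : X ⊗[ℂ] Y →ₗ[ℂ] X ⊗[ℂ] Y :=
  TensorProduct.map (EquivariantModule.smulₗ B X s) (EquivariantModule.smulₗ C Y s)

theorem algSMul_tmul (s : S) (x : X) (y : Y) :
    algSMul B C X Y s (x ⊗ₜ y) = (s • x) ⊗ₜ (s • y) := rfl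

theorem form_algSMul (s : S) (w z : X ⊗[ℂ] Y) :
    form X (lact (A := B) (B := C)) (algSMul B C X Y s w) (algSMul B C X Y s z) =
      s • form X (lact (A := B) (B := C)) w z := by
  induction w with
  | zero => simp
  | add w₁ w₂ h₁ h₂ => simp only [map_add, LinearMap.add_apply, h₁, h₂, smul_add]
  | tmul x y =>
    induction z with
    | zero => simp
    | add z₁ z₂ h₁ h₂ => simp only [map_add, h₁, h₂, smul_add]
    | tmul x' y' =>
      rw [algSMul_tmul, algSMul_tmul, form_tmul, form_tmul, EquivariantModule.smul_ip,
        EquivariantBimodule.smul_lact, EquivariantModule.smul_ip]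

theorem norm_algSMul (s : S) (z : X ⊗[ℂ] Y) :
    ‖(pre X (lact (A := B) (B := C))).toCompletion (algSMul B C X Y s z)‖ ≤
      1 * ‖(pre X (lact (A := B) (B := C))).toCompletion z‖ := by
  rw [PreHilbert.norm_toCompletion, PreHilbert.norm_toCompletion, one_mul]
  change √‖form _ _ _ _‖ ≤ √‖form _ _ _ _‖
  rw [form_algSMul, CStarAction.norm_smul]

variable (B C X Y) in
/-- The diagonal action of a group element on `X ⊗_B Y`. -/
def smulL (s : S) : InteriorTensor X (lact (A := B) (B := C) (X := Y)) →L[ℂ]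
    InteriorTensor X (lact (A := B) (B := C) (X := Y)) :=
  (pre X lact).lift (pre X lact) (algSMul B C X Y s)

theorem smulL_coe (s : S) (z : X ⊗[ℂ] Y) :
    smulL B C X Y s ((pre X lact).toCompletion z) =
      (pre X lact).toCompletion (algSMul B C X Y s z) :=
  PreHilbert.lift_coe _ _ ⟨1, norm_algSMul s⟩ z

/-- The diagonal action of `S` on `X ⊗_B Y`, `s (x ⊗ y) = s x ⊗ s y`. -/
instance : DistribMulAction S (InteriorTensor X (lact (A := B) (B := C) (X := Y))) where
  smul s z := smulL B C X Y s z
  one_smul z := by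
    refine PreHilbert.ind (P := pre X (lact (A := B) (B := C) (X := Y)))
      (p := fun z => smulL B C X Y (1 : S) z = z)
      (isClosed_eq (smulL B C X Y (1 : S)).continuous continuous_id) (fun z => ?_) z
    rw [smulL_coe]
    congr 1
    induction z with
    | zero => simp
    | add z₁ z₂ h₁ h₂ => rw [map_add, h₁, h₂]
    | tmul x y => rw [algSMul_tmul, one_smul, one_smul]
  mul_smul s t z := by
    refine PreHilbert.ind (P := pre X (lact (A := B) (B := C) (X := Y)))
      (p := fun z => smulL B C X Y (s * t) z = smulL B C X Y s (smulL B C X Y t z))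
      (isClosed_eq (smulL B C X Y (s * t)).continuous
        ((smulL B C X Y s).continuous.comp (smulL B C X Y t).continuous)) (fun z => ?_) z
    rw [smulL_coe, smulL_coe, smulL_coe]
    congr 1
    induction z with
    | zero => simp
    | add z₁ z₂ h₁ h₂ => rw [map_add, map_add, map_add, h₁, h₂]
    | tmul x y => rw [algSMul_tmul, algSMul_tmul, algSMul_tmul, mul_smul, mul_smul]
  smul_zero s := map_zero (smulL B C X Y s)
  smul_add s := map_add (smulL B C X Y s)

theorem smul_def (s : S) (z : InteriorTensor X (lact (A := B) (B := C) (X := Y))) :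
    s • z = smulL B C X Y s z := rfl

theorem smul_ip_aux (s : S) (w z : InteriorTensor X (lact (A := B) (B := C) (X := Y))) :
    s • ip (B := C) w z = ip (s • w) (s • z) := by
  refine PreHilbert.ind₂ (P := pre X (lact (A := B) (B := C) (X := Y))) (p := fun w z => s • (pre X lact).cip w z =
    (pre X lact).cip (smulL B C X Y s w) (smulL B C X Y s z))
    (isClosed_eq ((CStarAction.continuous_smul s).comp
      ((pre X lact).continuous_cip_comp continuous_fst continuous_snd))
        ((pre X lact).continuous_cip_comp ((smulL B C X Y s).continuous.comp continuous_fst)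
          ((smulL B C X Y s).continuous.comp continuous_snd))) (fun w z => ?_) w z
  rw [smulL_coe, smulL_coe, PreHilbert.cip_coe, PreHilbert.cip_coe]
  exact (form_algSMul s w z).symm

instance : EquivariantModule S C (InteriorTensor X (lact (A := B) (B := C) (X := Y))) where
  smul_complex s := map_smul (smulL B C X Y s)
  smul_rsmul := EquivariantModule.smul_rsmul_of_ip smul_ip_aux
  smul_ip := smul_ip_aux

end smul

variable [HilbertBimodule A B X] [EquivariantBimodule S A B X]

instance : EquivariantBimodule S A C (InteriorTensor X (lact (A := B) (B := C) (X := Y))) where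
  smul_lact s a z := by
    refine PreHilbert.ind (P := pre X (lact (A := B) (B := C) (X := Y)))
      (p := fun z => smulL B C X Y s (leftOp lact (lact (B := B) a) z) =
      leftOp lact (lact (B := B) (s • a)) (smulL B C X Y s z))
      (isClosed_eq ((smulL B C X Y s).continuous.comp (leftOp lact (lact (B := B) a)).toCLM.continuous)
        ((leftOp lact (lact (B := B) (s • a))).toCLM.continuous.comp (smulL B C X Y s).continuous)) (fun z => ?_) z
    rw [smulL_coe, leftOp_coe, leftOp_coe, smulL_coe]
    congr 1
    induction z with
    | zero => simp
    | add z₁ z₂ h₁ h₂ => simp only [map_add, h₁, h₂]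
    | tmul x y =>
      change (s • lact (B := B) a x) ⊗ₜ (s • y) = (lact (B := B) (s • a) (s • x)) ⊗ₜ[ℂ] (s • y)
      rw [EquivariantBimodule.smul_lact]

end equivariant

end InteriorTensor

end

noncomputable section

set_option linter.unusedSectionVars false

/-! ### Anchored bi-Γ-sets -/

/-- A set `V` with a left action of `Γ` and a right action of `Γ` (an action of `Γᵐᵒᵖ`, so that
`v γ` is `op γ • v`) is an `S`-anchored bi-`Γ`-set if the two actions commute and there is a given
map `anchor : V → S` with `anchor (γ v δ) = γ (anchor v) δ`. -/
class AnchoredBiset {S : Type*} [Group S] (Γ : Subgroup S) (V : Type*) [MulAction Γ V]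
    [MulAction Γᵐᵒᵖ V] where
  smul_op_smul : ∀ (γ δ : Γ) (v : V), γ • (op δ • v) = op δ • (γ • v)
  anchor : V → S
  anchor_smul : ∀ (γ : Γ) (v : V), anchor (γ • v) = γ * anchor v
  anchor_op_smul : ∀ (γ : Γ) (v : V), anchor (op γ • v) = anchor v * γ

/-- The group `Γ` itself, anchored by the inclusion. -/
instance AnchoredBiset.self {S : Type*} [Group S] (Γ : Subgroup S) : AnchoredBiset Γ Γ where
  smul_op_smul γ δ v := (mul_assoc γ v δ).symm
  anchor γ := γ
  anchor_smul _ _ := rfl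
  anchor_op_smul _ _ := rfl

section product

variable {S : Type*} [Group S] (Γ : Subgroup S) (V W : Type*) [MulAction Γ V] [MulAction Γᵐᵒᵖ V]
  [MulAction Γ W] [MulAction Γᵐᵒᵖ W]

/-- The relation `(v, w) ∼ (v γ, γ⁻¹ w)`. -/
def bisetSetoid : Setoid (V × W) where
  r p q := ∃ γ : Γ, q.1 = op γ • p.1 ∧ q.2 = γ⁻¹ • p.2
  iseqv :=
    { refl := fun p => ⟨1, by simp⟩
      symm := by
        rintro p q ⟨γ, h1, h2⟩
        exact ⟨γ⁻¹, by rw [h1, MulOpposite.op_inv, inv_smul_smul],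
          by rw [h2, inv_inv, smul_inv_smul]⟩
      trans := by
        rintro p q r ⟨γ, h1, h2⟩ ⟨δ, h3, h4⟩
        exact ⟨γ * δ, by rw [h3, h1, MulOpposite.op_mul, mul_smul],
          by rw [h4, h2, mul_inv_rev, mul_smul]⟩ }

/-- The `Γ`-product `V ×_Γ W`. -/
def BisetProd : Type _ := Quotient (bisetSetoid Γ V W)

variable {V W} in
/-- The class `[v, w]`. -/
def BisetProd.mk (v : V) (w : W) : BisetProd Γ V W := Quotient.mk (bisetSetoid Γ V W) (v, w)

namespace BisetProd

variable {Γ V W}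

theorem mk_eq (v : V) (w : W) (γ : Γ) : mk Γ (op γ • v) (γ⁻¹ • w) = mk Γ v w :=
  (Quotient.sound (s := bisetSetoid Γ V W) ⟨γ, rfl, rfl⟩ :
    Quotient.mk (bisetSetoid Γ V W) (v, w) = Quotient.mk _ (op γ • v, γ⁻¹ • w)).symm

theorem ind {p : BisetProd Γ V W → Prop} (h : ∀ v w, p (mk Γ v w)) (q : BisetProd Γ V W) : p q :=
  Quotient.ind (fun x => h x.1 x.2) q

variable [AnchoredBiset Γ V] [AnchoredBiset Γ W]

open AnchoredBiset

instance : MulAction Γ (BisetProd Γ V W) where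
  smul γ := Quotient.map (fun p => (γ • p.1, p.2)) (by
    rintro p q ⟨δ, h1, h2⟩
    exact ⟨δ, by rw [h1, smul_op_smul], h2⟩)
  one_smul q := by
    induction q using ind with
    | h v w => exact congrArg (fun v => mk Γ v w) (one_smul Γ v)
  mul_smul γ δ q := by
    induction q using ind with
    | h v w => exact congrArg (fun v => mk Γ v w) (mul_smul γ δ v)

instance : MulAction Γᵐᵒᵖ (BisetProd Γ V W) where
  smul γ := Quotient.map (fun p => (p.1, γ • p.2)) (by
    rintro p q ⟨δ, h1, h2⟩
    refine ⟨δ, h1, ?_⟩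
    have h := smul_op_smul (Γ := Γ) δ⁻¹ γ.unop p.2
    rw [MulOpposite.op_unop] at h
    rw [h2, h])
  one_smul q := by
    induction q using ind with
    | h v w => exact congrArg (fun w => mk Γ v w) (one_smul Γᵐᵒᵖ w)
  mul_smul γ δ q := by
    induction q using ind with
    | h v w => exact congrArg (fun w => mk Γ v w) (mul_smul γ δ w)

theorem smul_mk (γ : Γ) (v : V) (w : W) : γ • mk Γ v w = mk Γ (γ • v) w := rfl

theorem op_smul_mk (γ : Γ) (v : V) (w : W) : op γ • mk Γ v w = mk Γ v (op γ • w) := rfl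

/-- The product anchor `[v, w] ↦ m(v) m(w)`. -/
instance : AnchoredBiset Γ (BisetProd Γ V W) where
  smul_op_smul γ δ q := by
    induction q using ind with
    | h v w => rfl
  anchor := Quotient.lift (fun p => anchor Γ p.1 * anchor Γ p.2) (by
    rintro p q ⟨δ, h1, h2⟩
    rw [h1, h2, anchor_op_smul, anchor_smul, Subgroup.coe_inv]
    group)
  anchor_smul γ q := by
    induction q using ind with
    | h v w =>
      change anchor Γ (γ • v) * anchor Γ w = γ * (anchor Γ v * anchor Γ w)
      rw [anchor_smul, mul_assoc]
  anchor_op_smul γ q := by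
    induction q using ind with
    | h v w =>
      change anchor Γ v * anchor Γ (op γ • w) = anchor Γ v * anchor Γ w * γ
      rw [anchor_op_smul, mul_assoc]

end BisetProd

end product

end

noncomputable section

set_option linter.unusedSectionVars false

/-! ### The convolution bimodules `C_c(V, X)` -/

open HilbertModule HilbertBimodule AnchoredBiset
open Finsupp (single)

/-- The bilinear map on finitely supported functions with
`(i, a) ⊗ (k, x) ↦ (idx i k, β i k a x)` on one-point functions. -/
def finsuppBilin {ι κ τ M N P : Type*} [AddCommGroup M] [Module ℂ M] [AddCommGroup N] [Module ℂ N]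
    [AddCommGroup P] [Module ℂ P] (idx : ι → κ → τ) (β : ι → κ → M →ₗ[ℂ] N →ₗ[ℂ] P) :
    (ι →₀ M) →ₗ[ℂ] (κ →₀ N) →ₗ[ℂ] (τ →₀ P) :=
  LinearMap.mk₂ ℂ (fun f g => f.sum fun i a => g.sum fun k x => single (idx i k) (β i k a x))
    (fun f₁ f₂ g => Finsupp.sum_add_index' (fun i => by simp) fun i a b => by
      simp only [map_add, LinearMap.add_apply, Finsupp.single_add, Finsupp.sum_add])
    (fun c f g => by
      rw [Finsupp.sum_smul_index' (fun i => by simp), Finsupp.smul_sum]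
      refine Finsupp.sum_congr fun i _ => ?_
      rw [Finsupp.smul_sum]
      simp only [map_smul, LinearMap.smul_apply, Finsupp.smul_single])
    (fun f g₁ g₂ => by
      rw [← Finsupp.sum_add]
      refine Finsupp.sum_congr fun i _ => ?_
      rw [Finsupp.sum_add_index' (fun i => by simp) fun i a b => by
        simp only [map_add, Finsupp.single_add]])
    (fun c f g => by
      rw [Finsupp.smul_sum]
      refine Finsupp.sum_congr fun i _ => ?_
      rw [Finsupp.sum_smul_index' (fun i => by simp), Finsupp.smul_sum]
      simp only [map_smul, Finsupp.smul_single])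

theorem finsuppBilin_single {ι κ τ M N P : Type*} [AddCommGroup M] [Module ℂ M] [AddCommGroup N]
    [Module ℂ N] [AddCommGroup P] [Module ℂ P] (idx : ι → κ → τ) (β : ι → κ → M →ₗ[ℂ] N →ₗ[ℂ] P)
    (i : ι) (k : κ) (a : M) (x : N) :
    finsuppBilin idx β (single i a) (single k x) = single (idx i k) (β i k a x) := by
  change ((single i a).sum fun i a => (single k x).sum fun k x => single (idx i k) (β i k a x)) = _
  rw [Finsupp.sum_single_index (by simp), Finsupp.sum_single_index (by simp)]

section convolution

variable {S : Type*} [Group S] {Γ : Subgroup S} {A B V X : Type*}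
  [NonUnitalCStarAlgebra A] [NonUnitalCStarAlgebra B] [CStarAction S A] [CStarAction S B]
  [MulAction Γ V] [MulAction Γᵐᵒᵖ V]
  [NormedAddCommGroup X] [NormedSpace ℂ X] [CompleteSpace X] [HilbertModule B X]
  [DistribMulAction S X]

section left

variable (B) [HilbertBimodule A B X] [EquivariantBimodule S A B X]

/-- The left module structure of `C_c(V, X)` over `C_c(Γ, A)`:
`(f * Ψ)(v) = ∑_γ f(γ) γ(Ψ(γ⁻¹ v))`, see `lconv_apply`. -/
def lconv : (Γ →₀ A) →ₗ[ℂ] (V →₀ X) →ₗ[ℂ] (V →₀ X) :=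
  finsuppBilin (fun γ v => γ • v) fun γ _ => LinearMap.mk₂ ℂ
    (fun a x => lact (A := A) (B := B) a (γ • x))
    (fun a b x => InteriorTensor.φ_add_apply _ a b _)
    (fun c a x => InteriorTensor.φ_smul_apply _ c a _)
    (fun a x y => by rw [smul_add, map_add])
    (fun c a x => by
      rw [show γ • c • x = c • γ • x from EquivariantModule.smul_complex (B := B) (γ : S) c x,
        map_smul])

theorem lconv_single (γ : Γ) (a : A) (v : V) (x : X) :
    lconv B (single γ a) (single v x) = single (γ • v) (lact (B := B) a (γ • x)) :=
  finsuppBilin_single _ _ _ _ _ _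

theorem lconv_apply (f : Γ →₀ A) (Ψ : V →₀ X) (v : V) :
    lconv B f Ψ v = f.sum fun γ a => lact (B := B) a (γ • Ψ (γ⁻¹ • v)) := by
  classical
  induction f using Finsupp.induction_linear with
  | zero => simp
  | add f g hf hg =>
    rw [map_add, LinearMap.add_apply, Finsupp.add_apply, hf, hg, Finsupp.sum_add_index'
      (fun γ => by rw [map_zero]; rfl) (fun γ a b => by rw [map_add]; rfl)]
  | single γ a =>
    rw [Finsupp.sum_single_index (by rw [map_zero]; rfl)]
    induction Ψ using Finsupp.induction_linear with
    | zero => simp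
    | add Ψ Φ hΨ hΦ => rw [map_add, Finsupp.add_apply, hΨ, hΦ, Finsupp.add_apply, smul_add, map_add]
    | single w x =>
      rw [lconv_single, Finsupp.single_apply, Finsupp.single_apply]
      by_cases h : γ • w = v
      · rw [if_pos h, if_pos (by rw [← h, inv_smul_smul])]
      · rw [if_neg h, if_neg (fun h' => h (by rw [h', smul_inv_smul])), smul_zero, map_zero]

end left

section right

variable [AnchoredBiset Γ V]

/-- The right module structure of `C_c(V, X)` over `C_c(Γ, B)`:
`(Ψ * f)(v) = ∑_γ Ψ(v γ) m(v γ)(f(γ⁻¹))`, see `rconv_apply`. -/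
def rconv : (V →₀ X) →ₗ[ℂ] (Γ →₀ B) →ₗ[ℂ] (V →₀ X) :=
  finsuppBilin (fun v γ => op γ • v) fun v _ => LinearMap.mk₂ ℂ
    (fun x b => rsmul x (anchor Γ v • b))
    (fun x y b => ext_ip B fun w => by simp only [ip_rsmul_right, ip_add_right, add_mul])
    (fun c x b => ext_ip B fun w => by simp only [ip_rsmul_right, ip_smul_right, smul_mul_assoc])
    (fun x a b => ext_ip B fun w => by
      simp only [ip_rsmul_right, ip_add_right, smul_add, mul_add])
    (fun c x b => ext_ip B fun w => by
      simp only [ip_rsmul_right, ip_smul_right, CStarAction.smul_complex_alg, mul_smul_comm])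

theorem rconv_single (v : V) (x : X) (γ : Γ) (b : B) :
    rconv (single v x) (single γ b) = single (op γ • v) (rsmul x (anchor Γ v • b)) :=
  finsuppBilin_single _ _ _ _ _ _

theorem rsmul_zero (x : X) : rsmul x (0 : B) = 0 :=
  ext_ip B fun w => by rw [ip_rsmul_right, mul_zero, ip_zero_right]

theorem zero_rsmul (b : B) : rsmul (0 : X) b = 0 :=
  ext_ip B fun w => by rw [ip_rsmul_right, ip_zero_right, zero_mul]

theorem rsmul_add (x : X) (a b : B) : rsmul x (a + b) = rsmul x a + rsmul x b :=
  ext_ip B fun w => by simp only [ip_rsmul_right, ip_add_right, mul_add]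

theorem add_rsmul (x y : X) (b : B) : rsmul (x + y) b = rsmul x b + rsmul y b :=
  ext_ip B fun w => by simp only [ip_rsmul_right, ip_add_right, add_mul]

theorem rconv_apply (Ψ : V →₀ X) (f : Γ →₀ B) (v : V) :
    rconv Ψ f v = f.sum fun γ b => rsmul (Ψ (op γ⁻¹ • v)) (anchor Γ (op γ⁻¹ • v) • b) := by
  classical
  induction f using Finsupp.induction_linear with
  | zero => simp
  | add f g hf hg =>
    rw [map_add, Finsupp.add_apply, hf, hg, Finsupp.sum_add_index'
      (fun γ => by rw [smul_zero, rsmul_zero]) (fun γ a b => by rw [smul_add, rsmul_add])]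
  | single γ a =>
    rw [Finsupp.sum_single_index (by rw [smul_zero, rsmul_zero])]
    induction Ψ using Finsupp.induction_linear with
    | zero => simp [zero_rsmul]
    | add Ψ Φ hΨ hΦ =>
      rw [map_add, LinearMap.add_apply, Finsupp.add_apply, hΨ, hΦ, Finsupp.add_apply, add_rsmul]
    | single w x =>
      rw [rconv_single, Finsupp.single_apply, Finsupp.single_apply]
      by_cases h : op γ • w = v
      · have h' : op γ⁻¹ • v = w := by rw [← h, MulOpposite.op_inv, inv_smul_smul]
        rw [if_pos h, if_pos h'.symm, h']
      · rw [if_neg h, if_neg (fun h' => h (by rw [h', MulOpposite.op_inv, smul_inv_smul])),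
          zero_rsmul]

end right

section inner

variable [AnchoredBiset Γ V]

theorem op_smul_injective (v : V) : Function.Injective fun δ : Γ => op δ • v := by
  intro δ ε h
  have h' := congrArg (anchor Γ) h
  simp only [anchor_op_smul] at h'
  exact Subtype.ext (mul_left_cancel h')

variable (Γ B)

/-- The `C_c(Γ, B)`-valued inner product of `C_c(V, X)`:
`⟨Φ, Ψ⟩(δ) = ∑_v m(v)⁻¹ ⟨Φ(v), Ψ(v δ)⟩`. -/
def inn (Φ Ψ : V →₀ X) : Γ →₀ B :=
  Finsupp.ofSupportFinite
    (fun δ => Φ.sum fun v x => (anchor Γ v)⁻¹ • ip (B := B) x (Ψ (op δ • v))) (by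
      refine (Set.Finite.biUnion Φ.support.finite_toSet fun v _ =>
        Ψ.support.finite_toSet.preimage (op_smul_injective (Γ := Γ) v).injOn).subset ?_
      intro δ hδ
      obtain ⟨v, hv, h⟩ := Finset.exists_ne_zero_of_sum_ne_zero hδ
      refine Set.mem_iUnion₂.2 ⟨v, hv, ?_⟩
      simp only [Set.mem_preimage, Finset.mem_coe, Finsupp.mem_support_iff]
      intro h0
      exact h (by beta_reduce; rw [h0, ip_zero_right, smul_zero]))

variable {Γ B}

theorem inn_apply (Φ Ψ : V →₀ X) (δ : Γ) :
    inn Γ B Φ Ψ δ = Φ.sum fun v x => (anchor Γ v)⁻¹ • ip (B := B) x (Ψ (op δ • v)) := rfl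

theorem inn_add_left (Φ Φ' Ψ : V →₀ X) : inn Γ B (Φ + Φ') Ψ = inn Γ B Φ Ψ + inn Γ B Φ' Ψ := by
  ext δ
  rw [Finsupp.add_apply, inn_apply, inn_apply, inn_apply, Finsupp.sum_add_index'
    (fun v => by rw [ip_zero_left, smul_zero]) (fun v x y => by rw [ip_add_left, smul_add])]

theorem inn_smul_left (c : ℂ) (Φ Ψ : V →₀ X) : inn Γ B (c • Φ) Ψ = star c • inn Γ B Φ Ψ := by
  ext δ
  rw [Finsupp.smul_apply, inn_apply, inn_apply, Finsupp.sum_smul_index'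
    (fun v => by rw [ip_zero_left, smul_zero]), Finsupp.smul_sum]
  refine Finsupp.sum_congr fun v _ => ?_
  rw [ip_smul_left, CStarAction.smul_complex_alg]

theorem inn_add_right (Φ Ψ Ψ' : V →₀ X) : inn Γ B Φ (Ψ + Ψ') = inn Γ B Φ Ψ + inn Γ B Φ Ψ' := by
  ext δ
  rw [Finsupp.add_apply, inn_apply, inn_apply, inn_apply, ← Finsupp.sum_add]
  refine Finsupp.sum_congr fun v _ => ?_
  rw [Finsupp.add_apply, ip_add_right, smul_add]

theorem inn_smul_right (c : ℂ) (Φ Ψ : V →₀ X) : inn Γ B Φ (c • Ψ) = c • inn Γ B Φ Ψ := by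
  ext δ
  rw [Finsupp.smul_apply, inn_apply, inn_apply, Finsupp.smul_sum]
  refine Finsupp.sum_congr fun v _ => ?_
  rw [Finsupp.smul_apply, ip_smul_right, CStarAction.smul_complex_alg]

variable (Γ B V X) in
/-- The inner product of `C_c(V, X)` as a sesquilinear map. -/
def innₛₗ : (V →₀ X) →ₗ⋆[ℂ] (V →₀ X) →ₗ[ℂ] (Γ →₀ B) :=
  LinearMap.mk₂'ₛₗ (starRingEnd ℂ) (RingHom.id ℂ) (inn Γ B) inn_add_left inn_smul_left
    inn_add_right inn_smul_right

theorem innₛₗ_apply (Φ Ψ : V →₀ X) : innₛₗ Γ B V X Φ Ψ = inn Γ B Φ Ψ := rfl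

theorem inn_zero_left (Ψ : V →₀ X) : inn Γ B 0 Ψ = 0 := by simp [← innₛₗ_apply]

theorem inn_zero_right (Ψ : V →₀ X) : inn Γ B Ψ 0 = 0 := by simp [← innₛₗ_apply]

theorem inn_single_apply [DecidableEq V] (v w : V) (x y : X) (δ : Γ) :
    inn Γ B (single v x) (single w y) δ =
      if op δ • v = w then (anchor Γ v)⁻¹ • ip (B := B) x y else 0 := by
  rw [inn_apply, Finsupp.sum_single_index (by rw [ip_zero_left, smul_zero]), Finsupp.single_apply]
  by_cases h : op δ • v = w
  · rw [if_pos h, if_pos h.symm]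
  · rw [if_neg h, if_neg (fun h' => h h'.symm), ip_zero_right, smul_zero]

theorem inn_single_eq (v : V) (x y : X) (δ : Γ) :
    inn Γ B (single v x) (single (op δ • v) y) = single δ ((anchor Γ v)⁻¹ • ip (B := B) x y) := by
  classical
  ext ε
  rw [inn_single_apply, Finsupp.single_apply]
  by_cases h : δ = ε
  · rw [if_pos h, if_pos (by rw [h])]
  · rw [if_neg h, if_neg fun h' => h (op_smul_injective v h'.symm)]

theorem inn_single_ne {v w : V} (h : ∀ δ : Γ, op δ • v ≠ w) (x y : X) :
    inn Γ B (single v x) (single w y) = 0 := by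
  classical
  ext ε
  rw [inn_single_apply, if_neg (h ε), Finsupp.zero_apply]

/-- The involution of `C_c(Γ, B)`: `f*(γ) = γ(f(γ⁻¹)*)`. -/
def cstar (f : Γ →₀ B) : Γ →₀ B :=
  Finsupp.ofSupportFinite (fun γ => γ • star (f γ⁻¹)) (by
    refine (f.support.finite_toSet.preimage inv_injective.injOn).subset fun γ hγ => ?_
    simp only [Set.mem_preimage, Finset.mem_coe, Finsupp.mem_support_iff]
    intro h
    exact hγ (by beta_reduce; rw [h, star_zero, smul_zero]))

theorem cstar_apply (f : Γ →₀ B) (γ : Γ) : cstar f γ = γ • star (f γ⁻¹) := rfl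

theorem cstar_add (f g : Γ →₀ B) : cstar (f + g) = cstar f + cstar g := by
  ext γ; simp [cstar_apply]

theorem cstar_smul (c : ℂ) (f : Γ →₀ B) : cstar (c • f) = star c • cstar f := by
  ext γ
  rw [Finsupp.smul_apply, cstar_apply, cstar_apply, Finsupp.smul_apply, star_smul]
  exact CStarAction.smul_complex_alg (γ : S) _ _

theorem cstar_zero : cstar (0 : Γ →₀ B) = 0 := by
  ext γ; simp [cstar_apply]

theorem cstar_single (γ : Γ) (b : B) : cstar (single γ b) = single γ⁻¹ (γ⁻¹ • star b) := by
  classical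
  ext δ
  rw [cstar_apply, Finsupp.single_apply, Finsupp.single_apply]
  by_cases h : γ = δ⁻¹
  · rw [if_pos h, if_pos (by rw [h, inv_inv]), h, inv_inv]
  · rw [if_neg h, if_neg (fun h' => h (by rw [← h', inv_inv])), star_zero, smul_zero]

theorem cstar_cstar (f : Γ →₀ B) : cstar (cstar f) = f := by
  ext γ
  rw [cstar_apply, cstar_apply, show γ⁻¹ • star (f γ⁻¹⁻¹) = star (γ⁻¹ • f γ⁻¹⁻¹) from
    CStarAction.smul_star_alg (γ⁻¹ : Γ).1 _, star_star, smul_inv_smul, inv_inv]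

end inner

section identities

theorem rsmul_smul [EquivariantModule S B X] (s : S) (x : X) (b : B) :
    s • rsmul x b = rsmul (s • x) (s • b) := EquivariantModule.smul_rsmul s x b

variable [AnchoredBiset Γ V]

theorem lconv_lconv [HilbertBimodule A B X] [EquivariantBimodule S A B X] (f g : Γ →₀ A)
    (Ψ : V →₀ X) : lconv B f (lconv B g Ψ) = lconv B (lconv A f g) Ψ := by
  induction f using Finsupp.induction_linear with
  | zero => simp
  | add f f' hf hf' => simp only [map_add, LinearMap.add_apply, hf, hf']
  | single γ a =>
    induction g using Finsupp.induction_linear with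
    | zero => simp
    | add g g' hg hg' => simp only [map_add, LinearMap.add_apply, hg, hg']
    | single δ b =>
      induction Ψ using Finsupp.induction_linear with
      | zero => simp
      | add Ψ Ψ' h h' => simp only [map_add, h, h']
      | single v x =>
        rw [lconv_single, lconv_single, lconv_single, lconv_single, smul_eq_mul, mul_smul,
          self_lact, map_mul, mul_smul, show γ • lact (B := B) b (δ • x) =
            lact (B := B) (γ • b) (γ • δ • x) from EquivariantBimodule.smul_lact (γ : S) b _]
        rfl

theorem lconv_rconv [HilbertBimodule A B X] [EquivariantBimodule S A B X] (f : Γ →₀ A)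
    (Φ : V →₀ X) (g : Γ →₀ B) : lconv B f (rconv Φ g) = rconv (lconv B f Φ) g := by
  induction f using Finsupp.induction_linear with
  | zero => simp
  | add f f' hf hf' => simp only [map_add, LinearMap.add_apply, hf, hf']
  | single γ a =>
    induction g using Finsupp.induction_linear with
    | zero => simp
    | add g g' hg hg' => simp only [map_add, hg, hg']
    | single δ b =>
      induction Φ using Finsupp.induction_linear with
      | zero => simp
      | add Ψ Ψ' h h' => simp only [map_add, LinearMap.add_apply, h, h']
      | single v x =>
        rw [rconv_single, lconv_single, lconv_single, rconv_single, smul_op_smul, anchor_smul,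
          mul_smul, ← InteriorTensor.φ_rsmul]
        congr 2
        exact EquivariantModule.smul_rsmul (γ : S) x _

theorem inn_rconv (Φ Ψ : V →₀ X) (f : Γ →₀ B) :
    inn Γ B Φ (rconv Ψ f) = lconv B (inn Γ B Φ Ψ) f := by
  induction f using Finsupp.induction_linear with
  | zero => simp [inn_zero_right]
  | add f f' hf hf' => simp only [map_add, inn_add_right, hf, hf']
  | single γ b =>
    induction Φ using Finsupp.induction_linear with
    | zero => simp [inn_zero_left]
    | add Φ Φ' h h' => simp only [map_add, LinearMap.add_apply, inn_add_left, h, h']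
    | single v x =>
      induction Ψ using Finsupp.induction_linear with
      | zero => simp [inn_zero_right]
      | add Φ Φ' h h' => simp only [map_add, LinearMap.add_apply, inn_add_right, h, h']
      | single w y =>
        rw [rconv_single]
        by_cases h : ∃ δ : Γ, op δ • v = w
        · obtain ⟨δ, rfl⟩ := h
          rw [inn_single_eq, lconv_single, smul_smul, ← MulOpposite.op_mul, inn_single_eq,
            ip_rsmul_right, CStarAction.smul_mul_alg, anchor_op_smul, mul_smul, inv_smul_smul,
            self_lact, smul_eq_mul]
          rfl
        · push Not at h
          rw [inn_single_ne h, inn_single_ne, map_zero, LinearMap.zero_apply]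
          intro δ h'
          refine h (δ * γ⁻¹) ?_
          rw [MulOpposite.op_mul, mul_smul, h', MulOpposite.op_inv, inv_smul_smul]

theorem inn_inn (ξ : Γ →₀ B) (Φ Ω : V →₀ X) :
    inn Γ B ξ (inn Γ B Φ Ω) = inn Γ B (rconv Φ ξ) Ω := by
  induction ξ using Finsupp.induction_linear with
  | zero => simp [inn_zero_left]
  | add f f' hf hf' => simp only [map_add, inn_add_left, hf, hf']
  | single γ b =>
    induction Φ using Finsupp.induction_linear with
    | zero => simp [inn_zero_left, inn_zero_right]
    | add Φ Φ' h h' =>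
      simp only [map_add, LinearMap.add_apply, inn_add_left, inn_add_right, h, h']
    | single v x =>
      induction Ω using Finsupp.induction_linear with
      | zero => simp [inn_zero_right]
      | add Φ Φ' h h' => simp only [inn_add_right, h, h']
      | single w y =>
        rw [rconv_single]
        by_cases h : ∃ δ : Γ, op δ • v = w
        · obtain ⟨δ, rfl⟩ := h
          obtain ⟨ε, rfl⟩ : ∃ ε, δ = γ * ε := ⟨γ⁻¹ * δ, by group⟩
          rw [inn_single_eq, show γ * ε = op ε • γ from rfl, inn_single_eq,
            show op (op ε • γ) = op ε * op γ from rfl, mul_smul, inn_single_eq, self_ip,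
            ip_rsmul_left, anchor_op_smul, mul_inv_rev, mul_smul, CStarAction.smul_mul_alg,
            CStarAction.smul_mul_alg, CStarAction.smul_mul_alg, ← CStarAction.smul_star_alg,
            inv_smul_smul]
          rfl
        · push Not at h
          rw [inn_single_ne h, inn_single_ne, inn_zero_right]
          intro δ h'
          refine h (γ * δ) ?_
          rw [MulOpposite.op_mul, mul_smul, h']

theorem inn_lconv [HilbertBimodule A B X] [EquivariantBimodule S A B X] (f : Γ →₀ A)
    (Φ Ψ : V →₀ X) : inn Γ B (lconv B f Φ) Ψ = inn Γ B Φ (lconv B (cstar f) Ψ) := by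
  induction f using Finsupp.induction_linear with
  | zero => simp [inn_zero_left, inn_zero_right, cstar_zero]
  | add f f' hf hf' =>
    simp only [map_add, LinearMap.add_apply, cstar_add, inn_add_left, inn_add_right, hf, hf']
  | single γ a =>
    induction Φ using Finsupp.induction_linear with
    | zero => simp [inn_zero_left]
    | add Φ Φ' h h' =>
      simp only [map_add, inn_add_left, h, h']
    | single v x =>
      induction Ψ using Finsupp.induction_linear with
      | zero => simp [inn_zero_right]
      | add Φ Φ' h h' => simp only [map_add, inn_add_right, h, h']
      | single w y =>
        rw [cstar_single, lconv_single, lconv_single]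
        by_cases h : ∃ δ : Γ, op δ • (γ • v) = w
        · obtain ⟨δ, rfl⟩ := h
          rw [inn_single_eq, ← smul_op_smul, inv_smul_smul, inn_single_eq, anchor_smul,
            mul_inv_rev, mul_smul, Adj.ip_left, ← map_star, EquivariantModule.smul_ip,
            EquivariantBimodule.smul_lact]
          congr 3
          exact inv_smul_smul γ x
        · push Not at h
          rw [inn_single_ne h, inn_single_ne]
          intro δ h'
          refine h δ ?_
          rw [← smul_op_smul, h', smul_inv_smul]

theorem cstar_inn [EquivariantModule S B X] (Φ Ψ : V →₀ X) :
    cstar (inn Γ B Φ Ψ) = inn Γ B Ψ Φ := by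
  induction Φ using Finsupp.induction_linear with
  | zero => simp [inn_zero_left, inn_zero_right, cstar_zero]
  | add Φ Φ' h h' => simp only [inn_add_left, inn_add_right, cstar_add, h, h']
  | single v x =>
    induction Ψ using Finsupp.induction_linear with
    | zero => simp [inn_zero_left, inn_zero_right, cstar_zero]
    | add Φ Φ' h h' => simp only [inn_add_left, inn_add_right, cstar_add, h, h']
    | single w y =>
      by_cases h : ∃ δ : Γ, op δ • v = w
      · obtain ⟨δ, rfl⟩ := h
        have hv : single v x = single (op δ⁻¹ • op δ • v) x := by
          rw [MulOpposite.op_inv, inv_smul_smul]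
        rw [inn_single_eq, cstar_single, hv, inn_single_eq, anchor_op_smul, mul_inv_rev, mul_smul,
          ← CStarAction.smul_star_alg, star_ip]
        rfl
      · push Not at h
        rw [inn_single_ne h, inn_single_ne, cstar_zero]
        intro δ h'
        refine h δ⁻¹ ?_
        rw [← h', MulOpposite.op_inv, inv_smul_smul]

theorem inn_one_pos (Φ : V →₀ X) : ∃ b, inn Γ B Φ Φ 1 = star b * b := by
  rw [inn_apply]
  refine InteriorTensor.exists_star_mul_sum _ _ fun v _ => ?_
  beta_reduce
  rw [MulOpposite.op_one, one_smul]
  exact CStarAction.smul_pos _ (ip_self_pos _)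

end identities

end convolution

end

noncomputable section

set_option linter.unusedSectionVars false

/-! ### The reduced crossed product -/

open HilbertModule HilbertBimodule AnchoredBiset
open Finsupp (single)

section crossedProduct

variable {S : Type*} [Group S] (Γ : Subgroup S) (B : Type*) [NonUnitalCStarAlgebra B]
  [CStarAction S B]

variable {Γ B} in
theorem lconv_single_one (f : Γ →₀ B) (b : B) (γ : Γ) :
    lconv B f (single (1 : Γ) b) γ = f γ * γ • b := by
  classical
  induction f using Finsupp.induction_linear with
  | zero => simp
  | add f f' hf hf' =>
    rw [map_add, LinearMap.add_apply, Finsupp.add_apply, hf, hf', Finsupp.add_apply, add_mul]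
  | single δ a =>
    rw [lconv_single, smul_eq_mul, mul_one, Finsupp.single_apply, Finsupp.single_apply]
    by_cases h : δ = γ
    · rw [if_pos h, if_pos h, self_lact, h]
    · rw [if_neg h, if_neg h, zero_mul]

/-- The `B`-valued inner product `⟨f, g⟩ = (f* * g)(1) = ∑_γ γ⁻¹(f(γ)* g(γ))` on `C_c(Γ, B)`.
The map `f ↦ (γ ↦ γ⁻¹(f(γ)))` identifies it with the standard inner product `∑_γ ξ(γ)* η(γ)`. -/
def l2Pre : PreHilbert B (Γ →₀ B) where
  ip f g := inn Γ B f g 1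
  ip_add_right f g h := by rw [inn_add_right, Finsupp.add_apply]
  ip_smul_right c f g := by rw [inn_smul_right, Finsupp.smul_apply]
  star_ip f g := by
    rw [← cstar_inn f g, cstar_apply, one_smul, inv_one]
  ip_self_pos f := inn_one_pos f
  dense_right := dense_univ.mono fun b _ g => ⟨rconv g (single 1 b), fun f => by
    rw [inn_rconv, lconv_single_one, one_smul]⟩

/-- The Hilbert `B`-module `ℓ²(Γ, B)`. -/
abbrev L2 : Type _ := (l2Pre Γ B).Completion

variable {Γ B}

theorem norm_lconv_single_le (γ : Γ) (a : B) (g : Γ →₀ B) :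
    ‖(l2Pre Γ B).toCompletion (lconv B (single γ a) g)‖ ≤
      ‖a‖ * ‖(l2Pre Γ B).toCompletion g‖ := by
  let _ := CStarAlgebra.spectralOrder B
  have := CStarAlgebra.spectralOrderedRing B
  have hsum : ∀ d : B, inn Γ B g (lconv B (single (1 : Γ) d) g) 1 =
      g.sum fun γ b => (γ : S)⁻¹ • (star b * (d * g γ)) := by
    intro d
    rw [inn_apply]
    refine Finsupp.sum_congr fun γ _ => ?_
    rw [lconv_apply, Finsupp.sum_single_index (by rw [map_zero]; rfl), MulOpposite.op_one, one_smul,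
      inv_one, one_smul, one_smul]
    rfl
  have hsum' : inn Γ B g g 1 = g.sum fun γ b => (γ : S)⁻¹ • (star b * g γ) := by
    rw [inn_apply]
    refine Finsupp.sum_congr fun γ _ => ?_
    rw [MulOpposite.op_one, one_smul]
    rfl
  set c : B := γ⁻¹ • a with hc
  have h1 : inn Γ B (lconv B (single γ a) g) (lconv B (single γ a) g) 1 =
      inn Γ B g (lconv B (single (1 : Γ) (star c * c)) g) 1 := by
    rw [inn_lconv, lconv_lconv, cstar_single, lconv_single, smul_eq_mul, inv_mul_cancel, self_lact,
      show γ⁻¹ • star a = star (γ⁻¹ • a) from CStarAction.smul_star_alg (γ⁻¹ : Γ).1 a]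
  have h2 : inn Γ B g (lconv B (single (1 : Γ) (star c * c)) g) 1 ≤
      ((‖a‖ ^ 2 : ℝ) : ℂ) • inn Γ B g g 1 := by
    rw [hsum, hsum', Finsupp.smul_sum]
    refine Finset.sum_le_sum fun δ _ => ?_
    beta_reduce
    rw [← CStarAction.smul_complex_alg, ← sub_nonneg, ← smul_sub]
    refine exists_star_mul_iff.1 (CStarAction.smul_pos _ (exists_star_mul_iff.2 ?_))
    have h3 := CStarAlgebra.star_left_conjugate_le_norm_smul (a := g δ) (b := star c * c)
      (.star_mul_self c)
    rw [CStarRing.norm_star_mul_self, hc, show ‖γ⁻¹ • a‖ = ‖a‖ from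
      CStarAction.norm_smul (γ⁻¹ : Γ).1 a, ← sq, mul_assoc] at h3
    rw [sub_nonneg]
    exact h3
  rw [← h1] at h2
  have h3 := CStarAlgebra.norm_le_norm_of_nonneg_of_le (exists_star_mul_iff.1 (inn_one_pos _)) h2
  rw [norm_smul, Complex.norm_real, Real.norm_of_nonneg (by positivity)] at h3
  rw [PreHilbert.norm_toCompletion, PreHilbert.norm_toCompletion]
  calc _ ≤ √(‖a‖ ^ 2 * ‖inn Γ B g g 1‖) := Real.sqrt_le_sqrt h3
    _ = _ := by rw [Real.sqrt_mul (by positivity), Real.sqrt_sq (norm_nonneg _)]; rfl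

theorem exists_norm_lconv_le (f : Γ →₀ B) : ∃ K, ∀ g,
    ‖(l2Pre Γ B).toCompletion (lconv B f g)‖ ≤ K * ‖(l2Pre Γ B).toCompletion g‖ := by
  induction f using Finsupp.induction_linear with
  | zero => exact ⟨0, fun g => by simp⟩
  | add f f' hf hf' =>
    obtain ⟨K, hK⟩ := hf
    obtain ⟨K', hK'⟩ := hf'
    refine ⟨K + K', fun g => ?_⟩
    rw [map_add, LinearMap.add_apply, map_add, add_mul]
    exact (norm_add_le _ _).trans (add_le_add (hK g) (hK' g))
  | single γ a => exact ⟨‖a‖, norm_lconv_single_le γ a⟩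

theorem l2Pre_lconv (f g h : Γ →₀ B) :
    (l2Pre Γ B).ip (lconv B f g) h = (l2Pre Γ B).ip g (lconv B (cstar f) h) := by
  change inn Γ B _ _ 1 = inn Γ B _ _ 1
  rw [inn_lconv]

/-- The operator of left convolution with `f` on `ℓ²(Γ, B)`. -/
def regularOp (f : Γ →₀ B) : Adj B (L2 Γ B) :=
  (l2Pre Γ B).liftAdj (lconv B f) (lconv B (cstar f)) (exists_norm_lconv_le f)
    (exists_norm_lconv_le _) (l2Pre_lconv f)

theorem regularOp_coe (f g : Γ →₀ B) :
    regularOp f ((l2Pre Γ B).toCompletion g) = (l2Pre Γ B).toCompletion (lconv B f g) :=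
  PreHilbert.liftAdj_coe _ _ _ _ _ _ _

theorem Adj.l2_ext {T U : Adj B (L2 Γ B)} (h : ∀ g, T ((l2Pre Γ B).toCompletion g) =
    U ((l2Pre Γ B).toCompletion g)) : T = U :=
  Adj.ext (PreHilbert.clm_ext h)

theorem star_regularOp (f : Γ →₀ B) : star (regularOp f) = regularOp (cstar f) := by
  refine (PreHilbert.liftAdj_star _ _ _ (exists_norm_lconv_le f)
    (exists_norm_lconv_le _) (l2Pre_lconv f) fun g h => ?_).trans (Adj.l2_ext fun g => ?_)
  · rw [l2Pre_lconv, cstar_cstar]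
  · exact (PreHilbert.liftAdj_coe _ _ _ _ _ _ _).trans (regularOp_coe _ _).symm

variable (Γ B) in
/-- The regular representation of the convolution algebra `C_c(Γ, B)` on `ℓ²(Γ, B)`. -/
def regularRep : (Γ →₀ B) →ₗ[ℂ] Adj B (L2 Γ B) where
  toFun := regularOp
  map_add' f g := Adj.l2_ext fun h => by
    change _ = regularOp f _ + regularOp g _
    rw [regularOp_coe, regularOp_coe, regularOp_coe, map_add, LinearMap.add_apply, map_add]
  map_smul' c f := Adj.l2_ext fun h => by
    change _ = c • regularOp f _
    rw [regularOp_coe, regularOp_coe, map_smul, LinearMap.smul_apply, map_smul]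

theorem regularRep_coe (f g : Γ →₀ B) :
    regularRep Γ B f ((l2Pre Γ B).toCompletion g) = (l2Pre Γ B).toCompletion (lconv B f g) :=
  regularOp_coe f g

theorem regularRep_mul (f g : Γ →₀ B) :
    regularRep Γ B f * regularRep Γ B g = regularRep Γ B (lconv B f g) :=
  Adj.l2_ext fun h => by
    change regularOp f (regularOp g _) = regularOp _ _
    rw [regularOp_coe, regularOp_coe, regularOp_coe, lconv_lconv]

theorem regularRep_star (f : Γ →₀ B) : star (regularRep Γ B f) = regularRep Γ B (cstar f) :=
  star_regularOp f

variable (Γ B) in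
/-- The algebra of convolution operators. -/
def regularRange : NonUnitalStarSubalgebra ℂ (Adj B (L2 Γ B)) where
  carrier := Set.range (regularRep Γ B)
  zero_mem' := ⟨0, map_zero _⟩
  add_mem' := by
    rintro _ _ ⟨f, rfl⟩ ⟨g, rfl⟩
    exact ⟨f + g, map_add _ _ _⟩
  mul_mem' := by
    rintro _ _ ⟨f, rfl⟩ ⟨g, rfl⟩
    exact ⟨_, (regularRep_mul f g).symm⟩
  smul_mem' := by
    rintro c _ ⟨f, rfl⟩
    exact ⟨c • f, map_smul _ _ _⟩
  star_mem' := by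
    rintro _ ⟨f, rfl⟩
    exact ⟨_, (regularRep_star f).symm⟩

variable (Γ B) in
/-- The reduced crossed product `B ⋊_r Γ`: the completion of the convolution algebra `C_c(Γ, B)` in
the operator norm of its regular representation on `ℓ²(Γ, B)`, that is, the norm closure of the
algebra of convolution operators. -/
def ReducedCrossedProduct : Type _ := (regularRange Γ B).topologicalClosure

instance : NonUnitalCStarAlgebra (ReducedCrossedProduct Γ B) :=
  NonUnitalStarSubalgebra.nonUnitalCStarAlgebra (regularRange Γ B).topologicalClosure
    (h_closed := NonUnitalStarSubalgebra.isClosed_topologicalClosure _)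

/-- An element of the reduced crossed product, as an operator on `ℓ²(Γ, B)`. -/
def ReducedCrossedProduct.toAdj (T : ReducedCrossedProduct Γ B) : Adj B (L2 Γ B) := T.1

theorem ReducedCrossedProduct.ext {T U : ReducedCrossedProduct Γ B} (h : T.toAdj = U.toAdj) :
    T = U := Subtype.ext h

variable (Γ B) in
/-- The map from the convolution algebra `C_c(Γ, B)` to `B ⋊_r Γ`. -/
def ofCc : (Γ →₀ B) →ₗ[ℂ] ReducedCrossedProduct Γ B where
  toFun f := ⟨regularRep Γ B f,
    NonUnitalStarSubalgebra.le_topologicalClosure (regularRange Γ B) ⟨f, rfl⟩⟩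
  map_add' f g := ReducedCrossedProduct.ext (map_add _ f g)
  map_smul' c f := ReducedCrossedProduct.ext (map_smul _ c f)

theorem toAdj_ofCc (f : Γ →₀ B) : (ofCc Γ B f).toAdj = regularRep Γ B f := rfl

theorem ofCc_mul (f g : Γ →₀ B) : ofCc Γ B f * ofCc Γ B g = ofCc Γ B (lconv B f g) :=
  ReducedCrossedProduct.ext (regularRep_mul f g)

theorem ofCc_star (f : Γ →₀ B) : star (ofCc Γ B f) = ofCc Γ B (cstar f) :=
  ReducedCrossedProduct.ext (regularRep_star f)

theorem denseRange_ofCc : DenseRange (ofCc Γ B) := by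
  intro T
  refine closure_subtype.2 ?_
  have h : (Subtype.val '' Set.range (ofCc Γ B)) = Set.range (regularRep Γ B) := by
    refine (Set.range_comp _ _).symm.trans ?_
    rfl
  refine (congrArg (fun s => T.1 ∈ closure s) h).mpr ?_
  exact T.2

end crossedProduct

/-! ### The completed bimodules -/

section star

variable {S : Type*} [Group S] {Γ : Subgroup S} {B : Type*} [NonUnitalCStarAlgebra B]
  [CStarAction S B]

theorem cstar_lconv (f g : Γ →₀ B) : cstar (lconv B f g) = lconv B (cstar g) (cstar f) := by
  induction f using Finsupp.induction_linear with
  | zero => simp [cstar_zero]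
  | add f f' hf hf' => simp only [map_add, LinearMap.add_apply, cstar_add, hf, hf']
  | single γ a =>
    induction g using Finsupp.induction_linear with
    | zero => simp [cstar_zero]
    | add f f' hf hf' => simp only [map_add, LinearMap.add_apply, cstar_add, hf, hf']
    | single δ b =>
      have h : (γ * δ)⁻¹ • star (a * γ • b) = δ⁻¹ • star b * δ⁻¹ • γ⁻¹ • star a := by
        have h1 : ∀ (ε : Γ) (x y : B), ε • (x * y) = ε • x * ε • y :=
          fun ε => CStarAction.smul_mul_alg (ε : S)
        have h2 : ∀ (ε : Γ) (x : B), star (ε • x) = ε • star x :=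
          fun ε x => (CStarAction.smul_star_alg (ε : S) x).symm
        rw [star_mul, h2, mul_inv_rev, mul_smul, h1, h1, inv_smul_smul]
      rw [lconv_single, cstar_single, cstar_single, cstar_single, lconv_single, smul_eq_mul,
        smul_eq_mul, mul_inv_rev, self_lact, self_lact, ← mul_inv_rev, h]

end star


section completion

variable {S : Type*} [Group S] (Γ : Subgroup S) (B V X : Type*)
  [NonUnitalCStarAlgebra B] [CStarAction S B] [MulAction Γ V] [MulAction Γᵐᵒᵖ V]
  [AnchoredBiset Γ V] [NormedAddCommGroup X] [NormedSpace ℂ X] [CompleteSpace X]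
  [HilbertModule B X] [DistribMulAction S X] [EquivariantModule S B X]

variable {Γ B V X} in
theorem ofCc_inn_pos (Φ : V →₀ X) : ∃ d, ofCc Γ B (inn Γ B Φ Φ) = star d * d := by
  refine exists_star_mul_of_rep (D := ReducedCrossedProduct Γ B) (F := L2 Γ B) (ip (B := B))
    (fun T x => T.toAdj x) (fun x y => ?_) ip_self_pos (fun a b x => rfl) (fun a x => rfl)
    (fun a x y => Adj.ip_left a.toAdj x y) (fun a h => ?_) ?_ fun x => ?_
  · exact map_neg ((toPreHilbert B (L2 Γ B)).ipₛₗ x) y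
  · exact ReducedCrossedProduct.ext (Adj.ext_apply fun x => ip_self_eq_zero (B := B) (h x))
  · rw [ofCc_star, cstar_inn]
  · let _ := CStarAlgebra.spectralOrder B
    have := CStarAlgebra.spectralOrderedRing B
    rw [exists_star_mul_iff]
    refine (l2Pre Γ B).ind (p := fun x => 0 ≤ (l2Pre Γ B).cip x
      ((regularRep Γ B (inn Γ B Φ Φ)).toCLM x)) ?_ (fun g => ?_) x
    · exact CStarAlgebra.isClosed_nonneg.preimage ((l2Pre Γ B).continuous_cip_comp continuous_id
        (regularRep Γ B (inn Γ B Φ Φ)).toCLM.continuous)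
    · rw [regularRep_coe, PreHilbert.cip_coe]
      change 0 ≤ inn Γ B g (lconv B (inn Γ B Φ Φ) g) 1
      rw [← inn_rconv, inn_inn]
      exact exists_star_mul_iff.1 (inn_one_pos _)

/-- `C_c(V, X)` with its inner product, viewed in `B ⋊_r Γ`. -/
def ccPre : PreHilbert (ReducedCrossedProduct Γ B) (V →₀ X) where
  ip Φ Ψ := ofCc Γ B (inn Γ B Φ Ψ)
  ip_add_right Φ Ψ Ω := by rw [inn_add_right, map_add]
  ip_smul_right c Φ Ψ := by rw [inn_smul_right, map_smul]
  star_ip Φ Ψ := by rw [ofCc_star, cstar_inn]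
  ip_self_pos Φ := ofCc_inn_pos Φ
  dense_right := denseRange_ofCc.mono (by
    rintro _ ⟨f, rfl⟩ Ψ
    exact ⟨rconv Ψ f, fun Φ => by rw [inn_rconv, ofCc_mul]⟩)

/-- The Hilbert `B ⋊_r Γ`-module completion of `C_c(V, X)`. -/
abbrev CcCompletion : Type _ := (ccPre Γ B V X).Completion

end completion

/-! ### The algebraic balanced tensor product -/

section balanced

variable {S : Type*} [Group S] (Γ : Subgroup S) (A B C V W X Y : Type*)
  [NonUnitalCStarAlgebra A] [NonUnitalCStarAlgebra B] [NonUnitalCStarAlgebra C]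
  [CStarAction S A] [CStarAction S B] [CStarAction S C]
  [MulAction Γ V] [MulAction Γᵐᵒᵖ V] [AnchoredBiset Γ V]
  [MulAction Γ W] [MulAction Γᵐᵒᵖ W] [AnchoredBiset Γ W]
  [NormedAddCommGroup X] [NormedSpace ℂ X] [CompleteSpace X]
  [HilbertModule B X] [DistribMulAction S X]
  [NormedAddCommGroup Y] [NormedSpace ℂ Y] [CompleteSpace Y]
  [HilbertModule C Y] [HilbertBimodule B C Y] [DistribMulAction S Y] [EquivariantBimodule S B C Y]

/-- The subspace spanned by the elements `Φ * f ⊗ Ψ - Φ ⊗ f * Ψ`. -/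
def balancing : Submodule ℂ ((V →₀ X) ⊗[ℂ] (W →₀ Y)) :=
  Submodule.span ℂ {z | ∃ (Φ : V →₀ X) (f : Γ →₀ B) (Ψ : W →₀ Y),
    z = rconv Φ f ⊗ₜ[ℂ] Ψ - Φ ⊗ₜ[ℂ] lconv C f Ψ}

/-- The algebraic tensor product of `C_c(V, X)` and `C_c(W, Y)` over `C_c(Γ, B)`. -/
abbrev BalancedTensor : Type _ := ((V →₀ X) ⊗[ℂ] (W →₀ Y)) ⧸ balancing Γ B C V W X Y

namespace BalancedTensor

variable {V W X Y} in
/-- The elementary tensor `Φ ⊗ Ψ`. -/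
def tmul (Φ : V →₀ X) (Ψ : W →₀ Y) : BalancedTensor Γ B C V W X Y :=
  (balancing Γ B C V W X Y).mkQ (Φ ⊗ₜ Ψ)

variable {Γ B C V W X Y}

theorem lift_ker {M : Type*} [AddCommGroup M] [Module ℂ M] {T : (V →₀ X) ⊗[ℂ] (W →₀ Y) →ₗ[ℂ] M}
    (h : ∀ (Φ : V →₀ X) (f : Γ →₀ B) (Ψ : W →₀ Y), T (rconv Φ f ⊗ₜ Ψ) = T (Φ ⊗ₜ lconv C f Ψ)) :
    balancing Γ B C V W X Y ≤ LinearMap.ker T := by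
  refine Submodule.span_le.2 ?_
  rintro _ ⟨Φ, f, Ψ, rfl⟩
  simp only [SetLike.mem_coe, LinearMap.mem_ker, map_sub, h, sub_self]

theorem tmul_balanced (Φ : V →₀ X) (f : Γ →₀ B) (Ψ : W →₀ Y) :
    tmul Γ B C (rconv Φ f) Ψ = tmul Γ B C Φ (lconv C f Ψ) :=
  (Submodule.Quotient.eq _).2 (Submodule.subset_span ⟨Φ, f, Ψ, rfl⟩)

variable (Γ B C V W X Y) in
/-- The right action of `f ∈ C_c(Γ, C)`: `(Φ ⊗ Ψ) * f = Φ ⊗ (Ψ * f)`. -/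
def rightConv (f : Γ →₀ C) : BalancedTensor Γ B C V W X Y →ₗ[ℂ] BalancedTensor Γ B C V W X Y :=
  (balancing Γ B C V W X Y).liftQ
    ((balancing Γ B C V W X Y).mkQ ∘ₗ TensorProduct.map LinearMap.id (rconv.flip f))
    (lift_ker fun Φ g Ψ => by
      change tmul Γ B C (rconv Φ g) (rconv Ψ f) = tmul Γ B C Φ (rconv (lconv C g Ψ) f)
      rw [tmul_balanced, lconv_rconv])

theorem rightConv_tmul (f : Γ →₀ C) (Φ : V →₀ X) (Ψ : W →₀ Y) :
    rightConv Γ B C V W X Y f (tmul Γ B C Φ Ψ) = tmul Γ B C Φ (rconv Ψ f) := rfl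

section left

variable [HilbertBimodule A B X] [EquivariantBimodule S A B X]

variable (Γ B C V W X Y) {A} in
/-- The left action of `f ∈ C_c(Γ, A)`: `f * (Φ ⊗ Ψ) = (f * Φ) ⊗ Ψ`. -/
def leftConv (f : Γ →₀ A) : BalancedTensor Γ B C V W X Y →ₗ[ℂ] BalancedTensor Γ B C V W X Y :=
  (balancing Γ B C V W X Y).liftQ
    ((balancing Γ B C V W X Y).mkQ ∘ₗ TensorProduct.map (lconv B f) LinearMap.id)
    (lift_ker fun Φ g Ψ => by
      change tmul Γ B C (lconv B f (rconv Φ g)) Ψ = tmul Γ B C (lconv B f Φ) (lconv C g Ψ)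
      rw [lconv_rconv, tmul_balanced])

theorem leftConv_tmul (f : Γ →₀ A) (Φ : V →₀ X) (Ψ : W →₀ Y) :
    leftConv Γ B C V W X Y f (tmul Γ B C Φ Ψ) = tmul Γ B C (lconv B f Φ) Ψ := rfl

end left

section sesquilinear

variable [EquivariantModule S B X]

variable (Γ B C V W X Y) in
/-- The form `⟨Φ ⊗ Ψ, Φ' ⊗ Ψ'⟩ = ⟨Ψ, ⟨Φ, Φ'⟩ * Ψ'⟩` on the tensor product over `ℂ`. -/
def preForm : (V →₀ X) ⊗[ℂ] (W →₀ Y) →ₗ⋆[ℂ] (V →₀ X) ⊗[ℂ] (W →₀ Y) →ₗ[ℂ] (Γ →₀ C) :=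
  TensorProduct.lift <| LinearMap.mk₂'ₛₗ (starRingEnd ℂ) (starRingEnd ℂ)
    (fun Φ Ψ => TensorProduct.lift <| LinearMap.mk₂ ℂ
      (fun Φ' Ψ' => inn Γ C Ψ (lconv C (inn Γ B Φ Φ') Ψ'))
      (fun a b c => by simp only [inn_add_right, map_add, LinearMap.add_apply])
      (fun c a b => by simp only [inn_smul_right, map_smul, LinearMap.smul_apply])
      (fun a b c => by simp only [inn_add_right, map_add])
      (fun c a b => by simp only [inn_smul_right, map_smul]))
    (fun a b c => by
      refine TensorProduct.ext' fun x y => ?_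
      simp [inn_add_left, inn_add_right])
    (fun c a b => by
      refine TensorProduct.ext' fun x y => ?_
      simp [inn_smul_left, inn_smul_right])
    (fun a b c => by
      refine TensorProduct.ext' fun x y => ?_
      simp [inn_add_left])
    (fun c a b => by
      refine TensorProduct.ext' fun x y => ?_
      simp [inn_smul_left])

theorem preForm_tmul (Φ Φ' : V →₀ X) (Ψ Ψ' : W →₀ Y) :
    preForm Γ B C V W X Y (Φ ⊗ₜ Ψ) (Φ' ⊗ₜ Ψ') = inn Γ C Ψ (lconv C (inn Γ B Φ Φ') Ψ') := rfl

theorem inn_rconv_left (Φ Φ' : V →₀ X) (f : Γ →₀ B) :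
    inn Γ B (rconv Φ f) Φ' = lconv B (cstar f) (inn Γ B Φ Φ') := by
  rw [← cstar_inn Φ' (rconv Φ f), inn_rconv, cstar_lconv, cstar_inn]

variable (Γ B C V W X Y) in
/-- The `C_c(Γ, C)`-valued inner product `⟨Φ ⊗ Ψ, Φ' ⊗ Ψ'⟩ = ⟨Ψ, ⟨Φ, Φ'⟩ * Ψ'⟩` of the balanced
tensor product, see `form_tmul`. -/
def form : BalancedTensor Γ B C V W X Y →ₗ⋆[ℂ] BalancedTensor Γ B C V W X Y →ₗ[ℂ] (Γ →₀ C) :=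
  (balancing Γ B C V W X Y).liftQ
    { toFun := fun z => (balancing Γ B C V W X Y).liftQ (preForm Γ B C V W X Y z) (by
        refine lift_ker fun Φ f Ψ => ?_
        induction z with
        | zero => simp
        | add z₁ z₂ h₁ h₂ => simp only [map_add, LinearMap.add_apply, h₁, h₂]
        | tmul Φ' Ψ' => rw [preForm_tmul, preForm_tmul, inn_rconv, lconv_lconv])
      map_add' := fun z₁ z₂ => Submodule.linearMap_qext _ (TensorProduct.ext' fun Φ Ψ => by
        change preForm Γ B C V W X Y (z₁ + z₂) (Φ ⊗ₜ Ψ) =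
          preForm Γ B C V W X Y z₁ (Φ ⊗ₜ Ψ) + preForm Γ B C V W X Y z₂ (Φ ⊗ₜ Ψ)
        rw [map_add, LinearMap.add_apply])
      map_smul' := fun c z => Submodule.linearMap_qext _ (TensorProduct.ext' fun Φ Ψ => by
        change preForm Γ B C V W X Y (c • z) (Φ ⊗ₜ Ψ) =
          star c • preForm Γ B C V W X Y z (Φ ⊗ₜ Ψ)
        rw [LinearMap.map_smulₛₗ, LinearMap.smul_apply]
        rfl) } (by
    refine Submodule.span_le.2 ?_
    rintro _ ⟨Φ, f, Ψ, rfl⟩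
    refine LinearMap.mem_ker.2 ?_
    refine Submodule.linearMap_qext _ (TensorProduct.ext' fun Φ' Ψ' => ?_)
    change preForm Γ B C V W X Y (rconv Φ f ⊗ₜ Ψ - Φ ⊗ₜ lconv C f Ψ) (Φ' ⊗ₜ Ψ') = 0
    rw [map_sub, LinearMap.sub_apply, preForm_tmul, preForm_tmul, inn_rconv_left, inn_lconv,
      lconv_lconv, sub_self])

theorem form_tmul (Φ Φ' : V →₀ X) (Ψ Ψ' : W →₀ Y) :
    form Γ B C V W X Y (tmul Γ B C Φ Ψ) (tmul Γ B C Φ' Ψ') =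
      inn Γ C Ψ (lconv C (inn Γ B Φ Φ') Ψ') := rfl

end sesquilinear

end BalancedTensor

end balanced

/-- `X ⊗_B Y` for a Hilbert `B`-module `X` and a C*-`(B, C)`-bimodule `Y`. -/
abbrev BimoduleTensor (B C X Y : Type*) [NonUnitalCStarAlgebra B] [NonUnitalCStarAlgebra C]
    [NormedAddCommGroup X] [NormedSpace ℂ X] [CompleteSpace X] [HilbertModule B X]
    [NormedAddCommGroup Y] [NormedSpace ℂ Y] [CompleteSpace Y] [HilbertModule C Y]
    [HilbertBimodule B C Y] : Type _ :=
  InteriorTensor X (lact (A := B) (B := C) (X := Y))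

end

/-! The algebraic half rests on one-point functions. The map `convMap` is the bilinear extension of
(δ_v x, δ_w y) ↦ δ_[v,w] (x ⊗ m(v)y). Balancing, the bimodule rules, the formula for α and the
equality of inner products are all identities between expressions additive in every argument, so
each is checked on one-point functions only. There it reduces to the equivariance of the anchor and
of the module structures. The anchor takes values in a group and intertwines the Γ-actions with
translations, so both Γ-actions on V and on W are free; hence every sum over Γ that occurs has at
most one non-zero term.

The analytic half is one inequality, `norm_ccPre_lconv_le`: on E(V,X), left convolution by f ∈
C_c(Γ,A) is bounded by the norm of f in A ⋊_r Γ. It is what lets the reduced crossed product, and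
not just the convolution algebra, act. It comes from Fell absorption. Replace E(V,X) by the B-module
ℓ²(V,X), whose inner product is the value of ⟨Φ,Ψ⟩ at the identity. Since V is a free left Γ-set, it
has an equivariant map p : V → Γ, and p identifies the vectors f * Φ isometrically with vectors of
ℓ²(Γ,A) ⊗_A ℓ²(V,X), where convolution by h becomes λ(h) ⊗ 1, λ being the regular representation
(`algLeft_absorb`, `form_absorb`). So h acts on the vectors f * Φ with norm at most ‖λ(h)‖. Since A
may act degenerately on X, these vectors need not be dense; taking f = h* and using ‖T‖² = ‖TT*‖
gives the bound on all of ℓ²(V,X) (`norm_l2SpaceRep_le`). Finally ⟨g, ⟨Φ,Φ⟩ * g⟩(1) = ⟨Φ * g, Φ *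
g⟩(1) for g ∈ C_c(Γ,B), so the operator ⟨f * Φ, f * Φ⟩ on ℓ²(Γ,B) is controlled by norms in ℓ²(V,X),
and the estimate passes to E(V,X).

Once `crossedRep` exists, the interior tensor product of the completions makes sense, and the
canonical map j and the map α pull the inner products of their targets back to the same form on the
balanced tensor product (`ip_toInterior`, `inn_convMap`). Both have dense range, so α factors
through j by a surjective isometry U. Its compatibility with inner products and left actions follows
by density; compatibility with the right action then follows from that with inner products. -/

noncomputable section

set_option linter.unusedSectionVars false

open HilbertModule HilbertBimodule AnchoredBiset
open Finsupp (single)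

/-! ### Operator inequalities in Hilbert modules -/

section general

variable {B X : Type*} [NonUnitalCStarAlgebra B] [NormedAddCommGroup X] [NormedSpace ℂ X]
  [CompleteSpace X] [HilbertModule B X]

/-- In the C*-algebra of adjointable operators ‖T‖² - T*T is positive, hence of the form R*R, and
the difference is ⟨Rx, Rx⟩. An inequality in B, not only in norm, is needed because it is later
summed over the points of V. -/
theorem Adj.ip_apply_self_le (T : Adj B X) (x : X) :
    ∃ b, ((‖T‖ ^ 2 : ℝ) : ℂ) • ip (B := B) x x - ip (T x) (T x) = star b * b := by
  let _ := CStarAlgebra.spectralOrder (Adj B X)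
  have := CStarAlgebra.spectralOrderedRing (Adj B X)
  obtain ⟨R, hR⟩ := exists_star_mul_iff.2 (sub_nonneg.2
    (CStarAlgebra.star_mul_le_algebraMap_norm_sq (a := T)))
  obtain ⟨b, hb⟩ := ip_self_pos (B := B) (R x)
  refine ⟨b, ?_⟩
  have h2 : star R * R = ((‖T‖ ^ 2 : ℝ) : ℂ) • (1 : Adj B X) - star T * T := by
    rw [← hR, Algebra.algebraMap_eq_smul_one]
    rfl
  have h3 : (star R) (R x) = ((‖T‖ ^ 2 : ℝ) : ℂ) • x - (star T) (T x) :=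
    congrArg (fun U : Adj B X => U x) h2
  rw [← hb, Adj.ip_left R, h3, ip_sub_right, ip_smul_right, ← Adj.ip_left]

theorem Adj.norm_apply_le (T : Adj B X) (x : X) : ‖T x‖ ≤ ‖T‖ * ‖x‖ :=
  T.toCLM.le_opNorm x

theorem Adj.norm_le_of_bound (T : Adj B X) {K : ℝ} (hK : 0 ≤ K) (h : ∀ x, ‖T x‖ ≤ K * ‖x‖) :
    ‖T‖ ≤ K :=
  T.toCLM.opNorm_le_bound hK h

end general

/-! ### Representations of the convolution algebra on completions of C_c(V, X) -/

section convRep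

variable {S : Type*} [Group S] {Γ : Subgroup S} {A B D V X : Type*}
  [NonUnitalCStarAlgebra A] [NonUnitalCStarAlgebra B] [CStarAction S A] [CStarAction S B]
  [NonUnitalCStarAlgebra D]
  [MulAction Γ V] [MulAction Γᵐᵒᵖ V] [AnchoredBiset Γ V]
  [NormedAddCommGroup X] [NormedSpace ℂ X] [CompleteSpace X] [HilbertModule B X]
  [DistribMulAction S X] [HilbertBimodule A B X] [EquivariantBimodule S A B X]
  (P : PreHilbert D (V →₀ X))
  (hadj : ∀ (f : Γ →₀ A) Φ Ψ, P.ip (lconv B f Φ) Ψ = P.ip Φ (lconv B (cstar f) Ψ))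
  (hbd : ∀ f : Γ →₀ A, ∃ K, ∀ Φ, ‖P.toCompletion (lconv B f Φ)‖ ≤ K * ‖P.toCompletion Φ‖)

/-- The representation of the convolution algebra `C_c(Γ, A)` on a completion of `C_c(V, X)` on
which left convolution acts by bounded operators. -/
def convRep : (Γ →₀ A) →ₗ[ℂ] Adj D P.Completion where
  toFun f := P.liftAdj (lconv B f) (lconv B (cstar f)) (hbd f) (hbd _) (hadj f)
  map_add' f g := Adj.ext <| PreHilbert.clm_ext fun Φ => by
    change P.liftAdj _ _ _ _ _ _ = P.liftAdj _ _ _ _ _ _ + P.liftAdj _ _ _ _ _ _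
    rw [PreHilbert.liftAdj_coe, PreHilbert.liftAdj_coe, PreHilbert.liftAdj_coe, map_add,
      LinearMap.add_apply, map_add]
  map_smul' c f := Adj.ext <| PreHilbert.clm_ext fun Φ => by
    change P.liftAdj _ _ _ _ _ _ = c • P.liftAdj _ _ _ _ _ _
    rw [PreHilbert.liftAdj_coe, PreHilbert.liftAdj_coe, map_smul, LinearMap.smul_apply, map_smul]

theorem convRep_coe (f : Γ →₀ A) (Φ : V →₀ X) :
    convRep P hadj hbd f (P.toCompletion Φ) = P.toCompletion (lconv B f Φ) :=
  P.liftAdj_coe _ _ (hbd f) (hbd (cstar f)) (hadj f) Φ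

theorem convRep_mul (f g : Γ →₀ A) :
    convRep P hadj hbd (lconv A f g) = convRep P hadj hbd f * convRep P hadj hbd g :=
  Adj.ext <| PreHilbert.clm_ext fun Φ => by
    change convRep P hadj hbd _ _ = convRep P hadj hbd f (convRep P hadj hbd g _)
    rw [convRep_coe, convRep_coe, convRep_coe, lconv_lconv]

theorem convRep_star (f : Γ →₀ A) :
    convRep P hadj hbd (cstar f) = star (convRep P hadj hbd f) := by
  refine ((PreHilbert.liftAdj_star P _ _ (hbd f) (hbd _) (hadj f) fun Φ Ψ => ?_).trans
    (Adj.ext <| PreHilbert.clm_ext fun Φ => ?_)).symm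
  · rw [hadj, cstar_cstar]
  · exact (PreHilbert.liftAdj_coe _ _ _ _ _ _ _).trans (convRep_coe P hadj hbd _ Φ).symm

end convRep

/-! ### The Hilbert B-module ℓ²(V, X) -/

section l2Space

variable {S : Type*} [Group S] (Γ : Subgroup S) (A B V X : Type*)
  [NonUnitalCStarAlgebra A] [NonUnitalCStarAlgebra B] [CStarAction S A] [CStarAction S B]
  [MulAction Γ V] [MulAction Γᵐᵒᵖ V] [AnchoredBiset Γ V]
  [NormedAddCommGroup X] [NormedSpace ℂ X] [CompleteSpace X] [HilbertModule B X]
  [DistribMulAction S X]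

/-- The `B`-valued inner product `⟨Φ, Ψ⟩(1) = ∑_v m(v)⁻¹ ⟨Φ(v), Ψ(v)⟩` on `C_c(V, X)`. -/
def l2SpacePre [EquivariantModule S B X] : PreHilbert B (V →₀ X) where
  ip Φ Ψ := inn Γ B Φ Ψ 1
  ip_add_right f g h := by rw [inn_add_right, Finsupp.add_apply]
  ip_smul_right c f g := by rw [inn_smul_right, Finsupp.smul_apply]
  star_ip f g := by rw [← cstar_inn f g, cstar_apply, one_smul, inv_one]
  ip_self_pos f := inn_one_pos f
  dense_right := dense_univ.mono fun b _ g => ⟨rconv g (single 1 b), fun f => by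
    rw [inn_rconv, lconv_single_one, one_smul]⟩

variable [HilbertBimodule A B X] [EquivariantBimodule S A B X]

variable {Γ A B V X}

theorem l2SpacePre_lconv (f : Γ →₀ A) (Φ Ψ : V →₀ X) :
    (l2SpacePre Γ B V X).ip (lconv B f Φ) Ψ = (l2SpacePre Γ B V X).ip Φ (lconv B (cstar f) Ψ) := by
  change inn Γ B _ _ 1 = inn Γ B _ _ 1
  rw [inn_lconv]

/-- Left convolution by a δ_γ is a translation followed by a pointwise operation, so the estimate
can be made at each point v separately. This crude bound only serves to make convolution operators
exist on ℓ²(V, X); the reduced norm enters later. -/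
theorem norm_l2Space_lconv_single_le (γ : Γ) (a : A) (Φ : V →₀ X) :
    ‖(l2SpacePre Γ B V X).toCompletion (lconv B (single γ a) Φ)‖ ≤
      ‖lact (B := B) (X := X) (γ⁻¹ • a)‖ * ‖(l2SpacePre Γ B V X).toCompletion Φ‖ := by
  let _ := CStarAlgebra.spectralOrder B
  have := CStarAlgebra.spectralOrderedRing B
  set c : A := γ⁻¹ • a with hc
  set K := ‖lact (B := B) (X := X) c‖ with hK
  -- With c = γ⁻¹(a) one has (a δ_γ)* * (a δ_γ) = c*c δ_1: the translation cancels and a pointwise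
  -- operator remains.
  have h1 : inn Γ B (lconv B (single γ a) Φ) (lconv B (single γ a) Φ) 1 =
      inn Γ B Φ (lconv B (single (1 : Γ) (star c * c)) Φ) 1 := by
    rw [inn_lconv, lconv_lconv, cstar_single, lconv_single, smul_eq_mul, inv_mul_cancel, self_lact,
      show γ⁻¹ • star a = star (γ⁻¹ • a) from CStarAction.smul_star_alg (γ⁻¹ : Γ).1 a]
  have h2 : inn Γ B Φ (lconv B (single (1 : Γ) (star c * c)) Φ) 1 ≤
      ((K ^ 2 : ℝ) : ℂ) • inn Γ B Φ Φ 1 := by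
    rw [inn_apply, inn_apply, Finsupp.smul_sum]
    -- The summand at v is m(v)⁻¹ applied to ⟨Φ(v), c*c Φ(v)⟩, and m(v)⁻¹ preserves positivity.
    refine Finset.sum_le_sum fun v _ => ?_
    beta_reduce
    rw [MulOpposite.op_one, one_smul, lconv_apply,
      Finsupp.sum_single_index (by rw [map_zero]; rfl), inv_one, one_smul, one_smul,
      ← CStarAction.smul_complex_alg, ← sub_nonneg, ← smul_sub]
    refine exists_star_mul_iff.1 (CStarAction.smul_pos _ ?_)
    have h3 := Adj.ip_apply_self_le (lact (B := B) (X := X) c) (Φ v)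
    rw [Adj.ip_left, ← map_star, ← InteriorTensor.φ_mul_apply] at h3
    exact h3
  rw [← h1] at h2
  have h3 := CStarAlgebra.norm_le_norm_of_nonneg_of_le (exists_star_mul_iff.1 (inn_one_pos _)) h2
  rw [norm_smul, Complex.norm_real, Real.norm_of_nonneg (by positivity)] at h3
  rw [PreHilbert.norm_toCompletion, PreHilbert.norm_toCompletion]
  calc _ ≤ √(K ^ 2 * ‖inn Γ B Φ Φ 1‖) := Real.sqrt_le_sqrt h3
    _ = _ := by rw [Real.sqrt_mul (by positivity), Real.sqrt_sq (norm_nonneg _)]; rfl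

theorem exists_norm_l2Space_lconv_le (f : Γ →₀ A) : ∃ K, ∀ Φ,
    ‖(l2SpacePre Γ B V X).toCompletion (lconv B f Φ)‖ ≤
      K * ‖(l2SpacePre Γ B V X).toCompletion Φ‖ := by
  induction f using Finsupp.induction_linear with
  | zero => exact ⟨0, fun g => by simp⟩
  | add f f' hf hf' =>
    obtain ⟨K, hK⟩ := hf
    obtain ⟨K', hK'⟩ := hf'
    refine ⟨K + K', fun g => ?_⟩
    rw [map_add, LinearMap.add_apply, map_add, add_mul]
    exact (norm_add_le _ _).trans (add_le_add (hK g) (hK' g))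
  | single γ a => exact ⟨_, norm_l2Space_lconv_single_le γ a⟩

variable (Γ A B V X) in
/-- Left convolution on the Hilbert `B`-module `ℓ²(V, X)`. -/
def l2SpaceRep : (Γ →₀ A) →ₗ[ℂ] Adj B (l2SpacePre Γ B V X).Completion :=
  convRep (l2SpacePre Γ B V X) l2SpacePre_lconv exists_norm_l2Space_lconv_le

theorem l2SpaceRep_coe (f : Γ →₀ A) (Φ : V →₀ X) :
    l2SpaceRep Γ A B V X f ((l2SpacePre Γ B V X).toCompletion Φ) =
      (l2SpacePre Γ B V X).toCompletion (lconv B f Φ) :=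
  convRep_coe _ _ _ f Φ

variable (Γ A B V X) in
/-- The action of `A` on `ℓ²(V, X)`, by the functions on `Γ` supported at the identity. -/
def l2SpaceLact : A →⋆ₙₐ[ℂ] Adj B (l2SpacePre Γ B V X).Completion where
  toFun a := l2SpaceRep Γ A B V X (single 1 a)
  map_zero' := by rw [Finsupp.single_zero, map_zero]
  map_add' a b := by rw [Finsupp.single_add, map_add]
  map_smul' c a := by rw [← Finsupp.smul_single, map_smul]; rfl
  map_mul' a b := by
    rw [l2SpaceRep, ← convRep_mul, lconv_single, one_smul, one_smul, self_lact]
  map_star' a := by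
    rw [l2SpaceRep, ← convRep_star, cstar_single, inv_one, one_smul]

theorem l2SpaceLact_coe (a : A) (Φ : V →₀ X) :
    l2SpaceLact Γ A B V X a ((l2SpacePre Γ B V X).toCompletion Φ) =
      (l2SpacePre Γ B V X).toCompletion (lconv B (single (1 : Γ) a) Φ) :=
  l2SpaceRep_coe _ Φ

/-! ### Fell absorption: convolution on ℓ²(V, X) is bounded by the reduced norm -/

variable (Γ V) in
-- The left action is free, so once a representative is chosen in every orbit, p(v) is the unique
-- group element that moves the representative to v.
theorem exists_equivariant_map : ∃ p : V → Γ, ∀ (γ : Γ) v, p (γ • v) = γ * p v := by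
  -- Freeness is read off the anchor: γ m(v) = δ m(v) in the group S.
  have hfree : ∀ (γ δ : Γ) (v : V), γ • v = δ • v → γ = δ := fun γ δ v h => by
    have h' := congrArg (anchor Γ) h
    rw [anchor_smul, anchor_smul] at h'
    exact Subtype.ext (mul_right_cancel h')
  have h : ∀ v : V, ∃ γ : Γ, γ • (Quotient.mk (MulAction.orbitRel Γ V) v).out = v := fun v =>
    MulAction.orbitRel_apply.1
      ((MulAction.orbitRel Γ V).symm (Quotient.mk_out (s := MulAction.orbitRel Γ V) v))
  choose p hp using h
  refine ⟨p, fun γ v => ?_⟩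
  have hq : Quotient.mk (MulAction.orbitRel Γ V) (γ • v) = Quotient.mk _ v :=
    Quotient.sound (MulAction.orbitRel_apply.2 ⟨γ, rfl⟩)
  -- Since v and γv share their representative, both p(γv) and γ p(v) move it to γv.
  refine hfree _ _ (Quotient.mk (MulAction.orbitRel Γ V) v).out ?_
  rw [mul_smul, hp v, ← hq, hp]

/-- Right translation of a function on `Γ`. -/
def rightTranslate (γ : Γ) : (Γ →₀ A) →ₗ[ℂ] (Γ →₀ A) := Finsupp.lmapDomain A ℂ fun δ => δ * γ

theorem rightTranslate_single (γ δ : Γ) (a : A) :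
    rightTranslate γ (single δ a) = single (δ * γ) a :=
  Finsupp.mapDomain_single

theorem lconv_rightTranslate (γ : Γ) (f g : Γ →₀ A) :
    lconv A f (rightTranslate γ g) = rightTranslate γ (lconv A f g) := by
  induction f using Finsupp.induction_linear with
  | zero => simp
  | add f f' hf hf' => simp only [map_add, LinearMap.add_apply, hf, hf']
  | single δ a =>
    induction g using Finsupp.induction_linear with
    | zero => simp
    | add f f' hf hf' => simp only [map_add, hf, hf']
    | single ε b =>
      rw [rightTranslate_single, lconv_single, lconv_single, rightTranslate_single, smul_eq_mul,
        smul_eq_mul, mul_assoc]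

/-- A group element can be moved between the function and the vector. With γ = p(v) this lets every
f * δ_v x be written with a vector supported in the fibre of p over the identity. -/
theorem lconv_rightTranslate_single (γ : Γ) (f : Γ →₀ A) (v : V) (x : X) :
    lconv B (rightTranslate γ f) (single v x) = lconv B f (single (γ • v) (γ • x)) := by
  induction f using Finsupp.induction_linear with
  | zero => simp
  | add f f' hf hf' => simp only [map_add, LinearMap.add_apply, hf, hf']
  | single δ a =>
    rw [rightTranslate_single, lconv_single, lconv_single, mul_smul, mul_smul]

/-- Needed to recognize the product f* * g, produced by moving f across an inner product, as the
inner product whose value at the identity defines ℓ²(Γ, A). -/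
theorem inn_group (f g : Γ →₀ A) : inn Γ A f g = lconv A (cstar f) g := by
  induction f using Finsupp.induction_linear with
  | zero => simp [inn_zero_left, cstar_zero]
  | add f f' hf hf' => simp only [inn_add_left, cstar_add, map_add, LinearMap.add_apply, hf, hf']
  | single δ a =>
    induction g using Finsupp.induction_linear with
    | zero => simp [inn_zero_right]
    | add f f' hf hf' => simp only [inn_add_right, map_add, hf, hf']
    | single ε b =>
      obtain ⟨γ, rfl⟩ : ∃ γ, ε = δ * γ := ⟨δ⁻¹ * ε, by group⟩
      rw [show δ * γ = op γ • δ from rfl, inn_single_eq, cstar_single, lconv_single, self_lact,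
        show δ⁻¹ • op γ • δ = γ from inv_mul_cancel_left δ γ, self_ip, CStarAction.smul_mul_alg]
      rfl

/-- A coefficient k(γ) contributes at the identity only if γw = v. Applying p gives γ = 1, so over
one fibre of p a convolution operator is seen only through its value at the identity, which is an
element of A. -/
theorem inn_lconv_single_one {p : V → Γ} (hp : ∀ (γ : Γ) v, p (γ • v) = γ * p v) {v w : V}
    (hv : p v = 1) (hw : p w = 1) (x y : X) (k : Γ →₀ A) :
    inn Γ B (single v x) (lconv B k (single w y)) 1 =
      inn Γ B (single v x) (lconv B (single (1 : Γ) (k 1)) (single w y)) 1 := by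
  classical
  induction k using Finsupp.induction_linear with
  | zero => simp
  | add f f' hf hf' =>
    simp only [map_add, LinearMap.add_apply, Finsupp.add_apply, Finsupp.single_add, inn_add_right,
      hf, hf']
  | single γ a =>
    by_cases h : γ = 1
    · rw [h, Finsupp.single_eq_same]
    · rw [Finsupp.single_eq_of_ne (Ne.symm h), Finsupp.single_zero, map_zero, LinearMap.zero_apply,
        inn_zero_right, lconv_single, inn_single_apply, if_neg, Finsupp.zero_apply]
      intro h'
      rw [MulOpposite.op_one, one_smul] at h'
      refine h ?_
      have h2 := hp γ w
      rw [← h', hv, hw, mul_one] at h2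
      exact h2.symm

/-- The vector of `ℓ²(Γ, A) ⊗_A ℓ²(V, X)` that corresponds to `f * Φ` when the free left `Γ`-set `V`
is trivialized by `p`. -/
def absorb (p : V → Γ) (f : Γ →₀ A) (Φ : V →₀ X) :
    L2 Γ A ⊗[ℂ] (l2SpacePre Γ B V X).Completion :=
  Φ.sum fun v x => (l2Pre Γ A).toCompletion (rightTranslate (p v) f) ⊗ₜ
    (l2SpacePre Γ B V X).toCompletion (single ((p v)⁻¹ • v) ((p v)⁻¹ • x))

/-- The trivialization only translates f on the right, and left convolution commutes with right
translation. Hence convolution by h acts on the first tensor factor alone, by the regular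
representation. -/
theorem algLeft_absorb (p : V → Γ) (h f : Γ →₀ A) (Φ : V →₀ X) :
    InteriorTensor.algLeft (regularRep Γ A h) (absorb (B := B) p f Φ) =
      absorb p (lconv A h f) Φ := by
  rw [absorb, absorb, Finsupp.sum, Finsupp.sum, map_sum]
  refine Finset.sum_congr rfl fun v _ => ?_
  change (regularRep Γ A h ((l2Pre Γ A).toCompletion (rightTranslate (p v) f))) ⊗ₜ[ℂ] _ = _
  rw [regularRep_coe, lconv_rightTranslate]
  rfl

/-- The passage from f * Φ to its absorbed form is isometric. Write f_v for the right translate of f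
by p(v), and v' = p(v)⁻¹v. The terms for v and w pair through f_v* * f_w, of which only the value at
the identity survives because p(v') = p(w') = 1; that value is ⟨f_v, f_w⟩ in ℓ²(Γ, A), as the
interior tensor product requires. -/
theorem form_absorb {p : V → Γ} (hp : ∀ (γ : Γ) v, p (γ • v) = γ * p v) (f : Γ →₀ A)
    (Φ : V →₀ X) :
    InteriorTensor.form (L2 Γ A) (l2SpaceLact Γ A B V X) (absorb p f Φ) (absorb p f Φ) =
      inn Γ B (lconv B f Φ) (lconv B f Φ) 1 := by
  have key : ∀ (v w : V) (x y : X),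
      InteriorTensor.form (L2 Γ A) (l2SpaceLact Γ A B V X)
        ((l2Pre Γ A).toCompletion (rightTranslate (p v) f) ⊗ₜ
          (l2SpacePre Γ B V X).toCompletion (single ((p v)⁻¹ • v) ((p v)⁻¹ • x)))
        ((l2Pre Γ A).toCompletion (rightTranslate (p w) f) ⊗ₜ
          (l2SpacePre Γ B V X).toCompletion (single ((p w)⁻¹ • w) ((p w)⁻¹ • y))) =
      inn Γ B (lconv B f (single v x)) (lconv B f (single w y)) 1 := by
    intro v w x y
    have h1 : ∀ v : V, p ((p v)⁻¹ • v) = 1 := fun v => by rw [hp, inv_mul_cancel]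
    have h2 : ∀ (v : V) (x : X), lconv B f (single v x) =
        lconv B (rightTranslate (p v) f) (single ((p v)⁻¹ • v) ((p v)⁻¹ • x)) := fun v x => by
      rw [lconv_rightTranslate_single, smul_inv_smul, smul_inv_smul]
    rw [InteriorTensor.form_tmul, h2 v x, h2 w y, inn_lconv, lconv_lconv, ← inn_group,
      inn_lconv_single_one hp (h1 v) (h1 w), l2SpaceLact_coe]
    refine ((l2SpacePre Γ B V X).cip_coe _ _).trans ?_
    have h3 : ip (B := A) ((l2Pre Γ A).toCompletion (rightTranslate (p v) f))
        ((l2Pre Γ A).toCompletion (rightTranslate (p w) f)) =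
        inn Γ A (rightTranslate (p v) f) (rightTranslate (p w) f) 1 := (l2Pre Γ A).cip_coe _ _
    rw [h3]
    rfl
  -- Both sides are now double sums over the support of Φ, to which the identity for one-point
  -- functions applies term by term.
  have hΦ : lconv B f Φ = ∑ v ∈ Φ.support, lconv B f (single v (Φ v)) := by
    conv_lhs => rw [← Finsupp.sum_single Φ]
    rw [Finsupp.sum, map_sum]
  have hR : inn Γ B (lconv B f Φ) (lconv B f Φ) 1 =
      (l2SpacePre Γ B V X).ipₛₗ (lconv B f Φ) (lconv B f Φ) := rfl
  rw [hR, hΦ, absorb, Finsupp.sum]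
  simp only [map_sum, LinearMap.sum_apply, key]
  rfl

/-- On absorbed vectors h acts as λ(h) ⊗ 1, whose norm is at most ‖λ(h)‖. The factor f cannot be
dropped at this stage: A need not be unital or act nondegenerately on X, so a general Φ has no
counterpart in ℓ²(Γ, A) ⊗_A ℓ²(V, X). -/
theorem norm_l2Space_lconv_lconv_le (h f : Γ →₀ A) (Φ : V →₀ X) :
    ‖(l2SpacePre Γ B V X).toCompletion (lconv B h (lconv B f Φ))‖ ≤
      ‖ofCc Γ A h‖ * ‖(l2SpacePre Γ B V X).toCompletion (lconv B f Φ)‖ := by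
  obtain ⟨p, hp⟩ := exists_equivariant_map Γ V
  have h1 : ∀ g : Γ →₀ A, ‖(l2SpacePre Γ B V X).toCompletion (lconv B g Φ)‖ =
      ‖(InteriorTensor.pre (L2 Γ A) (l2SpaceLact Γ A B V X)).toCompletion (absorb p g Φ)‖ := by
    intro g
    rw [PreHilbert.norm_toCompletion, PreHilbert.norm_toCompletion]
    change √‖inn Γ B _ _ 1‖ = √‖InteriorTensor.form _ _ _ _‖
    rw [form_absorb hp]
  rw [lconv_lconv, h1, h1, ← algLeft_absorb]
  exact InteriorTensor.norm_algLeft_le _ _ _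

/-- The estimate is known on vectors of the form f * Φ, and the range of T* supplies such vectors.
The C*-identity ‖T‖² = ‖TT*‖ shows that bounding T on the range of T* is enough. -/
theorem norm_l2SpaceRep_le (h : Γ →₀ A) : ‖l2SpaceRep Γ A B V X h‖ ≤ ‖ofCc Γ A h‖ := by
  set T := l2SpaceRep Γ A B V X h with hT
  have hs : star T = l2SpaceRep Γ A B V X (cstar h) := (convRep_star _ _ _ h).symm
  -- On the dense subspace T*Φ = h* * Φ, so the previous lemma applies with f = h*.
  have h1 : ∀ x, ‖T ((star T) x)‖ ≤ ‖ofCc Γ A h‖ * ‖(star T) x‖ := by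
    refine (l2SpacePre Γ B V X).ind (isClosed_le
      ((T.toCLM.continuous.comp (star T).toCLM.continuous).norm)
      (continuous_const.mul (star T).toCLM.continuous.norm)) fun Φ => ?_
    rw [hs, hT, l2SpaceRep_coe, l2SpaceRep_coe]
    exact norm_l2Space_lconv_lconv_le _ _ _
  have h2 : ‖T * star T‖ ≤ ‖ofCc Γ A h‖ * ‖T‖ := by
    refine Adj.norm_le_of_bound _ (by positivity) fun x => (h1 x).trans ?_
    rw [mul_assoc]
    gcongr
    rw [← norm_star T]
    exact Adj.norm_apply_le _ x
  rw [CStarRing.norm_self_mul_star] at h2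
  -- From ‖T‖² ≤ ‖λ(h)‖ ‖T‖ one factor ‖T‖ is cancelled, unless it is zero.
  rcases (norm_nonneg T).eq_or_lt with h0 | h0
  · rw [← h0]; positivity
  · exact le_of_mul_le_mul_right h2 h0

theorem norm_l2Space_lconv_le (f : Γ →₀ A) (Φ : V →₀ X) :
    ‖(l2SpacePre Γ B V X).toCompletion (lconv B f Φ)‖ ≤
      ‖ofCc Γ A f‖ * ‖(l2SpacePre Γ B V X).toCompletion Φ‖ := by
  rw [← l2SpaceRep_coe]
  exact (Adj.norm_apply_le _ _).trans (by gcongr; exact norm_l2SpaceRep_le f)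

/-! ### From ℓ²(V, X) to the completion E(V, X): the action of the reduced crossed product -/

theorem ip_regularRep_inn (Φ : V →₀ X) (g : Γ →₀ B) :
    ip (B := B) ((l2Pre Γ B).toCompletion g)
      (regularRep Γ B (inn Γ B Φ Φ) ((l2Pre Γ B).toCompletion g)) =
      inn Γ B (rconv Φ g) (rconv Φ g) 1 := by
  rw [regularRep_coe]
  refine ((l2Pre Γ B).cip_coe _ _).trans ?_
  change inn Γ B g (lconv B (inn Γ B Φ Φ) g) 1 = _
  -- ⟨g, ⟨Φ,Φ⟩ * g⟩ = ⟨g, ⟨Φ, Φ * g⟩⟩ = ⟨Φ * g, Φ * g⟩.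
  rw [← inn_rconv, inn_inn]

/-- The norm of E(V, X) is the operator norm of ⟨Φ, Φ⟩ on ℓ²(Γ, B), and the quadratic form of this
operator at g is the squared length of Φ * g in ℓ²(V, X). As f * (Φ * g) = (f * Φ) * g, the bound
for convolution by f on ℓ²(V, X) applies to every g at once. -/
theorem norm_ccPre_lconv_le (f : Γ →₀ A) (Φ : V →₀ X) :
    ‖(ccPre Γ B V X).toCompletion (lconv B f Φ)‖ ≤
      ‖ofCc Γ A f‖ * ‖(ccPre Γ B V X).toCompletion Φ‖ := by
  -- A square root R of ⟨f * Φ, f * Φ⟩: then ‖R‖ is the norm of f * Φ in E(V, X), and it can be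
  -- bounded vector by vector.
  obtain ⟨R, hR⟩ := ofCc_inn_pos (Γ := Γ) (B := B) (lconv B f Φ)
  set c := ‖ofCc Γ A f‖ with hc
  set s := ‖ofCc Γ B (inn Γ B Φ Φ)‖ with hs
  have hRa : star R.toAdj * R.toAdj = regularRep Γ B (inn Γ B (lconv B f Φ) (lconv B f Φ)) :=
    (congrArg ReducedCrossedProduct.toAdj hR).symm
  have hn : ∀ g : Γ →₀ B, ‖inn Γ B g g 1‖ = ‖(l2Pre Γ B).toCompletion g‖ ^ 2 := fun g => by
    rw [PreHilbert.norm_toCompletion, Real.sq_sqrt (norm_nonneg _)]; rfl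
  have hn' : ∀ Ω : V →₀ X, ‖inn Γ B Ω Ω 1‖ = ‖(l2SpacePre Γ B V X).toCompletion Ω‖ ^ 2 :=
    fun g => by
      rw [PreHilbert.norm_toCompletion, Real.sq_sqrt (norm_nonneg _)]; rfl
  have hb : ∀ x, ‖R.toAdj x‖ ≤ (c * √s) * ‖x‖ := by
    refine (l2Pre Γ B).ind (isClosed_le R.toAdj.toCLM.continuous.norm
      (continuous_const.mul continuous_norm)) fun g => ?_
    refine le_of_sq_le_sq ?_ (by positivity)
    -- ⟨Rg, Rg⟩ = ⟨g, ⟨f * Φ, f * Φ⟩ * g⟩, which is the squared length of (f * Φ) * g.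
    have h1 : ‖R.toAdj ((l2Pre Γ B).toCompletion g)‖ ^ 2 =
        ‖inn Γ B (lconv B f (rconv Φ g)) (lconv B f (rconv Φ g)) 1‖ := by
      rw [norm_sq (B := B), Adj.ip_left, lconv_rconv, ← ip_regularRep_inn, ← hRa]
      rfl
    -- Cauchy–Schwarz for the quadratic form of ⟨Φ, Φ⟩, whose operator norm is s.
    have h2 : ‖inn Γ B (rconv Φ g) (rconv Φ g) 1‖ ≤ s * ‖(l2Pre Γ B).toCompletion g‖ ^ 2 := by
      rw [← ip_regularRep_inn]
      refine (norm_ip_le _ _).trans ?_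
      calc _ ≤ ‖(l2Pre Γ B).toCompletion g‖ * (s * ‖(l2Pre Γ B).toCompletion g‖) := by
            gcongr; exact Adj.norm_apply_le _ _
        _ = _ := by ring
    have h3 := norm_l2Space_lconv_le (B := B) f (rconv Φ g)
    rw [h1, hn']
    rw [hn'] at h2
    calc _ ≤ (c * ‖(l2SpacePre Γ B V X).toCompletion (rconv Φ g)‖) ^ 2 := by gcongr
      _ = c ^ 2 * ‖(l2SpacePre Γ B V X).toCompletion (rconv Φ g)‖ ^ 2 := by ring
      _ ≤ c ^ 2 * (s * ‖(l2Pre Γ B).toCompletion g‖ ^ 2) := by gcongr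
      _ = _ := by rw [mul_pow, mul_pow, Real.sq_sqrt (norm_nonneg _)]; ring
  have hRn : ‖R‖ ≤ c * √s := Adj.norm_le_of_bound R.toAdj (by positivity) hb
  rw [PreHilbert.norm_toCompletion, PreHilbert.norm_toCompletion]
  change √‖ofCc Γ B (inn Γ B (lconv B f Φ) (lconv B f Φ))‖ ≤ c * √s
  rw [hR, CStarRing.norm_star_mul_self, Real.sqrt_mul_self (norm_nonneg _)]
  exact hRn

theorem ccPre_lconv (f : Γ →₀ A) (Φ Ψ : V →₀ X) :
    (ccPre Γ B V X).ip (lconv B f Φ) Ψ = (ccPre Γ B V X).ip Φ (lconv B (cstar f) Ψ) := by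
  change ofCc Γ B _ = ofCc Γ B _
  rw [inn_lconv]

variable (Γ A B V X) in
/-- Left convolution on the completion of `C_c(V, X)`. -/
def ccRep : (Γ →₀ A) →ₗ[ℂ] Adj (ReducedCrossedProduct Γ B) (CcCompletion Γ B V X) :=
  convRep (ccPre Γ B V X) ccPre_lconv fun f => ⟨_, norm_ccPre_lconv_le f⟩

theorem ccRep_coe (f : Γ →₀ A) (Φ : V →₀ X) :
    ccRep Γ A B V X f ((ccPre Γ B V X).toCompletion Φ) =
      (ccPre Γ B V X).toCompletion (lconv B f Φ) :=
  convRep_coe _ _ _ f Φ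

theorem norm_ccRep_le (f : Γ →₀ A) : ‖ccRep Γ A B V X f‖ ≤ ‖ofCc Γ A f‖ := by
  refine Adj.norm_le_of_bound _ (norm_nonneg _) ((ccPre Γ B V X).ind (isClosed_le
    (ccRep Γ A B V X f).toCLM.continuous.norm (continuous_const.mul continuous_norm)) fun Φ => ?_)
  rw [ccRep_coe]
  exact norm_ccPre_lconv_le f Φ

variable (Γ A B V X) in
/-- The continuous extension of left convolution to the reduced crossed product. -/
def crossedRepCLM : ReducedCrossedProduct Γ A →L[ℂ]
    Adj (ReducedCrossedProduct Γ B) (CcCompletion Γ B V X) :=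
  (ccRep Γ A B V X).extendOfNorm (ofCc Γ A)

/-- The extension has the prescribed values because convolution by f is dominated by the reduced
norm of f, and C_c(Γ, A) is dense in that norm. -/
theorem crossedRepCLM_ofCc (f : Γ →₀ A) :
    crossedRepCLM Γ A B V X (ofCc Γ A f) = ccRep Γ A B V X f :=
  LinearMap.extendOfNorm_eq denseRange_ofCc
    ⟨1, fun f => by rw [one_mul]; exact norm_ccRep_le f⟩ f

variable (Γ A B V X) in
/-- The action of `A ⋊_r Γ` on the completion of `C_c(V, X)`. -/
def crossedRep : ReducedCrossedProduct Γ A →⋆ₙₐ[ℂ]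
    Adj (ReducedCrossedProduct Γ B) (CcCompletion Γ B V X) where
  toFun := crossedRepCLM Γ A B V X
  map_zero' := map_zero _
  map_add' := map_add _
  map_smul' := map_smul _
  map_mul' S T := by
    refine denseRange_ofCc.induction_on₂ (p := fun S T => crossedRepCLM Γ A B V X (S * T) =
      crossedRepCLM Γ A B V X S * crossedRepCLM Γ A B V X T)
      (isClosed_eq (by fun_prop) (by fun_prop)) (fun f g => ?_) S T
    rw [ofCc_mul, crossedRepCLM_ofCc, crossedRepCLM_ofCc, crossedRepCLM_ofCc]
    exact convRep_mul _ _ _ f g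
  map_star' T := by
    refine denseRange_ofCc.induction_on (p := fun T => crossedRepCLM Γ A B V X (star T) =
      star (crossedRepCLM Γ A B V X T)) T
      (isClosed_eq (by fun_prop) (by fun_prop)) (fun f => ?_)
    rw [ofCc_star, crossedRepCLM_ofCc, crossedRepCLM_ofCc]
    exact convRep_star _ _ _ f

theorem crossedRep_ofCc (f : Γ →₀ A) (Φ : V →₀ X) :
    crossedRep Γ A B V X (ofCc Γ A f) ((ccPre Γ B V X).toCompletion Φ) =
      (ccPre Γ B V X).toCompletion (lconv B f Φ) := by
  rw [← ccRep_coe, ← crossedRepCLM_ofCc]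
  rfl

end l2Space

end

noncomputable section

set_option linter.unusedSectionVars false

open HilbertModule HilbertBimodule AnchoredBiset
open Finsupp (single)

/-! ### Elementary tensors in interior tensor products -/

namespace InteriorTensor

variable {B C X Y : Type*} [NonUnitalCStarAlgebra B] [NonUnitalCStarAlgebra C]
  [NormedAddCommGroup X] [NormedSpace ℂ X] [CompleteSpace X] [HilbertModule B X]
  [NormedAddCommGroup Y] [NormedSpace ℂ Y] [CompleteSpace Y] [HilbertModule C Y]
  (φ : B →⋆ₙₐ[ℂ] Adj C Y)

theorem ip_tmul (x x' : X) (y y' : Y) :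
    ip (B := C) (tmul φ x y) (tmul φ x' y') = ip y (φ (ip x x') y') :=
  (pre X φ).cip_coe _ _

variable (X) in
/-- The elementary tensor as a bilinear map. -/
def tmulₗ : X →ₗ[ℂ] Y →ₗ[ℂ] InteriorTensor X φ :=
  (TensorProduct.mk ℂ X Y).compr₂ (pre X φ).toCompletion

/-- Since φ is contractive, ‖⟨y, φ(⟨x,x⟩)y⟩‖ ≤ ‖x‖²‖y‖². The resulting joint continuity is what the
density arguments need. -/
theorem norm_tmul_le (x : X) (y : Y) : ‖tmul φ x y‖ ≤ ‖x‖ * ‖y‖ := by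
  refine le_of_sq_le_sq ?_ (by positivity)
  rw [norm_sq (B := C), ip_tmul]
  calc _ ≤ ‖y‖ * (‖φ (ip x x)‖ * ‖y‖) :=
        (norm_ip_le _ _).trans (by gcongr; exact Adj.norm_apply_le _ _)
    _ ≤ ‖y‖ * (‖ip (B := B) x x‖ * ‖y‖) := by
        gcongr; exact NonUnitalStarAlgHom.norm_apply_le φ _
    _ = _ := by rw [← norm_sq]; ring

theorem continuous_tmul : Continuous fun p : X × Y => tmul φ p.1 p.2 := by
  let F : X →L[ℂ] Y →L[ℂ] InteriorTensor X φ :=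
    (tmulₗ X φ).mkContinuous₂ 1 fun x y => by rw [one_mul]; exact norm_tmul_le φ x y
  exact (F.continuous.comp continuous_fst).clm_apply continuous_snd

theorem clm_ext_tmul {G : Type*} [NormedAddCommGroup G] [NormedSpace ℂ G]
    {T U : InteriorTensor X φ →L[ℂ] G} (h : ∀ x y, T (tmul φ x y) = U (tmul φ x y)) : T = U := by
  refine PreHilbert.clm_ext fun z => ?_
  have h' : T.toLinearMap ∘ₗ (pre X φ).toCompletion = U.toLinearMap ∘ₗ (pre X φ).toCompletion :=
    TensorProduct.ext' h
  exact LinearMap.congr_fun h' z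

theorem ext_ip_tmul {z z' : InteriorTensor X φ}
    (h : ∀ x y, ip (B := C) (tmul φ x y) z = ip (tmul φ x y) z') : z = z' := by
  refine ext_ip C fun w => ?_
  rw [← star_ip z w, ← star_ip z' w]
  congr 1
  -- The inner product is linear in its second variable, so after taking adjoints the fixed vector z
  -- stands first and ⟨z, ·⟩ is a bounded linear map, determined by its values on elementary
  -- tensors.
  let T : InteriorTensor X φ → InteriorTensor X φ →L[ℂ] C := fun z =>
    ((toPreHilbert C (InteriorTensor X φ)).ipₛₗ z).mkContinuous ‖z‖ fun w => norm_ip_le z w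
  have hT : T z = T z' := clm_ext_tmul φ fun x y => by
    change ip (B := C) z (tmul φ x y) = ip z' (tmul φ x y)
    rw [← star_ip, h, star_ip]
  exact congrArg (fun T => T w) hT

/-- Balancing over B is automatic in the completion, although the algebraic tensor product is taken
over ℂ: the two tensors have the same inner products, because φ is multiplicative, and null vectors
are divided out. -/
theorem tmul_rsmul (x : X) (b : B) (y : Y) : tmul φ (rsmul x b) y = tmul φ x (φ b y) :=
  ext_ip_tmul φ fun x' y' => by
    rw [ip_tmul, ip_tmul, ip_rsmul_right, φ_mul_apply]

theorem rsmul_tmul (x : X) (y : Y) (c : C) : rsmul (tmul φ x y) c = tmul φ x (rsmul y c) :=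
  ext_ip_tmul φ fun x' y' => by
    rw [ip_rsmul_right, ip_tmul, ip_tmul, φ_rsmul, ip_rsmul_right]

theorem leftHom_tmul (T : Adj B X) (x : X) (y : Y) :
    leftHom φ T (tmul φ x y) = tmul φ (T x) y :=
  leftOp_tmul φ T x y

end InteriorTensor

/-! ### One-point functions and right convolution in E(V, X) -/

section ccPre

variable {S : Type*} [Group S] {Γ : Subgroup S} {B V X : Type*} [NonUnitalCStarAlgebra B]
  [CStarAction S B] [MulAction Γ V] [MulAction Γᵐᵒᵖ V] [AnchoredBiset Γ V]
  [NormedAddCommGroup X] [NormedSpace ℂ X] [CompleteSpace X] [HilbertModule B X]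
  [DistribMulAction S X] [EquivariantModule S B X]

theorem norm_ofCc_single_le (γ : Γ) (b : B) : ‖ofCc Γ B (single γ b)‖ ≤ ‖b‖ := by
  refine Adj.norm_le_of_bound (regularRep Γ B (single γ b)) (norm_nonneg _)
    ((l2Pre Γ B).ind (isClosed_le (regularRep Γ B (single γ b)).toCLM.continuous.norm
      (continuous_const.mul continuous_norm)) fun g => ?_)
  rw [regularRep_coe]
  exact norm_lconv_single_le γ b g

/-- By freeness of the right action, ⟨δ_v x, δ_v x⟩ is supported at the identity, with value
m(v)⁻¹⟨x, x⟩, and m(v)⁻¹ acts isometrically. -/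
theorem norm_ccPre_single_le (v : V) (x : X) :
    ‖(ccPre Γ B V X).toCompletion (single v x)‖ ≤ ‖x‖ := by
  rw [PreHilbert.norm_toCompletion, norm_eq_sqrt (B := B) x]
  refine Real.sqrt_le_sqrt ?_
  change ‖ofCc Γ B (inn Γ B (single v x) (single v x))‖ ≤ _
  have h := inn_single_eq (Γ := Γ) (B := B) v x x 1
  rw [MulOpposite.op_one, one_smul] at h
  rw [h]
  exact (norm_ofCc_single_le _ _).trans_eq (CStarAction.norm_smul _ _)

variable (Γ B X) in
/-- The inclusion of the functions supported at `v` in the completion of `C_c(V, X)`. -/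
def ccSingle (v : V) : X →L[ℂ] CcCompletion Γ B V X :=
  ((ccPre Γ B V X).toCompletion ∘ₗ Finsupp.lsingle v).mkContinuous 1 fun x => by
    rw [one_mul]; exact norm_ccPre_single_le v x

theorem ip_toCompletion (Φ Ψ : V →₀ X) :
    ip (B := ReducedCrossedProduct Γ B) ((ccPre Γ B V X).toCompletion Φ)
      ((ccPre Γ B V X).toCompletion Ψ) = ofCc Γ B (inn Γ B Φ Ψ) :=
  (ccPre Γ B V X).cip_coe Φ Ψ

/-- The right action on a completion is known only through its inner products, so right convolution
is recognized by pairing with the dense subspace C_c(V, X). -/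
theorem rsmul_toCompletion (Φ : V →₀ X) (f : Γ →₀ B) :
    rsmul ((ccPre Γ B V X).toCompletion Φ) (ofCc Γ B f) =
      (ccPre Γ B V X).toCompletion (rconv Φ f) := by
  refine ext_ip (ReducedCrossedProduct Γ B) fun x => ?_
  rw [ip_rsmul_right]
  refine (ccPre Γ B V X).ind (p := fun x => (ccPre Γ B V X).cip x _ * _ =
    (ccPre Γ B V X).cip x _)
    (isClosed_eq (((ccPre Γ B V X).continuous_cip_comp continuous_id continuous_const).mul
      continuous_const) ((ccPre Γ B V X).continuous_cip_comp continuous_id continuous_const))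
    (fun Ψ => ?_) x
  rw [PreHilbert.cip_coe, PreHilbert.cip_coe]
  change ofCc Γ B (inn Γ B Ψ Φ) * ofCc Γ B f = ofCc Γ B (inn Γ B Ψ (rconv Φ f))
  rw [ofCc_mul, inn_rconv]

end ccPre

/-! ### The map α: balancing, formula, bimodule property, inner products, dense range -/

namespace BalancedTensor

variable {S : Type*} [Group S] (Γ : Subgroup S) {A : Type*} (B C V W X Y : Type*)
  [NonUnitalCStarAlgebra A] [NonUnitalCStarAlgebra B] [NonUnitalCStarAlgebra C]
  [CStarAction S A] [CStarAction S B] [CStarAction S C]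
  [MulAction Γ V] [MulAction Γᵐᵒᵖ V] [AnchoredBiset Γ V]
  [MulAction Γ W] [MulAction Γᵐᵒᵖ W] [AnchoredBiset Γ W]
  [NormedAddCommGroup X] [NormedSpace ℂ X] [CompleteSpace X]
  [HilbertModule B X] [DistribMulAction S X]
  [NormedAddCommGroup Y] [NormedSpace ℂ Y] [CompleteSpace Y]
  [HilbertModule C Y] [HilbertBimodule B C Y] [DistribMulAction S Y] [EquivariantBimodule S B C Y]

section convMap

variable [EquivariantModule S B X]

/-- The bilinear map with `(δ_v x, δ_w y) ↦ δ_[v,w] (x ⊗ m(v) y)`. -/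
def preConvMap : (V →₀ X) →ₗ[ℂ] (W →₀ Y) →ₗ[ℂ]
    (BisetProd Γ V W →₀ BimoduleTensor B C X Y) :=
  finsuppBilin (BisetProd.mk Γ) fun v _ =>
    (InteriorTensor.tmulₗ X lact).compl₂ (EquivariantModule.smulₗ C Y (anchor Γ v))

variable {Γ B C V W X Y}

theorem preConvMap_single (v : V) (w : W) (x : X) (y : Y) :
    preConvMap Γ B C V W X Y (single v x) (single w y) =
      single (BisetProd.mk Γ v w) (InteriorTensor.tmul lact x (anchor Γ v • y)) :=
  finsuppBilin_single _ _ _ _ _ _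

theorem preConvMap_balanced (Φ : V →₀ X) (f : Γ →₀ B) (Ψ : W →₀ Y) :
    preConvMap Γ B C V W X Y (rconv Φ f) Ψ = preConvMap Γ B C V W X Y Φ (lconv C f Ψ) := by
  induction Φ using Finsupp.induction_linear with
  | zero => simp
  | add Φ Φ' h h' => simp only [map_add, LinearMap.add_apply, h, h']
  | single v x =>
    induction f using Finsupp.induction_linear with
    | zero => simp
    | add f f' h h' => simp only [map_add, LinearMap.add_apply, h, h']
    | single γ b =>
      induction Ψ using Finsupp.induction_linear with
      | zero => simp
      | add Ψ Ψ' h h' => simp only [map_add, h, h']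
      | single w y =>
        -- This gives [vγ, w] = [v, γw]. The remaining equality of values is xm(v)(b) ⊗ m(vγ)y = x ⊗
        -- m(v)(b · γy).
        have hm := BisetProd.mk_eq (Γ := Γ) v (γ • w) γ
        rw [inv_smul_smul] at hm
        rw [rconv_single, lconv_single, preConvMap_single, preConvMap_single, hm,
          InteriorTensor.tmul_rsmul, EquivariantBimodule.smul_lact, anchor_op_smul, mul_smul]
        rfl

variable (Γ B C V W X Y) in
/-- The map `α` from the balanced tensor product of `C_c(V, X)` and `C_c(W, Y)` to
`C_c(V ×_Γ W, X ⊗_B Y)`. -/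
def convMap : BalancedTensor Γ B C V W X Y →ₗ[ℂ]
    (BisetProd Γ V W →₀ BimoduleTensor B C X Y) :=
  (balancing Γ B C V W X Y).liftQ (TensorProduct.lift (preConvMap Γ B C V W X Y))
    (lift_ker preConvMap_balanced)

theorem convMap_tmul (Φ : V →₀ X) (Ψ : W →₀ Y) :
    convMap Γ B C V W X Y (tmul Γ B C Φ Ψ) = preConvMap Γ B C V W X Y Φ Ψ := rfl

theorem induction_tmul {p : BalancedTensor Γ B C V W X Y → Prop} (h0 : p 0)
    (hadd : ∀ ξ η, p ξ → p η → p (ξ + η)) (h : ∀ Φ Ψ, p (tmul Γ B C Φ Ψ))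
    (ξ : BalancedTensor Γ B C V W X Y) : p ξ := by
  obtain ⟨z, rfl⟩ := (balancing Γ B C V W X Y).mkQ_surjective ξ
  induction z with
  | zero => rwa [map_zero]
  | add z₁ z₂ h₁ h₂ => rw [map_add]; exact hadd _ _ h₁ h₂
  | tmul Φ Ψ => exact h Φ Ψ

theorem induction_single {p : BalancedTensor Γ B C V W X Y → Prop} (h0 : p 0)
    (hadd : ∀ ξ η, p ξ → p η → p (ξ + η))
    (h : ∀ v x w y, p (tmul Γ B C (single v x) (single w y)))
    (ξ : BalancedTensor Γ B C V W X Y) : p ξ := by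
  refine induction_tmul h0 hadd (fun Φ Ψ => ?_) ξ
  have hz : ∀ (Φ : V →₀ X) (Ψ : W →₀ Y), tmul Γ B C Φ Ψ =
      ((TensorProduct.mk ℂ (V →₀ X) (W →₀ Y)).compr₂ (balancing Γ B C V W X Y).mkQ) Φ Ψ :=
    fun _ _ => rfl
  rw [hz]
  induction Φ using Finsupp.induction_linear with
  | zero => simpa only [map_zero, LinearMap.zero_apply]
  | add Φ Φ' h₁ h₂ => rw [map_add, LinearMap.add_apply]; exact hadd _ _ h₁ h₂
  | single v x =>
    induction Ψ using Finsupp.induction_linear with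
    | zero => simpa only [map_zero]
    | add Ψ Ψ' h₁ h₂ => rw [map_add]; exact hadd _ _ h₁ h₂
    | single w y => exact h v x w y

variable (Γ) in
theorem finite_setOf_convMap_ne_zero (Φ : V →₀ X) (Ψ : W →₀ Y) (v : V) (w : W) :
    {γ : Γ | Φ (op γ • v) ≠ 0 ∧ Ψ (γ⁻¹ • w) ≠ 0}.Finite :=
  (Φ.support.finite_toSet.preimage (op_smul_injective (Γ := Γ) v).injOn).subset fun γ hγ => by
    simpa using hγ.1

/-- For one-point functions at v₀ and w₀ the γ-th summand is non-zero only if v₀ = vγ and w₀ = γ⁻¹w,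
which forces [v₀, w₀] = [v, w] and, by freeness, determines γ; the value matches because m(v₀) =
m(v)γ. -/
theorem preConvMap_apply (Φ : V →₀ X) (Ψ : W →₀ Y) (v : V) (w : W) :
    preConvMap Γ B C V W X Y Φ Ψ (BisetProd.mk Γ v w) =
      ∑ᶠ γ : Γ, InteriorTensor.tmul lact (Φ (op γ • v)) (anchor Γ v • γ • Ψ (γ⁻¹ • w)) := by
  classical
  have hsub : ∀ (Φ : V →₀ X) (Ψ : W →₀ Y), (Function.support fun γ : Γ =>
      InteriorTensor.tmulₗ X (lact (A := B) (B := C) (X := Y)) (Φ (op γ • v))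
        (anchor Γ v • γ • Ψ (γ⁻¹ • w) : Y)) ⊆
      {γ : Γ | Φ (op γ • v) ≠ 0 ∧ Ψ (γ⁻¹ • w) ≠ 0} := by
    refine fun Φ Ψ γ hγ => ⟨fun h0 => hγ ?_, fun h0 => hγ ?_⟩
    · beta_reduce; rw [h0, map_zero, LinearMap.zero_apply]
    · beta_reduce; rw [h0, smul_zero, smul_zero, map_zero]
  have hfin := fun (Φ : V →₀ X) (Ψ : W →₀ Y) => (finite_setOf_convMap_ne_zero Γ Φ Ψ v w).subset (hsub Φ Ψ)
  -- The bilinear form of ⊗ makes additivity in Φ and Ψ available. Splitting the sum over Γ also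
  -- needs the finite supports established above.
  change _ = ∑ᶠ γ : Γ, InteriorTensor.tmulₗ X (lact (A := B) (B := C) (X := Y)) (Φ (op γ • v))
    (anchor Γ v • γ • Ψ (γ⁻¹ • w) : Y)
  induction Φ using Finsupp.induction_linear with
  | zero => simp
  | add Φ Φ' h h' =>
    rw [map_add, LinearMap.add_apply, Finsupp.add_apply, h, h',
      ← finsum_add_distrib (hfin Φ Ψ) (hfin Φ' Ψ)]
    simp only [Finsupp.add_apply, map_add, LinearMap.add_apply]
  | single v₀ x =>
    induction Ψ using Finsupp.induction_linear with
    | zero => simp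
    | add Ψ Ψ' h h' =>
      rw [map_add, Finsupp.add_apply, h, h', ← finsum_add_distrib (hfin _ Ψ) (hfin _ Ψ')]
      simp only [Finsupp.add_apply, map_add, smul_add]
    | single w₀ y =>
      rw [preConvMap_single, Finsupp.single_apply]
      by_cases h : BisetProd.mk Γ v₀ w₀ = BisetProd.mk Γ v w
      · rw [if_pos h]
        obtain ⟨γ, h1, h2⟩ := Quotient.exact (s := bisetSetoid Γ V W) h.symm
        change v₀ = op γ • v at h1
        change w₀ = γ⁻¹ • w at h2
        rw [finsum_eq_single _ γ fun δ hδ => ?_]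
        · rw [← h1, ← h2, Finsupp.single_eq_same, Finsupp.single_eq_same, h1, anchor_op_smul,
            mul_smul]
          rfl
        · rw [Finsupp.single_eq_of_ne fun h' => hδ (op_smul_injective v (h'.trans h1)), map_zero,
            LinearMap.zero_apply]
      · rw [if_neg h]
        refine (finsum_eq_zero_of_forall_eq_zero fun γ => ?_).symm
        by_contra hne
        obtain ⟨h1, h2⟩ := hsub _ _ hne
        rw [Finsupp.single_apply_ne_zero] at h1 h2
        refine h ?_
        rw [← h1.1, ← h2.1, BisetProd.mk_eq]

theorem convMap_rightConv (f : Γ →₀ C) (ξ : BalancedTensor Γ B C V W X Y) :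
    convMap Γ B C V W X Y (rightConv Γ B C V W X Y f ξ) = rconv (convMap Γ B C V W X Y ξ) f := by
  induction ξ using induction_single with
  | h0 => simp
  | hadd ξ ξ' h h' => simp only [map_add, LinearMap.add_apply, h, h']
  | h v x w y =>
    rw [rightConv_tmul, convMap_tmul, convMap_tmul, preConvMap_single]
    induction f using Finsupp.induction_linear with
    | zero => simp
    | add f f' h h' => simp only [map_add, h, h']
    | single γ c =>
      rw [rconv_single, preConvMap_single, rconv_single, BisetProd.op_smul_mk,
        InteriorTensor.rsmul_tmul, EquivariantModule.smul_rsmul, ← mul_smul]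
      rfl

/-- For one-point functions at (v, w) and (v', w') both sides vanish unless v' = vε and wδ = εw' for
some ε and δ; freeness makes these unique. In that case [v', w'] = [v, w]δ, and the two values agree
because m(v)⁻¹ distributes over the inner product of X ⊗_B Y. -/
theorem inn_convMap (ξ η : BalancedTensor Γ B C V W X Y) :
    inn Γ C (convMap Γ B C V W X Y ξ) (convMap Γ B C V W X Y η) = form Γ B C V W X Y ξ η := by
  induction ξ using induction_single with
  | h0 => simp [inn_zero_left]
  | hadd ξ ξ' h h' => simp only [map_add, LinearMap.add_apply, inn_add_left, h, h']
  | h v x w y =>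
    induction η using induction_single with
    | h0 => simp [inn_zero_right]
    | hadd ξ ξ' h h' => simp only [map_add, inn_add_right, h, h']
    | h v' x' w' y' =>
      rw [form_tmul, convMap_tmul, convMap_tmul, preConvMap_single, preConvMap_single]
      by_cases h : ∃ ε : Γ, op ε • v = v'
      · obtain ⟨ε, rfl⟩ := h
        have hm := BisetProd.mk_eq (Γ := Γ) v (ε • w') ε
        rw [inv_smul_smul] at hm
        rw [inn_single_eq, lconv_single, hm]
        by_cases h' : ∃ δ : Γ, op δ • w = ε • w'
        · obtain ⟨δ, h'⟩ := h'
          rw [← h', ← BisetProd.op_smul_mk, inn_single_eq, inn_single_eq, InteriorTensor.ip_tmul]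
          have ha : anchor Γ (BisetProd.mk Γ v w) = anchor Γ v * anchor Γ w := rfl
          rw [ha, mul_inv_rev, mul_smul, EquivariantModule.smul_ip, inv_smul_smul,
            EquivariantBimodule.smul_lact, anchor_op_smul, mul_smul, inv_smul_smul]
          rfl
        · push Not at h'
          rw [inn_single_ne h', inn_single_ne]
          intro δ hδ
          rw [BisetProd.op_smul_mk] at hδ
          obtain ⟨ζ, h1, h2⟩ := Quotient.exact (s := bisetSetoid Γ V W) hδ
          change v = op ζ • v at h1
          change ε • w' = ζ⁻¹ • op δ • w at h2
          -- The two representatives have the same first entry v, so freeness forces the connecting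
          -- element to be trivial, and then wδ = εw', which was excluded.
          have hζ : ζ = 1 := op_smul_injective v (by
            change op ζ • v = op 1 • v
            rw [← h1, MulOpposite.op_one, one_smul])
          rw [hζ, inv_one, one_smul] at h2
          exact h' δ h2.symm
      · push Not at h
        rw [inn_single_ne h, map_zero, LinearMap.zero_apply, inn_zero_right, inn_single_ne]
        intro δ hδ
        rw [BisetProd.op_smul_mk] at hδ
        obtain ⟨ζ, h1, -⟩ := Quotient.exact (s := bisetSetoid Γ V W) hδ
        exact h ζ h1.symm

/-- The range contains every δ_[v,w] (x ⊗ y). Values of functions in C_c(V ×_Γ W, X ⊗_B Y) lie in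
the completed tensor product, so a closure is needed already at a single point; it is harmless
because the inclusion of the functions supported at one point is contractive. -/
theorem denseRange_convMap : DenseRange fun ξ : BalancedTensor Γ B C V W X Y =>
    (ccPre Γ C (BisetProd Γ V W) (BimoduleTensor B C X Y)).toCompletion
      (convMap Γ B C V W X Y ξ) := by
  let P := ccPre Γ C (BisetProd Γ V W) (BimoduleTensor B C X Y)
  let R : Submodule ℂ P.Completion :=
    (LinearMap.range (P.toCompletion ∘ₗ convMap Γ B C V W X Y)).topologicalClosure
  have hR : ∀ ξ, P.toCompletion (convMap Γ B C V W X Y ξ) ∈ R := fun ξ =>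
    Submodule.le_topologicalClosure _ ⟨ξ, rfl⟩
  have hcl : IsClosed (R : Set P.Completion) := Submodule.isClosed_topologicalClosure _
  have h1 : ∀ q z, P.toCompletion (single q z) ∈ R := by
    intro q z
    induction q using BisetProd.ind with
    | h v w =>
      refine PreHilbert.ind (p := fun z => ccSingle Γ C _ (BisetProd.mk Γ v w) z ∈ R) _
        (hcl.preimage (ccSingle Γ C _ _).continuous) (fun t => ?_) z
      induction t with
      | zero => rw [map_zero, map_zero]; exact R.zero_mem
      | add t₁ t₂ h₁ h₂ => rw [map_add, map_add]; exact R.add_mem h₁ h₂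
      | tmul x y =>
        -- The factor m(v)⁻¹ cancels the twist m(v) in the definition of α.
        have h := hR (tmul Γ B C (single v x) (single w ((anchor Γ v)⁻¹ • y)))
        rwa [convMap_tmul, preConvMap_single, smul_inv_smul] at h
  have h2 : ∀ z, z ∈ R := P.ind hcl fun Ω => by
    induction Ω using Finsupp.induction_linear with
    | zero => rw [map_zero]; exact R.zero_mem
    | add t₁ t₂ h₁ h₂ => rw [map_add]; exact R.add_mem h₁ h₂
    | single q z => exact h1 q z
  exact fun z => h2 z

end convMap

section left

variable [HilbertBimodule A B X] [EquivariantBimodule S A B X]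

variable {Γ B C V W X Y}

theorem convMap_leftConv (f : Γ →₀ A)
    (ξ : BalancedTensor Γ B C V W X Y) :
    convMap Γ B C V W X Y (leftConv Γ B C V W X Y f ξ) = lconv C f (convMap Γ B C V W X Y ξ) := by
  induction ξ using induction_single with
  | h0 => simp
  | hadd ξ ξ' h h' => simp only [map_add, h, h']
  | h v x w y =>
    rw [leftConv_tmul, convMap_tmul, convMap_tmul, preConvMap_single]
    induction f using Finsupp.induction_linear with
    | zero => simp
    | add f f' h h' => simp only [map_add, LinearMap.add_apply, h, h']
    | single γ a =>
      rw [lconv_single, preConvMap_single, lconv_single, BisetProd.smul_mk, anchor_smul, mul_smul]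
      congr 1
      -- Here the diagonal action on X ⊗_B Y is used: m(γv) = γm(v) makes γ act on both tensor
      -- factors.
      have h : γ • (InteriorTensor.tmul lact x (anchor Γ v • y) : BimoduleTensor B C X Y) =
          InteriorTensor.tmul lact (γ • x) (γ • anchor Γ v • y) :=
        InteriorTensor.smulL_coe (γ : S) _
      rw [h]
      exact (InteriorTensor.leftHom_tmul lact _ _ _).symm

end left

end BalancedTensor

end

noncomputable section

set_option linter.unusedSectionVars false

open HilbertModule HilbertBimodule AnchoredBiset
open Finsupp (single)

/-! ### The interior tensor product of the completions and the unitary U -/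

namespace BalancedTensor

variable {S : Type*} [Group S] (Γ : Subgroup S) {A : Type*} (B C V W X Y : Type*)
  [NonUnitalCStarAlgebra A] [NonUnitalCStarAlgebra B] [NonUnitalCStarAlgebra C]
  [CStarAction S A] [CStarAction S B] [CStarAction S C]
  [MulAction Γ V] [MulAction Γᵐᵒᵖ V] [AnchoredBiset Γ V]
  [MulAction Γ W] [MulAction Γᵐᵒᵖ W] [AnchoredBiset Γ W]
  [NormedAddCommGroup X] [NormedSpace ℂ X] [CompleteSpace X]
  [HilbertModule B X] [DistribMulAction S X]
  [NormedAddCommGroup Y] [NormedSpace ℂ Y] [CompleteSpace Y]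
  [HilbertModule C Y] [HilbertBimodule B C Y] [DistribMulAction S Y] [EquivariantBimodule S B C Y]

section toInterior

variable [EquivariantModule S B X]

/-- The canonical map from the balanced tensor product of `C_c(V, X)` and `C_c(W, Y)` to the
interior tensor product of the completions. -/
def toInterior : BalancedTensor Γ B C V W X Y →ₗ[ℂ]
    InteriorTensor (CcCompletion Γ B V X) (crossedRep Γ B C W Y) :=
  (balancing Γ B C V W X Y).liftQ
    (TensorProduct.lift ((InteriorTensor.tmulₗ (CcCompletion Γ B V X)
      (crossedRep Γ B C W Y)).compl₁₂ (ccPre Γ B V X).toCompletion (ccPre Γ C W Y).toCompletion))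
    -- Balancing over C_c(Γ, B) is the special case of balancing over B ⋊_r Γ in the interior tensor
    -- product, once both actions are identified with convolution.
    (lift_ker fun Φ f Ψ => by
      change InteriorTensor.tmul _ ((ccPre Γ B V X).toCompletion (rconv Φ f)) _ =
        InteriorTensor.tmul _ _ ((ccPre Γ C W Y).toCompletion (lconv C f Ψ))
      rw [← rsmul_toCompletion, InteriorTensor.tmul_rsmul, crossedRep_ofCc])

variable {Γ B C V W X Y}

theorem toInterior_tmul (Φ : V →₀ X) (Ψ : W →₀ Y) :
    toInterior Γ B C V W X Y (tmul Γ B C Φ Ψ) =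
      InteriorTensor.tmul (crossedRep Γ B C W Y) ((ccPre Γ B V X).toCompletion Φ)
        ((ccPre Γ C W Y).toCompletion Ψ) := rfl

theorem ip_toInterior (ξ η : BalancedTensor Γ B C V W X Y) :
    ip (B := ReducedCrossedProduct Γ C) (toInterior Γ B C V W X Y ξ)
      (toInterior Γ B C V W X Y η) = ofCc Γ C (form Γ B C V W X Y ξ η) := by
  induction ξ using induction_tmul with
  | h0 => rw [map_zero, ip_zero_left, map_zero, LinearMap.zero_apply, map_zero]
  | hadd ξ ξ' h h' => rw [map_add, ip_add_left, h, h', map_add, LinearMap.add_apply, map_add]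
  | h Φ Ψ =>
    induction η using induction_tmul with
    | h0 => rw [map_zero, ip_zero_right, map_zero, map_zero]
    | hadd ξ ξ' h h' => rw [map_add, ip_add_right, h, h', map_add, map_add]
    | h Φ' Ψ' =>
      rw [toInterior_tmul, toInterior_tmul, InteriorTensor.ip_tmul, ip_toCompletion,
        crossedRep_ofCc, ip_toCompletion, form_tmul]

theorem toInterior_rightConv (f : Γ →₀ C) (ξ : BalancedTensor Γ B C V W X Y) :
    toInterior Γ B C V W X Y (rightConv Γ B C V W X Y f ξ) =
      rsmul (toInterior Γ B C V W X Y ξ) (ofCc Γ C f) := by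
  induction ξ using induction_tmul with
  | h0 =>
    rw [map_zero, map_zero]
    exact (zero_rsmul (B := ReducedCrossedProduct Γ C) _).symm
  | hadd ξ ξ' h h' =>
    rw [map_add, map_add, map_add, h, h']
    exact (add_rsmul (B := ReducedCrossedProduct Γ C) _ _ _).symm
  | h Φ Ψ =>
    rw [rightConv_tmul, toInterior_tmul, toInterior_tmul, InteriorTensor.rsmul_tmul,
      rsmul_toCompletion]

/-- Elementary tensors of vectors from C_c(V, X) and C_c(W, Y) lie in the range. Continuity of ⊗ in
each factor extends this to tensors of arbitrary vectors in the closure, and these span a dense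
subspace. -/
theorem denseRange_toInterior : DenseRange (toInterior Γ B C V W X Y) := by
  let φ := crossedRep Γ B C W Y
  let R : Submodule ℂ (InteriorTensor (CcCompletion Γ B V X) φ) :=
    (LinearMap.range (toInterior Γ B C V W X Y)).topologicalClosure
  have hcl : IsClosed (R : Set (InteriorTensor (CcCompletion Γ B V X) φ)) :=
    Submodule.isClosed_topologicalClosure _
  have h0 : ∀ Φ Ψ, InteriorTensor.tmul φ ((ccPre Γ B V X).toCompletion Φ)
      ((ccPre Γ C W Y).toCompletion Ψ) ∈ R := fun Φ Ψ =>
    Submodule.le_topologicalClosure (LinearMap.range (toInterior Γ B C V W X Y))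
      (LinearMap.mem_range_self _ (tmul Γ B C Φ Ψ))
  have h1 : ∀ x y, InteriorTensor.tmul φ x y ∈ R := fun x y =>
    (ccPre Γ B V X).ind (p := fun x => InteriorTensor.tmul φ x y ∈ R)
      (hcl.preimage ((InteriorTensor.continuous_tmul φ).comp (Continuous.prodMk_left y)))
      (fun Φ => (ccPre Γ C W Y).ind (p := fun y => InteriorTensor.tmul φ _ y ∈ R)
        (hcl.preimage ((InteriorTensor.continuous_tmul φ).comp (Continuous.prodMk_right _)))
        (h0 Φ) y) x
  have h2 : ∀ z, z ∈ R := (InteriorTensor.pre (CcCompletion Γ B V X) φ).ind hcl fun t => by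
    induction t with
    | zero => rw [map_zero]; exact R.zero_mem
    | add t₁ t₂ h₁ h₂ => rw [map_add]; exact R.add_mem h₁ h₂
    | tmul x y => exact h1 x y
  exact fun z => h2 z

variable (Γ B C V W X Y) in
/-- The unitary isomorphism induced by `convMap`. -/
def interiorEquiv : InteriorTensor (CcCompletion Γ B V X) (crossedRep Γ B C W Y) ≃ₗᵢ[ℂ]
    CcCompletion Γ C (BisetProd Γ V W) (BimoduleTensor B C X Y) :=
  (LinearEquiv.refl ℂ (BalancedTensor Γ B C V W X Y)).extendOfIsometry
    (toInterior Γ B C V W X Y)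
    ((ccPre Γ C (BisetProd Γ V W) (BimoduleTensor B C X Y)).toCompletion ∘ₗ
      convMap Γ B C V W X Y) denseRange_toInterior denseRange_convMap fun ξ => by
    -- Both norms of ξ come from the same C_c(Γ, C)-valued form, so the identity of the balanced
    -- tensor product is isometric between the two dense images. No injectivity of j is needed.
    rw [norm_eq_sqrt (B := ReducedCrossedProduct Γ C) (toInterior Γ B C V W X Y ξ), ip_toInterior,
      ← inn_convMap]
    exact PreHilbert.norm_toCompletion _ _

theorem interiorEquiv_toInterior (ξ : BalancedTensor Γ B C V W X Y) :
    interiorEquiv Γ B C V W X Y (toInterior Γ B C V W X Y ξ) =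
      (ccPre Γ C (BisetProd Γ V W) (BimoduleTensor B C X Y)).toCompletion
        (convMap Γ B C V W X Y ξ) :=
  LinearEquiv.extendOfIsometry_eq _ _ _ _ _ _ ξ

theorem ip_interiorEquiv
    (x y : InteriorTensor (CcCompletion Γ B V X) (crossedRep Γ B C W Y)) :
    ip (B := ReducedCrossedProduct Γ C) (interiorEquiv Γ B C V W X Y x)
      (interiorEquiv Γ B C V W X Y y) = ip x y := by
  refine denseRange_toInterior.induction_on₂ (p := fun x y =>
    ip (B := ReducedCrossedProduct Γ C) (interiorEquiv Γ B C V W X Y x)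
      (interiorEquiv Γ B C V W X Y y) = ip x y) (isClosed_eq ?_ ?_) (fun ξ η => ?_) x y
  · exact PreHilbert.continuous_cip_comp _
      ((interiorEquiv Γ B C V W X Y).continuous.comp continuous_fst)
      ((interiorEquiv Γ B C V W X Y).continuous.comp continuous_snd)
  · exact PreHilbert.continuous_cip _
  · rw [interiorEquiv_toInterior, interiorEquiv_toInterior, ip_toCompletion, ip_toInterior,
      inn_convMap]

theorem interiorEquiv_rsmul (x : InteriorTensor (CcCompletion Γ B V X) (crossedRep Γ B C W Y))
    (d : ReducedCrossedProduct Γ C) :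
    interiorEquiv Γ B C V W X Y (rsmul x d) = rsmul (interiorEquiv Γ B C V W X Y x) d := by
  refine ext_ip (ReducedCrossedProduct Γ C) fun z => ?_
  -- Surjectivity of U allows testing against vectors Uw only, so right linearity follows from
  -- preservation of inner products.
  obtain ⟨w, rfl⟩ := (interiorEquiv Γ B C V W X Y).surjective z
  rw [ip_interiorEquiv, ip_rsmul_right, ip_rsmul_right, ip_interiorEquiv]

end toInterior

section left

variable [HilbertBimodule A B X] [EquivariantBimodule S A B X]

variable {Γ B C V W X Y}

theorem toInterior_leftConv (f : Γ →₀ A) (ξ : BalancedTensor Γ B C V W X Y) :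
    toInterior Γ B C V W X Y (leftConv Γ B C V W X Y f ξ) =
      InteriorTensor.leftHom (crossedRep Γ B C W Y) (crossedRep Γ A B V X (ofCc Γ A f))
        (toInterior Γ B C V W X Y ξ) := by
  induction ξ using induction_tmul with
  | h0 => simp only [map_zero]
  | hadd ξ ξ' h h' => simp only [map_add, h, h']
  | h Φ Ψ =>
    rw [leftConv_tmul, toInterior_tmul, toInterior_tmul, InteriorTensor.leftHom_tmul,
      crossedRep_ofCc]

/-- Continuity in a, then in x, reduces the claim to a from the convolution algebra and x in the
range of j, where it says that α intertwines the left convolutions. -/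
theorem interiorEquiv_leftHom (a : ReducedCrossedProduct Γ A)
    (x : InteriorTensor (CcCompletion Γ B V X) (crossedRep Γ B C W Y)) :
    interiorEquiv Γ B C V W X Y
        (InteriorTensor.leftHom (crossedRep Γ B C W Y) (crossedRep Γ A B V X a) x) =
      crossedRep Γ A C (BisetProd Γ V W) (BimoduleTensor B C X Y) a
        (interiorEquiv Γ B C V W X Y x) := by
  -- A *-homomorphism between C*-algebras is contractive, so a ↦ ρ(a)z is bounded with constant ‖z‖.
  have hcont : ∀ {D Z : Type _} [NonUnitalCStarAlgebra D] [NormedAddCommGroup Z]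
      [NormedSpace ℂ Z] [CompleteSpace Z] [HilbertModule D Z]
      (ρ : ReducedCrossedProduct Γ A →⋆ₙₐ[ℂ] Adj D Z) (z : Z), Continuous fun a => ρ a z := by
    intro D Z _ _ _ _ _ ρ z
    let F : ReducedCrossedProduct Γ A →ₗ[ℂ] Z :=
      { toFun := fun a => ρ a z
        map_add' := fun a b => InteriorTensor.φ_add_apply ρ a b z
        map_smul' := fun c a => InteriorTensor.φ_smul_apply ρ c a z }
    exact (F.mkContinuous ‖z‖ fun a => by
      rw [mul_comm]
      refine (Adj.norm_apply_le _ _).trans ?_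
      gcongr
      exact NonUnitalStarAlgHom.norm_apply_le ρ a).continuous
  refine denseRange_ofCc.induction_on (p := fun a => interiorEquiv Γ B C V W X Y
    (InteriorTensor.leftHom (crossedRep Γ B C W Y) (crossedRep Γ A B V X a) x) =
      crossedRep Γ A C (BisetProd Γ V W) (BimoduleTensor B C X Y) a
        (interiorEquiv Γ B C V W X Y x)) a (isClosed_eq ?_ ?_) fun f => ?_
  · exact (interiorEquiv Γ B C V W X Y).continuous.comp
      (hcont ((InteriorTensor.leftHom (crossedRep Γ B C W Y)).comp (crossedRep Γ A B V X)) x)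
  · exact hcont (crossedRep Γ A C (BisetProd Γ V W) (BimoduleTensor B C X Y)) _
  refine denseRange_toInterior.induction_on (p := fun x => interiorEquiv Γ B C V W X Y
    (InteriorTensor.leftHom (crossedRep Γ B C W Y) (crossedRep Γ A B V X (ofCc Γ A f)) x) =
      crossedRep Γ A C (BisetProd Γ V W) (BimoduleTensor B C X Y) (ofCc Γ A f)
        (interiorEquiv Γ B C V W X Y x)) x (isClosed_eq ?_ ?_) fun ξ => ?_
  · exact (interiorEquiv Γ B C V W X Y).continuous.comp (Adj.toCLM _).continuous
  · exact (Adj.toCLM _).continuous.comp (interiorEquiv Γ B C V W X Y).continuous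
  · rw [← toInterior_leftConv, interiorEquiv_toInterior, interiorEquiv_toInterior,
      convMap_leftConv, crossedRep_ofCc]

end left

end BalancedTensor

end

/-! ### The proposition, for Γ regarded as a subgroup of S -/

theorem mainTheorem9 {G : Type*} [Group G] (Γ S : Subgroup G) (hΓS : Γ ≤ S)
    (hS : S ≤ Subgroup.Commensurable.commensurator Γ)
    {A B C V W X Y : Type*}
    -- the `S`-C*-algebras
    [NonUnitalCStarAlgebra A] [NonUnitalCStarAlgebra B] [NonUnitalCStarAlgebra C]
    [CStarAction S A] [CStarAction S B] [CStarAction S C]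
    -- the `S`-anchored bi-`Γ`-sets
    [MulAction (Γ.subgroupOf S) V] [MulAction (Γ.subgroupOf S)ᵐᵒᵖ V]
    [AnchoredBiset (Γ.subgroupOf S) V]
    [MulAction (Γ.subgroupOf S) W] [MulAction (Γ.subgroupOf S)ᵐᵒᵖ W]
    [AnchoredBiset (Γ.subgroupOf S) W]
    -- the `S`-equivariant `(A, B)`-bimodule `X`
    [NormedAddCommGroup X] [NormedSpace ℂ X] [CompleteSpace X] [HilbertModule B X]
    [HilbertBimodule A B X] [DistribMulAction S X] [EquivariantBimodule S A B X]
    -- the `S`-equivariant `(B, C)`-bimodule `Y`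
    [NormedAddCommGroup Y] [NormedSpace ℂ Y] [CompleteSpace Y] [HilbertModule C Y]
    [HilbertBimodule B C Y] [DistribMulAction S Y] [EquivariantBimodule S B C Y] :
    ∃ α : BalancedTensor (Γ.subgroupOf S) B C V W X Y →ₗ[ℂ]
        (BisetProd (Γ.subgroupOf S) V W →₀ BimoduleTensor B C X Y),
      -- the formula for `α`
      (∀ (Φ : V →₀ X) (Ψ : W →₀ Y) (v : V) (w : W),
        {γ : Γ.subgroupOf S | Φ (op γ • v) ≠ 0 ∧ Ψ (γ⁻¹ • w) ≠ 0}.Finite ∧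
        α (BalancedTensor.tmul (Γ.subgroupOf S) B C Φ Ψ) (BisetProd.mk (Γ.subgroupOf S) v w) =
          ∑ᶠ γ : Γ.subgroupOf S, InteriorTensor.tmul HilbertBimodule.lact (Φ (op γ • v))
            (AnchoredBiset.anchor (Γ.subgroupOf S) v • γ • Ψ (γ⁻¹ • w))) ∧
      -- `α` is a bimodule map
      (∀ (f : Γ.subgroupOf S →₀ A) ξ,
        α (BalancedTensor.leftConv (Γ.subgroupOf S) B C V W X Y f ξ) = lconv C f (α ξ)) ∧
      (∀ (f : Γ.subgroupOf S →₀ C) ξ,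
        α (BalancedTensor.rightConv (Γ.subgroupOf S) B C V W X Y f ξ) = rconv (α ξ) f) ∧
      -- `α` preserves the inner products
      (∀ ξ η, inn (Γ.subgroupOf S) C (α ξ) (α η) =
        BalancedTensor.form (Γ.subgroupOf S) B C V W X Y ξ η) ∧
      -- `α` has dense range
      DenseRange (fun ξ => (ccPre (Γ.subgroupOf S) C (BisetProd (Γ.subgroupOf S) V W)
        (BimoduleTensor B C X Y)).toCompletion (α ξ)) ∧
      -- the left actions of the reduced crossed products on the completions
      ∃ (lV : ReducedCrossedProduct (Γ.subgroupOf S) A →⋆ₙₐ[ℂ]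
          Adj (ReducedCrossedProduct (Γ.subgroupOf S) B) (CcCompletion (Γ.subgroupOf S) B V X))
        (lW : ReducedCrossedProduct (Γ.subgroupOf S) B →⋆ₙₐ[ℂ]
          Adj (ReducedCrossedProduct (Γ.subgroupOf S) C) (CcCompletion (Γ.subgroupOf S) C W Y))
        (lVW : ReducedCrossedProduct (Γ.subgroupOf S) A →⋆ₙₐ[ℂ]
          Adj (ReducedCrossedProduct (Γ.subgroupOf S) C)
            (CcCompletion (Γ.subgroupOf S) C (BisetProd (Γ.subgroupOf S) V W)
              (BimoduleTensor B C X Y))),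
        (∀ (f : Γ.subgroupOf S →₀ A) (Φ : V →₀ X),
          lV (ofCc (Γ.subgroupOf S) A f) ((ccPre (Γ.subgroupOf S) B V X).toCompletion Φ) =
            (ccPre (Γ.subgroupOf S) B V X).toCompletion (lconv B f Φ)) ∧
        (∀ (f : Γ.subgroupOf S →₀ B) (Ψ : W →₀ Y),
          lW (ofCc (Γ.subgroupOf S) B f) ((ccPre (Γ.subgroupOf S) C W Y).toCompletion Ψ) =
            (ccPre (Γ.subgroupOf S) C W Y).toCompletion (lconv C f Ψ)) ∧
        (∀ (f : Γ.subgroupOf S →₀ A)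
            (Ω : BisetProd (Γ.subgroupOf S) V W →₀ BimoduleTensor B C X Y),
          lVW (ofCc (Γ.subgroupOf S) A f) ((ccPre (Γ.subgroupOf S) C
              (BisetProd (Γ.subgroupOf S) V W) (BimoduleTensor B C X Y)).toCompletion Ω) =
            (ccPre (Γ.subgroupOf S) C (BisetProd (Γ.subgroupOf S) V W)
              (BimoduleTensor B C X Y)).toCompletion (lconv C f Ω)) ∧
        -- the interior tensor product of the completions is the completion of the algebraic one
        ∃ j : BalancedTensor (Γ.subgroupOf S) B C V W X Y →ₗ[ℂ]
            InteriorTensor (CcCompletion (Γ.subgroupOf S) B V X) lW,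
          (∀ (Φ : V →₀ X) (Ψ : W →₀ Y),
            j (BalancedTensor.tmul (Γ.subgroupOf S) B C Φ Ψ) =
              InteriorTensor.tmul lW ((ccPre (Γ.subgroupOf S) B V X).toCompletion Φ)
                ((ccPre (Γ.subgroupOf S) C W Y).toCompletion Ψ)) ∧
          (∀ ξ η, HilbertModule.ip (j ξ) (j η) = ofCc (Γ.subgroupOf S) C
            (BalancedTensor.form (Γ.subgroupOf S) B C V W X Y ξ η)) ∧
          (∀ (f : Γ.subgroupOf S →₀ A) ξ,
            j (BalancedTensor.leftConv (Γ.subgroupOf S) B C V W X Y f ξ) =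
              InteriorTensor.leftHom lW (lV (ofCc (Γ.subgroupOf S) A f)) (j ξ)) ∧
          (∀ (f : Γ.subgroupOf S →₀ C) ξ,
            j (BalancedTensor.rightConv (Γ.subgroupOf S) B C V W X Y f ξ) =
              HilbertModule.rsmul (j ξ) (ofCc (Γ.subgroupOf S) C f)) ∧
          DenseRange j ∧
          -- the unitary isomorphism of bimodules induced by `α`
          ∃ U : InteriorTensor (CcCompletion (Γ.subgroupOf S) B V X) lW ≃ₗᵢ[ℂ]
              CcCompletion (Γ.subgroupOf S) C (BisetProd (Γ.subgroupOf S) V W)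
                (BimoduleTensor B C X Y),
            (∀ ξ, U (j ξ) = (ccPre (Γ.subgroupOf S) C (BisetProd (Γ.subgroupOf S) V W)
              (BimoduleTensor B C X Y)).toCompletion (α ξ)) ∧
            (∀ x y, HilbertModule.ip (B := ReducedCrossedProduct (Γ.subgroupOf S) C)
              (U x) (U y) = HilbertModule.ip x y) ∧
            (∀ x (d : ReducedCrossedProduct (Γ.subgroupOf S) C),
              U (HilbertModule.rsmul x d) = HilbertModule.rsmul (U x) d) ∧
            (∀ (a : ReducedCrossedProduct (Γ.subgroupOf S) A) x,
              U (InteriorTensor.leftHom lW (lV a) x) = lVW a (U x)) := by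
  -- All three left actions are instances of `crossedRep`; the third is taken for the bi-Γ-set V ×_Γ
  -- W and the (A, C)-bimodule X ⊗_B Y.
  exact ⟨BalancedTensor.convMap (Γ.subgroupOf S) B C V W X Y,
    fun Φ Ψ v w => ⟨BalancedTensor.finite_setOf_convMap_ne_zero _ Φ Ψ v w,
      BalancedTensor.preConvMap_apply Φ Ψ v w⟩,
    BalancedTensor.convMap_leftConv, BalancedTensor.convMap_rightConv, BalancedTensor.inn_convMap,
    BalancedTensor.denseRange_convMap, crossedRep _ A B V X, crossedRep _ B C W Y,
    crossedRep _ A C _ _, crossedRep_ofCc, crossedRep_ofCc, crossedRep_ofCc,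
    BalancedTensor.toInterior _ B C V W X Y, BalancedTensor.toInterior_tmul,
    BalancedTensor.ip_toInterior, BalancedTensor.toInterior_leftConv,
    BalancedTensor.toInterior_rightConv, BalancedTensor.denseRange_toInterior,
    BalancedTensor.interiorEquiv _ B C V W X Y, BalancedTensor.interiorEquiv_toInterior,
    BalancedTensor.ip_interiorEquiv, BalancedTensor.interiorEquiv_rsmul,
    BalancedTensor.interiorEquiv_leftHom⟩
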